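/- Let $FL_2=\{(w,W)\in S^5\times Gr_{\mathbb C}(2,\mathbb C^3): w\in W\}$, with base point $q_0=(e_1,\mathrm{span}\{e_1,e_2\})$, and let $\pi:S^5\to\mathbb{CP}^2$ be the Hopf map. Put $\epsilon=e^{2\pi i/3}$, $S=\mathrm{diag}(1,\epsilon,\epsilon^2)$, let $T$ be the permutation matrix $e_1\mapsto e_1$, $e_2\mapsto e_3$, $e_3\mapsto e_2$, and define automorphisms of $SU_3$ by $\nu(g)=SgS^{-1}$, $\mu(g)=T(g^{-1})^tT^{-1}$, $\sigma=\mu\nu$. Then $SU_3$ acts transitively on $FL_2$, $\mu$ and $\nu$ commute, $\sigma$ has order six, and the isotropy group of $q_0$ is the fixed point group of $\sigma$, $K_2=\{\mathrm{diag}(1,a,a^{-1})\}$; so $FL_2=SU_3/K_2$ is a 6-symmetric space. Let $\mathfrak g_j\subset\mathfrak{sl}_3(\mathbb C)$ be the eigenspace of (the differential of) $\sigma$ for the eigenvalue $(-\epsilon)^j$, $\mathfrak p_2=\mathfrak{su}_3\cap\bigoplus_{j\ne0}\mathfrak g_j$, and $[\mathfrak g_1]_q=\mathrm{Ad}\,g\cdot\mathfrak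 g_1$, $[\mathfrak p_2]_q=\mathrm{Ad}\,g\cdot\mathfrak p_2$ for $q=g\cdot q_0$; identify $T_qFL_2$ with $[\mathfrak p_2]_q$ by $X\mapsto \frac{d}{dt}(e^{tX}\cdot q)|_{t=0}$. A smooth immersion $\psi:M\to FL_2$ of a Riemann surface is called primitive if $d\psi(\partial/\partial z)\in[\mathfrak g_1]_\psi$ for every local complex coordinate $z$. Let $M$ be a connected Riemann surface. A minimal immersion of $M$ means a conformal harmonic immersion (for the round metric of $S^5$, the Fubini--Study metric of $\mathbb{CP}^2$). (1) Let $\varphi:M\to\mathbb{CP}^2$ be a minimal Lagrangian immersion which has a horizontal lift $f:M\to S^5$, let $\ell_0\subset M\times\mathbb C^3$ be the pull-back by $\varphi$ of the tautological line bundle and $\ell_1=\pi_{\ell_0}^\perp(\frac{\partial}{\partial z}\ell_0)$. Then there is a constant $a\in\mathbb C$, $|a|=1$, such that for the horizontal lift $f'=af$ of $\varphi$ the map $\psi_2=(f',\ell_0\oplus\ell_1):M\to FL_2$ is well defined, primitive, and harmonic for the normal $SU_3$-invariant metric of $FL_2$ (the one given by $-\mathrm{tr}(XY)$ on $\mathfrak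 p_2$). (2) Conversely, let $\psi=(f,W):M\to FL_2$ be any primitive map. Then $f:M\to S^5$ is a smooth, weakly conformal, harmonic map that is horizontal (isotropic for the contact structure), and $\varphi=\pi\circ f:M\to\mathbb{CP}^2$ is a smooth, weakly conformal, harmonic map with $\varphi^*\omega=0$ for the Fubini--Study Kähler form $\omega$. At every point where $df\neq0$ both $df$ and $d\varphi$ are injective. In particular, if $f$ is an immersion, then $f$ is a minimal Legendrian immersion and $\varphi$ is a minimal Lagrangian immersion. -/

import Mathlib

open Complex Module
open scoped Matrix Manifold ContDiff LinearAlgebra.Projectivization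

noncomputable section

namespace MinLag

/-! ### The spaces `ℂ³`, `S⁵`, `ℂP²`, the group `SU₃` and the flag space `FL₂` -/

/-- `ℂ³` with its standard Hermitian inner product. -/
abbrev V : Type := EuclideanSpace ℂ (Fin 3)

/-- The unit sphere `S⁵ ⊂ ℂ³`. -/
abbrev S5 : Type := Metric.sphere (0 : V) 1

/-- The complex projective plane, as the set of complex lines in `ℂ³`. -/
abbrev CP2 : Type := ℙ ℂ V

/-- Complex `3 × 3` matrices. -/
abbrev Mat : Type := Matrix (Fin 3) (Fin 3) ℂ

/-- The group `SU₃`. -/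
abbrev SU3 : Type := Matrix.specialUnitaryGroup (Fin 3) ℂ

/-- The operator on `ℂ³` given by a matrix. -/
abbrev op (X : Mat) : V →L[ℂ] V := Matrix.toEuclideanCLM (n := Fin 3) (𝕜 := ℂ) X

/-- The Hopf map `π : S⁵ → ℂP²`. -/
def hopf (w : S5) : CP2 :=
  Projectivization.mk ℂ (w : V) (ne_zero_of_mem_unit_sphere w)

/-- `FL₂ = {(w, W) ∈ S⁵ × Gr_ℂ(2, ℂ³) : w ∈ W}`. -/
@[ext] structure FL2 where
  w : S5
  W : Submodule ℂ V
  finrank_W : finrank ℂ W = 2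
  w_mem : (w : V) ∈ W

/-- The standard equivariant embedding of `FL₂` into a vector space, in which the plane `W` is
represented by the orthogonal projection onto `W`. The smooth structure of `FL₂` is the one
induced by this embedding. -/
def FL2.emb (q : FL2) : V × (V →L[ℂ] V) := (q.w, q.W.starProjection)

/-- The standard equivariant embedding of `ℂP²`: a line is represented by the orthogonal projection
onto it. The smooth structure and (up to a constant factor) the Fubini–Study metric of `ℂP²` are
induced by this embedding. -/
def CP2.emb (ℓ : CP2) : V →L[ℂ] V := ℓ.submodule.starProjection

lemma op_mul_apply (X Y : Mat) (v : V) : op (X * Y) v = op X (op Y v) := by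
  simp [op, map_mul]

lemma op_inv_apply (g : SU3) (v : V) : op ((g⁻¹ : SU3) : Mat) (op (g : Mat) v) = v := by
  rw [← op_mul_apply, ← Submonoid.coe_mul]
  simp

lemma norm_op (g : SU3) (v : V) : ‖op (g : Mat) v‖ = ‖v‖ := by
  have hg : star (g : Mat) * (g : Mat) = 1 :=
    (Matrix.mem_unitaryGroup_iff' (A := (g : Mat))).1 (Matrix.mem_specialUnitaryGroup_iff.1 g.2).1
  have h1 : (ContinuousLinearMap.adjoint (op (g : Mat))) (op (g : Mat) v) = v := by
    rw [← ContinuousLinearMap.star_eq_adjoint]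
    unfold op
    rw [← map_star, ← op, ← op, ← op_mul_apply, hg]
    simp
  have h2 : inner ℂ (op (g : Mat) v) (op (g : Mat) v) = inner ℂ v v := by
    rw [← ContinuousLinearMap.adjoint_inner_left, h1]
  rw [@norm_eq_sqrt_re_inner ℂ, @norm_eq_sqrt_re_inner ℂ _ _ _ _ v, h2]

/-- The action of `SU₃` on `FL₂`: `g · (w, W) = (g w, g W)`. -/
def FL2.act (g : SU3) (q : FL2) : FL2 where
  w := ⟨op (g : Mat) q.w, by simp [norm_op]⟩
  W := q.W.map (op (g : Mat)).toLinearMap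
  finrank_W := by
    have hinj : Function.Injective (op (g : Mat)).toLinearMap :=
      Function.LeftInverse.injective (op_inv_apply g)
    rw [← (Submodule.equivMapOfInjective _ hinj q.W).finrank_eq, q.finrank_W]
  w_mem := Submodule.mem_map_of_mem q.w_mem

/-- The `j`-th vector of the standard unitary basis of `ℂ³` (indices `0, 1, 2`). -/
abbrev stdE (j : Fin 3) : V := EuclideanSpace.single j (1 : ℂ)

/-- The base point `(e₁, span {e₁, e₂})` of `FL₂`. -/
def FL2.base : FL2 where
  w := ⟨stdE 0, by simp⟩
  W := Submodule.span ℂ {stdE 0, stdE 1}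
  finrank_W := by
    have : LinearIndependent ℂ ![stdE 0, stdE 1] := by
      rw [LinearIndependent.pair_iff]
      intro s t h
      have h0 := congrArg (fun v : V => v 0) h
      have h1 := congrArg (fun v : V => v 1) h
      simpa using And.intro h0 h1
    have h2 := finrank_span_eq_card this
    have h3 : Set.range ![stdE 0, stdE 1] = {stdE 0, stdE 1} := by
      simp [Matrix.range_cons, Set.pair_comm]
    rw [h3] at h2
    simpa using h2
  w_mem := Submodule.subset_span (by simp)

/-! ### The order six automorphism and its eigenspaces -/

/-- `ε = exp(2πi/3)`. -/
def eps : ℂ := Complex.exp (2 * Real.pi * I / 3)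

lemma eps_pow_three : eps ^ 3 = 1 := by
  rw [eps, ← Complex.exp_nat_mul, ← Complex.exp_two_pi_mul_I]
  congr 1
  push_cast
  ring

lemma eps_mul_conj : eps * star eps = 1 := by
  have h : eps = Complex.exp (((2 * Real.pi / 3 : ℝ) : ℂ) * I) := by
    rw [eps]; congr 1; push_cast; ring
  rw [Complex.star_def, Complex.mul_conj, Complex.normSq_eq_norm_sq, h,
    Complex.norm_exp_ofReal_mul_I]
  simp

/-- `S = diag(1, ε, ε²)`. -/
def matS : Mat := Matrix.diagonal ![1, eps, eps ^ 2]

lemma matS_mem : matS ∈ Matrix.specialUnitaryGroup (Fin 3) ℂ := by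
  rw [Matrix.mem_specialUnitaryGroup_iff, Matrix.mem_unitaryGroup_iff]
  constructor
  · rw [matS, Matrix.star_eq_conjTranspose, Matrix.diagonal_conjTranspose,
      Matrix.diagonal_mul_diagonal, ← Matrix.diagonal_one]
    congr 1
    ext j
    fin_cases j
    · simp
    · simpa using eps_mul_conj
    · have := eps_mul_conj
      simp only [Complex.star_def] at this
      simp [← mul_pow, this]
  · rw [matS, Matrix.det_diagonal]
    simpa [Fin.prod_univ_three, ← pow_succ'] using eps_pow_three

/-- The permutation matrix `T`: `T e₁ = e₁`, `T e₂ = e₃`, `T e₃ = e₂`. -/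
def matT : Mat := !![1, 0, 0; 0, 0, 1; 0, 1, 0]

lemma matT_mul_self : matT * matT = 1 := by
  ext i j
  fin_cases i <;> fin_cases j <;> simp [matT, Matrix.mul_apply, Fin.sum_univ_three]

lemma matT_inv : matT⁻¹ = matT := Matrix.inv_eq_left_inv matT_mul_self

lemma matT_star : star matT = matT := by
  ext i j
  fin_cases i <;> fin_cases j <;> simp [matT, Matrix.star_apply]

lemma matT_transpose : matTᵀ = matT := by
  ext i j
  fin_cases i <;> fin_cases j <;> simp [matT]

/-- The Coxeter–Killing automorphism `ν(g) = S g S⁻¹` of `SU₃`. -/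
def nu : MulAut SU3 := MulAut.conj ⟨matS, matS_mem⟩

/-- The map `g ↦ T (g⁻¹)ᵗ T⁻¹` on `SU₃`. -/
def muFun (g : SU3) : SU3 := ⟨matT * ((g⁻¹ : SU3) : Mat)ᵀ * matT⁻¹, by
  obtain ⟨hu, hd⟩ := Matrix.mem_specialUnitaryGroup_iff.1 (g⁻¹ : SU3).2
  rw [Matrix.mem_unitaryGroup_iff'] at hu
  have hu' : ((g⁻¹ : SU3) : Mat)ᵀ * (star ((g⁻¹ : SU3) : Mat))ᵀ = 1 := by
    rw [← Matrix.transpose_mul, hu, Matrix.transpose_one]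
  have hs : star (((g⁻¹ : SU3) : Mat)ᵀ) = (star ((g⁻¹ : SU3) : Mat))ᵀ := by
    ext i j; simp [Matrix.star_apply]
  rw [Matrix.mem_specialUnitaryGroup_iff, Matrix.mem_unitaryGroup_iff, matT_inv]
  constructor
  · rw [star_mul, star_mul, matT_star, hs]
    calc matT * ((g⁻¹ : SU3) : Mat)ᵀ * matT * (matT * ((star ((g⁻¹ : SU3) : Mat))ᵀ * matT))
        = matT * ((g⁻¹ : SU3) : Mat)ᵀ * (matT * matT) * (star ((g⁻¹ : SU3) : Mat))ᵀ * matT := by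
          simp only [Matrix.mul_assoc]
      _ = matT * (((g⁻¹ : SU3) : Mat)ᵀ * (star ((g⁻¹ : SU3) : Mat))ᵀ) * matT := by
          rw [matT_mul_self]; simp only [Matrix.mul_assoc, Matrix.one_mul]
      _ = 1 := by rw [hu', Matrix.mul_one, matT_mul_self]
  · rw [Matrix.det_mul, Matrix.det_mul, Matrix.det_transpose, hd, mul_one, ← Matrix.det_mul,
      matT_mul_self, Matrix.det_one]⟩

lemma muFun_muFun (g : SU3) : muFun (muFun g) = g := by
  have hg : (muFun g)⁻¹ = muFun g⁻¹ := by
    apply inv_eq_of_mul_eq_one_right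
    apply Subtype.ext
    simp only [muFun, Submonoid.coe_mul, Submonoid.coe_one, matT_inv, inv_inv]
    calc matT * ((g⁻¹ : SU3) : Mat)ᵀ * matT * (matT * (g : Mat)ᵀ * matT)
        = matT * ((g⁻¹ : SU3) : Mat)ᵀ * (matT * matT) * (g : Mat)ᵀ * matT := by
          simp only [Matrix.mul_assoc]
      _ = matT * ((g : Mat) * ((g⁻¹ : SU3) : Mat))ᵀ * matT := by
          rw [matT_mul_self, Matrix.transpose_mul]
          simp only [Matrix.mul_assoc, Matrix.one_mul]
      _ = 1 := by
          rw [← Submonoid.coe_mul, mul_inv_cancel]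
          simp [matT_mul_self]
  apply Subtype.ext
  change matT * (((muFun g)⁻¹ : SU3) : Mat)ᵀ * matT⁻¹ = g
  rw [hg]
  simp only [muFun, matT_inv, inv_inv, Matrix.transpose_mul, Matrix.transpose_transpose,
    matT_transpose]
  calc matT * (matT * ((g : Mat) * matT)) * matT = (matT * matT) * (g : Mat) * (matT * matT) := by
        simp only [Matrix.mul_assoc]
    _ = g := by rw [matT_mul_self]; simp

/-- The outer involution `μ(g) = T (g⁻¹)ᵗ T⁻¹` of `SU₃`. -/
def mu : MulAut SU3 where
  toFun := muFun
  invFun := muFun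
  left_inv := muFun_muFun
  right_inv := muFun_muFun
  map_mul' g h := by
    apply Subtype.ext
    simp only [muFun, Submonoid.coe_mul, matT_inv, mul_inv_rev, Matrix.transpose_mul]
    calc matT * (((g⁻¹ : SU3) : Mat)ᵀ * ((h⁻¹ : SU3) : Mat)ᵀ) * matT
        = matT * ((g⁻¹ : SU3) : Mat)ᵀ * 1 * ((h⁻¹ : SU3) : Mat)ᵀ * matT := by
          simp only [Matrix.mul_assoc, Matrix.one_mul]
      _ = _ := by rw [← matT_mul_self]; simp only [Matrix.mul_assoc]

/-- The automorphism `σ = μν` of `SU₃`. -/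
def sigma : MulAut SU3 := mu * nu

/-- The differential of `σ` at the identity, extended complex linearly to `𝔤^ℂ`:
`X ↦ -T (S X S⁻¹)ᵗ T⁻¹`. -/
def dsigma : Mat →ₗ[ℂ] Mat where
  toFun X := -(matT * (matS * X * matS⁻¹)ᵀ * matT⁻¹)
  map_add' X Y := by
    simp only [Matrix.mul_add, Matrix.add_mul, Matrix.transpose_add, neg_add]
  map_smul' c X := by
    simp only [Matrix.mul_smul, Matrix.smul_mul, Matrix.transpose_smul, smul_neg, RingHom.id_apply]

/-- `𝔰𝔲₃`: trace-free skew-Hermitian matrices. Its complexification is the space of all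
trace-free matrices. -/
def su3 : Set Mat := {X | Xᴴ = -X ∧ X.trace = 0}

/-- The eigenspace `𝔤_j ⊂ 𝔤^ℂ = 𝔰𝔩₃(ℂ)` of `σ` for the eigenvalue `(-ε)^j`. -/
def gPart (j : ℕ) : Submodule ℂ Mat :=
  LinearMap.ker (Matrix.traceLinearMap (Fin 3) ℂ ℂ) ⊓ Module.End.eigenspace dsigma ((-eps) ^ j)

/-- `𝔭₂^ℂ = ⨁_{j ≠ 0} 𝔤_j`. -/
def pPartC : Submodule ℂ Mat := ⨆ j ∈ Finset.Icc 1 5, gPart j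

/-- The fibre `[𝔤₁]_q = Ad g · 𝔤₁`, `q = g K₂`, of the primitive distribution. -/
def bundleG1 (q : FL2) : Set Mat :=
  {X | ∃ g : SU3, FL2.act g FL2.base = q ∧ ((g⁻¹ : SU3) : Mat) * X * (g : Mat) ∈ gPart 1}

/-- The fibre `[𝔭₂]_q = Ad g · 𝔭₂ ⊂ 𝔰𝔲₃`, `q = g K₂`. -/
def bundleP (q : FL2) : Set Mat :=
  {X | X ∈ su3 ∧
    ∃ g : SU3, FL2.act g FL2.base = q ∧ ((g⁻¹ : SU3) : Mat) * X * (g : Mat) ∈ pPartC}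

/-- The tangent vector `d/dt (exp(tX) · q)` at `t = 0`, in the embedding of `FL₂`:
`(X w, [X, P_W])`. -/
def infAct (X : Mat) (q : FL2) : V × (V →L[ℂ] V) :=
  (op X q.w, op X ∘L q.W.starProjection - q.W.starProjection ∘L op X)

open Classical in
/-- The inverse of the isomorphism `[𝔭₂]_q → T_q FL₂`, `X ↦ d/dt (exp(tX) · q)`: the element of
`[𝔭₂]_q ⊂ 𝔰𝔲₃` which represents the tangent vector `ξ` at `q`. -/
def tangentRep (q : FL2) (ξ : V × (V →L[ℂ] V)) : Mat :=
  if h : ∃ X ∈ bundleP q, infAct X q = ξ then h.choose else 0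

/-! ### Maps of a Riemann surface -/

variable {M : Type*} [TopologicalSpace M] [ChartedSpace ℂ M]

/-- The map `h` in the complex coordinate `z = c(·)`, for a chart `c` of `M`. -/
abbrev inChart {F : Type*} (c : OpenPartialHomeomorph M ℂ) (h : M → F) : ℂ → F := h ∘ c.symm

/-- A smooth map of `M`, as a real manifold, into a normed space. -/
abbrev IsSmooth {F : Type*} [NormedAddCommGroup F] [NormedSpace ℝ F] (h : M → F) : Prop :=
  ContMDiff 𝓘(ℝ, ℂ) 𝓘(ℝ, F) ∞ h

/-- A map has injective differential at every point. -/
def IsImmersive {F : Type*} [NormedAddCommGroup F] [NormedSpace ℝ F] (h : M → F) : Prop :=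
  ∀ c ∈ atlas ℂ M, ∀ z ∈ c.target, Function.Injective (fderiv ℝ (inChart c h) z)

/-- The composition of `f : M → S⁵` with the inclusion `S⁵ ⊂ ℂ³`. -/
abbrev ofS5 (f : M → S5) : M → V := fun p => (f p : V)

/-- The composition of `φ : M → ℂP²` with the embedding of `ℂP²`. -/
abbrev ofCP2 (φ : M → CP2) : M → (V →L[ℂ] V) := fun p => CP2.emb (φ p)

/-- The composition of `ψ : M → FL₂` with the embedding of `FL₂`. -/
abbrev ofFL2 (ψ : M → FL2) : M → V × (V →L[ℂ] V) := fun p => FL2.emb (ψ p)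

/-- `f : M → S⁵` is smooth, isotropic for the contact structure (equivalently, horizontal for the
Hopf fibration), weakly conformal and harmonic; points with `df = 0` are allowed. Harmonicity says
that the tangential part of `Δf` vanishes. -/
structure IsConformalHarmonicLegendrian (f : M → S5) : Prop where
  smooth : IsSmooth (ofS5 f)
  horizontal : ∀ c ∈ atlas ℂ M, ∀ z ∈ c.target, ∀ v : ℂ,
    inner ℂ (inChart c (ofS5 f) z) (fderiv ℝ (inChart c (ofS5 f)) z v) = 0
  conformal : ∀ c ∈ atlas ℂ M, ∀ z ∈ c.target,
    ‖fderiv ℝ (inChart c (ofS5 f)) z 1‖ = ‖fderiv ℝ (inChart c (ofS5 f)) z I‖ ∧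
    (inner ℂ (fderiv ℝ (inChart c (ofS5 f)) z 1) (fderiv ℝ (inChart c (ofS5 f)) z I)).re = 0
  harmonic : ∀ c ∈ atlas ℂ M, ∀ z ∈ c.target, ∀ v : V,
    (inner ℂ v (inChart c (ofS5 f) z)).re = 0 →
    (inner ℂ v (Laplacian.laplacian (inChart c (ofS5 f)) z)).re = 0

/-- A minimal Legendrian immersion `f : M → S⁵`, where `M` carries the induced conformal
structure. -/
structure IsMinimalLegendrian (f : M → S5) : Prop extends IsConformalHarmonicLegendrian f where
  immersive : IsImmersive (ofS5 f)

/-- `φ : M → ℂP²` is smooth, isotropic for the Fubini–Study Kähler form, weakly conformal and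
harmonic for the Fubini–Study metric; points with `dφ = 0` are allowed. A tangent vector of `ℂP²`
at the line `ℓ`, given in the embedding by the operator `A`, corresponds to the element
`A|_ℓ` of `Hom(ℓ, ℓ^⊥)`; the Hermitian form on `T_ℓ ℂP²` is `⟨A u, B u⟩` for `u` a unit vector
of `ℓ`. Its real part is the metric and its imaginary part is the Kähler form. The tangential
part of a self-adjoint operator `A` vanishes if and only if `A` maps `ℓ` into `ℓ`. -/
structure IsConformalHarmonicLagrangian (φ : M → CP2) : Prop where
  smooth : IsSmooth (ofCP2 φ)
  lagrangian : ∀ c ∈ atlas ℂ M, ∀ z ∈ c.target, ∀ u ∈ (inChart c φ z).submodule,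
    (inner ℂ (fderiv ℝ (inChart c (ofCP2 φ)) z 1 u)
      (fderiv ℝ (inChart c (ofCP2 φ)) z I u)).im = 0
  conformal : ∀ c ∈ atlas ℂ M, ∀ z ∈ c.target, ∀ u ∈ (inChart c φ z).submodule,
    ‖fderiv ℝ (inChart c (ofCP2 φ)) z 1 u‖ = ‖fderiv ℝ (inChart c (ofCP2 φ)) z I u‖ ∧
    (inner ℂ (fderiv ℝ (inChart c (ofCP2 φ)) z 1 u)
      (fderiv ℝ (inChart c (ofCP2 φ)) z I u)).re = 0
  harmonic : ∀ c ∈ atlas ℂ M, ∀ z ∈ c.target, ∀ u ∈ (inChart c φ z).submodule,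
    Laplacian.laplacian (inChart c (ofCP2 φ)) z u ∈ (inChart c φ z).submodule

/-- A minimal Lagrangian immersion `φ : M → ℂP²`, where `M` carries the induced conformal
structure. -/
structure IsMinimalLagrangian (φ : M → CP2) : Prop extends IsConformalHarmonicLagrangian φ where
  immersive : IsImmersive (ofCP2 φ)

/-- `f : M → S⁵` is a (smooth) horizontal lift of `φ : M → ℂP²` for the Hopf fibration. -/
structure IsHorizontalLift (φ : M → CP2) (f : M → S5) : Prop where
  smooth : IsSmooth (ofS5 f)
  lift : ∀ p, hopf (f p) = φ p
  horizontal : ∀ c ∈ atlas ℂ M, ∀ z ∈ c.target, ∀ v : ℂ,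
    inner ℂ (inChart c (ofS5 f) z) (fderiv ℝ (inChart c (ofS5 f)) z v) = 0

/-- `∂s/∂z = (∂s/∂x - i ∂s/∂y) / 2`. -/
def dz {F : Type*} [NormedAddCommGroup F] [NormedSpace ℂ F] (s : ℂ → F) (z : ℂ) : F :=
  (1 / 2 : ℂ) • (fderiv ℝ s z 1 - I • fderiv ℝ s z I)

/-- For a bundle `ℓ` of subspaces of `ℂ³` over a domain of `ℂ`, the space
`π_ℓ^⊥ (∂ℓ/∂z)` at `z`: the span of `π_ℓ^⊥ (∂s/∂z)` over the smooth local sections `s` of `ℓ`. -/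
def nextBundle (ℓ : ℂ → Submodule ℂ V) (z : ℂ) : Submodule ℂ V :=
  Submodule.span ℂ {v | ∃ s : ℂ → V, ContDiffAt ℝ ∞ s z ∧ (∀ᶠ z' in nhds z, s z' ∈ ℓ z') ∧
    v = (ℓ z)ᗮ.starProjection (dz s z)}

/-- The fibre at `p` of `ℓ₀ = φ^* L`, where `L → ℂP²` is the tautological line bundle. -/
def ell0 (φ : M → CP2) (p : M) : Submodule ℂ V := (φ p).submodule

/-- The fibre at `p` of the second bundle `ℓ₁ = π_{ℓ₀}^⊥ (∂ℓ₀/∂z)` of the harmonic sequence (it does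
not depend on the complex coordinate `z` around `p`). -/
def ell1 (φ : M → CP2) (p : M) : Submodule ℂ V :=
  nextBundle (inChart (chartAt ℂ p) (ell0 φ)) (chartAt ℂ p p)

/-- The element of `[𝔭₂] ⊂ 𝔰𝔲₃` representing the tangent vector `dψ(v)` of `FL₂`, in the
coordinate `z` of the chart `c`. -/
def dRep (ψ : M → FL2) (c : OpenPartialHomeomorph M ℂ) (v z : ℂ) : Mat :=
  tangentRep (inChart c ψ z) (fderiv ℝ (inChart c (ofFL2 ψ)) z v)

/-- `ψ : M → FL₂` is primitive: it is a smooth immersion, and `dψ^{1,0}` takes values in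
`[𝔤₁]`, i.e. `dψ(∂/∂z) = (dψ(∂/∂x) - i dψ(∂/∂y)) / 2 ∈ [𝔤₁]`. -/
structure IsPrimitive (ψ : M → FL2) : Prop where
  smooth : IsSmooth (ofFL2 ψ)
  immersive : IsImmersive (ofFL2 ψ)
  primitive : ∀ c ∈ atlas ℂ M, ∀ z ∈ c.target,
    (1 / 2 : ℂ) • (dRep ψ c 1 z - I • dRep ψ c I z) ∈ bundleG1 (inChart c ψ z)

/-- `ψ : M → FL₂` is a harmonic map for the normal `SU₃`-invariant metric on `FL₂ = SU₃/K₂` (the one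
given on `𝔭₂` by `-tr(XY)`). Under `T FL₂ ≅ [𝔭₂]`, the covariant derivative of a section `Y` of
`ψ^*[𝔭₂]` for the Levi-Civita connection of this metric is
`∇_v Y = ∂_v Y - [β(v), Y] + [β(v), Y]_{[𝔭₂]} / 2`, with `β(v) ∈ [𝔭₂]` representing `dψ(v)`. In the
tension field `∑ ∇_v (β(v))`, over `v = ∂/∂x, ∂/∂y`, the brackets `[β(v), β(v)]` vanish. -/
structure IsHarmonicFL2 (ψ : M → FL2) : Prop where
  smooth : IsSmooth (ofFL2 ψ)
  tension : ∀ c ∈ atlas ℂ M, ∀ z ∈ c.target,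
    fderiv ℝ (fun z' => op (dRep ψ c 1 z')) z 1 + fderiv ℝ (fun z' => op (dRep ψ c I z')) z I = 0

end MinLag

end

noncomputable section

namespace MinLag

open InnerProductSpace (rankOne)

/-! Write `∂` and `∂̄` for the derivatives along `z` and `z̄`. For a horizontal lift `f`,
"Lagrangian" and "conformal" together say that `f_x` and `f_y` are orthogonal for the Hermitian
product and have equal length. Equivalently `f`, `∂f`, `∂̄f` are pairwise orthogonal and `|∂f| =
|∂̄f|`; harmonicity then becomes `∂∂̄f = -|∂f|² f`. These equations are `IsLegendrianAt`, the hinge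
between the two directions.

An element of `𝔤₁` has exactly the entries `(0,2)`, `(1,0)` (equal to each other) and `(2,1)`
(`mem_gPart_one_iff`). In a frame `e₀, e₁, e₂` adapted to a point of `FL₂`, a primitive map
therefore has `∂f = a e₁`, `∂̄f = -ā e₂`, and `∂∂̄f = -|a|² e₀` follows by differentiating `P ∂f =
∂f` and `P ∂̄f = 0`, where `P` is the projection onto `W`. This is the converse,
`isLegendrianAt_of_primitive`; injectivity of `df` and `dφ` is read off from the orthogonality of
`f_x` and `f_y`.

In the direct statement the adapted frame is `f, ∂f/|∂f|, -∂̄f/|∂f|`. It lies in `SU₃` exactly when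
the unit number `det(f, ∂f, ∂̄f)/|∂f|²` equals `-1`. This number is independent of the coordinate
(`lagrangianAngle_eq`) and locally constant (`fderiv_phase`); replacing `f` by `af` multiplies it by
`a³`, so a cube root corrects it (`exists_lift_phase`). The structure equations of the frame then
give primitivity (`IsLiftOn.primitive`).

For harmonicity let `P₀, P₁, P₂` be the projections onto the three lines of the frame. The element
of `𝔭₂` representing `dψ` is `∑ dP_j P_j` (`IsLiftOn.projRep_eq`). All three lines are harmonic,
that is, `ΔP_j` commutes with `P_j`, and so the divergence of `dP_j P_j` is `ΔP_j / 2`. The sum is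
half the Laplacian of the constant `1`, hence zero (`IsLiftOn.tension_eq_zero`).

Tangent vectors are turned into elements of `[𝔭₂]` by the explicit formula `projRep`, checked in
`IsTangent.projRep_spec`; uniqueness of the representative is `infAct_injOn`. -/

lemma eps_ne_zero : eps ≠ 0 := Complex.exp_ne_zero _

lemma eps_ne_one : eps ≠ 1 := by
  have := (Complex.isPrimitiveRoot_exp 3 (by norm_num)).ne_one (by norm_num)
  simpa [eps] using this

lemma eps_sq : eps ^ 2 = -1 - eps := by
  have h : (eps - 1) * (eps ^ 2 + eps + 1) = 0 := by linear_combination eps_pow_three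
  have := (mul_eq_zero.1 h).resolve_left (sub_ne_zero.2 eps_ne_one)
  linear_combination this

lemma star_eps : star eps = eps ^ 2 := by
  have h := eps_mul_conj
  have h' := eps_pow_three
  apply mul_left_cancel₀ eps_ne_zero
  rw [h, ← h']; ring

lemma conj_eps : (starRingEnd ℂ) eps = eps ^ 2 := star_eps

/-! ### Unitary frames and transitivity of `SU₃` on `FL₂` -/

lemma star_mul_coe (g : SU3) : star (g : Mat) * (g : Mat) = 1 :=
  (Matrix.mem_unitaryGroup_iff' (A := (g : Mat))).1 (Matrix.mem_specialUnitaryGroup_iff.1 g.2).1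

lemma mul_star_coe (g : SU3) : (g : Mat) * star (g : Mat) = 1 :=
  (Matrix.mem_unitaryGroup_iff (A := (g : Mat))).1 (Matrix.mem_specialUnitaryGroup_iff.1 g.2).1

lemma det_coe (g : SU3) : (g : Mat).det = 1 := (Matrix.mem_specialUnitaryGroup_iff.1 g.2).2

lemma coe_inv_eq (g : SU3) : ((g⁻¹ : SU3) : Mat) = (g : Mat)ᴴ := rfl

lemma op_apply (X : Mat) (v : V) (i : Fin 3) : op X v i = ∑ j, X i j * v j := by
  simp [op, Matrix.mulVec, dotProduct]

lemma op_stdE_apply (X : Mat) (i j : Fin 3) : op X (stdE j) i = X i j := by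
  simp [op_apply]

lemma inner_op_op (g : SU3) (u v : V) :
    inner ℂ (op (g : Mat) u) (op (g : Mat) v) = inner ℂ u v := by
  rw [← ContinuousLinearMap.adjoint_inner_right, ← ContinuousLinearMap.star_eq_adjoint]
  unfold op
  rw [← map_star, ← op, ← op, ← op_mul_apply, star_mul_coe]
  simp

/-- The unitary matrix with prescribed orthonormal columns of determinant one. -/
lemma exists_SU3_of_columns {e : Fin 3 → V} (he : Orthonormal ℂ e)
    (hdet : (Matrix.of fun i j => e j i).det = 1) :
    ∃ g : SU3, ∀ j, op (g : Mat) (stdE j) = e j := by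
  refine ⟨⟨Matrix.of fun i j => e j i, ?_⟩, fun j => ?_⟩
  · rw [Matrix.mem_specialUnitaryGroup_iff, Matrix.mem_unitaryGroup_iff']
    refine ⟨?_, hdet⟩
    ext i j
    have := (orthonormal_iff_ite.1 he) i j
    rw [PiLp.inner_apply] at this
    simp only [Matrix.mul_apply, Matrix.star_apply, Matrix.of_apply, Matrix.one_apply]
    rw [← this]
    refine Finset.sum_congr rfl fun k _ => ?_
    simp [mul_comm]
  · ext i
    rw [op_stdE_apply]
    rfl

lemma orthonormal_columns (g : SU3) : Orthonormal ℂ fun j => op (g : Mat) (stdE j) := by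
  rw [orthonormal_iff_ite]
  intro i j
  rw [inner_op_op]
  exact orthonormal_iff_ite.1 (EuclideanSpace.orthonormal_single (𝕜 := ℂ) (ι := Fin 3)) i j

lemma norm_det_of_orthonormal {e : Fin 3 → V} (he : Orthonormal ℂ e) :
    ‖(Matrix.of fun i j => e j i : Mat).det‖ = 1 := by
  set A : Mat := Matrix.of fun i j => e j i with hA
  have h : star A * A = 1 := by
    ext i j
    have := (orthonormal_iff_ite.1 he) i j
    rw [PiLp.inner_apply] at this
    simp only [Matrix.mul_apply, Matrix.star_apply, hA, Matrix.of_apply, Matrix.one_apply]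
    rw [← this]
    refine Finset.sum_congr rfl fun k _ => ?_
    simp [mul_comm]
  have h2 : star A.det * A.det = 1 := by
    have := congrArg Matrix.det h
    rwa [Matrix.det_mul, Matrix.star_eq_conjTranspose, Matrix.det_conjTranspose,
      Matrix.det_one] at this
  have h3 : ‖A.det‖ * ‖A.det‖ = 1 := by
    have := congrArg norm h2
    simpa using this
  nlinarith [norm_nonneg A.det]

/-- A submodule of dimension two containing two orthonormal vectors is spanned by them. -/
lemma eq_span_pair {W : Submodule ℂ V} (hW : finrank ℂ W = 2) {u v : V} (hu : u ∈ W) (hv : v ∈ W)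
    (huv : LinearIndependent ℂ ![u, v]) : W = Submodule.span ℂ {u, v} := by
  symm
  apply Submodule.eq_of_le_of_finrank_eq
  · rw [Submodule.span_le]
    rintro x (rfl | rfl) <;> assumption
  · have h := finrank_span_eq_card huv
    have hr : Set.range ![u, v] = {u, v} := by
      simp [Matrix.range_cons, Set.pair_comm]
    rw [hr] at h
    rw [hW, h, Fintype.card_fin]

lemma base_W : FL2.base.W = Submodule.span ℂ {stdE 0, stdE 1} := rfl

/-- The plane carries no further information: two orthonormal vectors of `W` already span it. Points
of `FL₂` can thus be handled through the first two columns of a matrix. -/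
lemma act_base_eq_iff (g : SU3) (q : FL2) :
    FL2.act g FL2.base = q ↔ op (g : Mat) (stdE 0) = q.w ∧ op (g : Mat) (stdE 1) ∈ q.W := by
  constructor
  · rintro rfl
    exact ⟨rfl, Submodule.mem_map_of_mem (Submodule.subset_span (by simp))⟩
  · rintro ⟨h0, h1⟩
    apply FL2.ext
    · exact Subtype.ext h0
    · have hli : LinearIndependent ℂ ![op (g : Mat) (stdE 0), op (g : Mat) (stdE 1)] := by
        have := (orthonormal_columns g).linearIndependent.comp ![0, 1] (by decide)
        have he : (fun j => op (g : Mat) (stdE j)) ∘ ![0, 1] =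
            ![op (g : Mat) (stdE 0), op (g : Mat) (stdE 1)] := by
          funext i; fin_cases i <;> rfl
        rw [he] at this
        exact this
      rw [eq_span_pair q.finrank_W (h0 ▸ q.w_mem) h1 hli]
      change (Submodule.span ℂ {stdE 0, stdE 1}).map (op (g : Mat)).toLinearMap = _
      rw [Submodule.map_span, Set.image_pair]
      rfl

/-- The vector `w` and a unit normal of `W` extend to an orthonormal basis, whose remaining vector
must lie in `W`. The phase of that vector is free and absorbs the determinant. -/
lemma exists_orthonormal_frame (q : FL2) : ∃ e : Fin 3 → V, Orthonormal ℂ e ∧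
    e 0 = q.w ∧ e 1 ∈ q.W ∧ (Matrix.of fun i j => e j i : Mat).det = 1 := by
  have hfin : finrank ℂ q.Wᗮ = 1 := by
    have := Submodule.finrank_add_finrank_orthogonal q.W
    rw [q.finrank_W, finrank_euclideanSpace_fin] at this
    omega
  obtain ⟨u, hu, hu0⟩ := Submodule.exists_mem_ne_zero_of_ne_bot
    (p := q.Wᗮ) (by rintro h; rw [h] at hfin; simp at hfin)
  set n : V := ((‖u‖ : ℂ)⁻¹) • u with hn
  have hnW : n ∈ q.Wᗮ := Submodule.smul_mem _ _ hu
  have hn1 : ‖n‖ = 1 := by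
    have : ‖u‖ ≠ 0 := norm_ne_zero_iff.2 hu0
    simp [hn, norm_smul, this]
  have hw1 : ‖(q.w : V)‖ = 1 := by simp
  have hwn : inner ℂ (q.w : V) n = 0 := hnW _ q.w_mem
  have hor : Orthonormal ℂ (({0, 2} : Set (Fin 3)).domRestrict ![(q.w : V), 0, n]) := by
    rw [orthonormal_iff_ite]
    have hnw : inner ℂ n (q.w : V) = 0 := inner_eq_zero_symm.1 hwn
    rintro ⟨i, hi⟩ ⟨j, hj⟩
    simp only [Set.mem_insert_iff, Set.mem_singleton_iff] at hi hj
    obtain rfl | rfl := hi <;> obtain rfl | rfl := hj <;>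
      simp [Set.domRestrict_apply, hwn, hnw, hn1]
  obtain ⟨b, hb⟩ := hor.exists_orthonormalBasis_extension_of_card_eq (ι := Fin 3)
    (by simp)
  have hb0 : b 0 = q.w := hb 0 (by simp)
  have hb2 : b 2 = n := hb 2 (by simp)
  have hWn : q.W = (ℂ ∙ n)ᗮ := by
    apply Submodule.eq_of_le_of_finrank_eq
    · intro x hx
      rw [Submodule.mem_orthogonal_singleton_iff_inner_left]
      exact hnW _ hx
    · have := Submodule.finrank_add_finrank_orthogonal (ℂ ∙ n)
      rw [finrank_span_singleton (by rw [← norm_ne_zero_iff, hn1]; norm_num),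
        finrank_euclideanSpace_fin] at this
      rw [q.finrank_W]; omega
  have hb1 : b 1 ∈ q.W := by
    rw [hWn, Submodule.mem_orthogonal_singleton_iff_inner_left, ← hb2]
    exact b.orthonormal.2 (by decide)
  set d := (Matrix.of fun i j => b j i : Mat).det with hd
  have hd1 : ‖d‖ = 1 := norm_det_of_orthonormal b.orthonormal
  have hd0 : d ≠ 0 := by rw [← norm_ne_zero_iff, hd1]; norm_num
  refine ⟨![b 0, d⁻¹ • b 1, b 2], ?_, hb0, Submodule.smul_mem _ _ hb1, ?_⟩
  · rw [orthonormal_iff_ite]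
    have hb' := orthonormal_iff_ite.1 b.orthonormal
    have hdd : (starRingEnd ℂ) d * d = 1 := by
      rw [mul_comm, Complex.mul_conj, Complex.normSq_eq_norm_sq, hd1]; simp
    have hdd' : d⁻¹ * (starRingEnd ℂ) d⁻¹ = 1 := by
      rw [map_inv₀, ← mul_inv, mul_comm, hdd, inv_one]
    intro i j
    fin_cases i <;> fin_cases j <;>
      simp [inner_smul_left, inner_smul_right, hb', norm_smul, hd1]
  · rw [Matrix.det_fin_three] at hd ⊢
    simp at hd ⊢
    field_simp
    rw [hd]; ring

theorem exists_act_base_eq (q : FL2) : ∃ g : SU3, FL2.act g FL2.base = q := by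
  obtain ⟨e, he, h0, h1, hdet⟩ := exists_orthonormal_frame q
  obtain ⟨g, hg⟩ := exists_SU3_of_columns he hdet
  exact ⟨g, (act_base_eq_iff g q).2 ⟨by rw [hg, h0], by rw [hg]; exact h1⟩⟩

/-! ### The automorphisms `μ`, `ν`, `σ` and the isotropy group -/

lemma coe_nu (g : SU3) : (nu g : Mat) = matS * g * matSᴴ := rfl

lemma coe_mu (g : SU3) : (mu g : Mat) = matT * ((g : Mat)ᴴ)ᵀ * matT := by
  change matT * ((g⁻¹ : SU3) : Mat)ᵀ * matT⁻¹ = _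
  rw [matT_inv, coe_inv_eq]

/-- The involution `0 ↦ 0`, `1 ↦ 2`, `2 ↦ 1` of the indices. -/
def swapIdx : Fin 3 → Fin 3 := ![0, 2, 1]

/-- The character `j ↦ ε ^ j` of the indices. -/
def epsPow : Fin 3 → ℂ := ![1, eps, eps ^ 2]

/-- For a unitary matrix `(g⁻¹)ᵗ` is the entrywise conjugate, and conjugation by `T` only permutes
indices. -/
lemma mu_apply (g : SU3) (i j : Fin 3) :
    (mu g : Mat) i j = (starRingEnd ℂ) ((g : Mat) (swapIdx i) (swapIdx j)) := by
  rw [coe_mu]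
  fin_cases i <;> fin_cases j <;>
    simp [matT, swapIdx, Matrix.mul_apply, Fin.sum_univ_three, Matrix.vecMul, dotProduct]

lemma nu_apply (g : SU3) (i j : Fin 3) :
    (nu g : Mat) i j = epsPow i * (g : Mat) i j * (starRingEnd ℂ) (epsPow j) := by
  rw [coe_nu, matS, Matrix.diagonal_conjTranspose, Matrix.mul_diagonal, Matrix.diagonal_mul]
  rfl

lemma conj_epsPow_swapIdx (i : Fin 3) : (starRingEnd ℂ) (epsPow (swapIdx i)) = epsPow i := by
  have h3 := eps_pow_three
  fin_cases i
  · simp [epsPow, swapIdx]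
  · simp [epsPow, swapIdx, conj_eps]
    linear_combination eps * h3
  · simp [epsPow, swapIdx, conj_eps]

lemma epsPow_mul_conj (i : Fin 3) : epsPow i * (starRingEnd ℂ) (epsPow i) = 1 := by
  have h3 := eps_pow_three
  fin_cases i
  · simp [epsPow]
  · simp [epsPow, conj_eps]
    linear_combination h3
  · simp [epsPow, conj_eps]
    linear_combination (eps ^ 3 + 1) * h3

/-- Complex conjugation inverts `ε`, and so does the exchange of the last two indices; in `μ` both
happen, so the weights of `ν` are unaffected. -/
theorem commute_mu_nu : Commute mu nu := by
  apply MulEquiv.ext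
  intro g
  apply Subtype.ext
  ext i j
  change (mu (nu g) : Mat) i j = (nu (mu g) : Mat) i j
  rw [mu_apply, nu_apply, nu_apply, mu_apply, map_mul, map_mul, conj_epsPow_swapIdx,
    ← conj_epsPow_swapIdx j]

lemma exists_nu_ne : nu ≠ 1 := by
  intro h
  -- A cyclic permutation matrix: `ν` multiplies its `(1,0)` entry by `ε`.
  obtain ⟨g, hg⟩ : ∃ g : SU3, (g : Mat) = !![0, 0, 1; 1, 0, 0; 0, 1, 0] := by
    refine ⟨⟨!![0, 0, 1; 1, 0, 0; 0, 1, 0], ?_⟩, rfl⟩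
    rw [Matrix.mem_specialUnitaryGroup_iff, Matrix.mem_unitaryGroup_iff]
    constructor
    · ext i j
      fin_cases i <;> fin_cases j <;>
        simp [Matrix.mul_apply, Fin.sum_univ_three]
    · simp [Matrix.det_fin_three]
  have h1 := congrArg (fun a : MulAut SU3 => (a g : Mat) 1 0) h
  simp only [nu_apply, hg, MulAut.one_apply] at h1
  simp [epsPow] at h1
  exact eps_ne_one h1

lemma orderOf_nu : orderOf nu = 3 := by
  have : Fact (Nat.Prime 3) := ⟨Nat.prime_three⟩
  apply orderOf_eq_prime _ exists_nu_ne
  have hS : (⟨matS, matS_mem⟩ : SU3) ^ 3 = 1 := by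
    apply Subtype.ext
    change matS ^ 3 = 1
    rw [matS, Matrix.diagonal_pow, ← Matrix.diagonal_one]
    congr 1
    have h3 := eps_pow_three
    ext i
    fin_cases i
    · simp
    · simpa using h3
    · simp
      linear_combination (eps ^ 3 + 1) * h3
  rw [nu, ← map_pow, hS, map_one]

lemma mu_ne_one : mu ≠ 1 := by
  intro h
  -- A central element which `μ` sends to its inverse; the order of `ε` is not two.
  obtain ⟨g, hg⟩ : ∃ g : SU3, (g : Mat) = eps • (1 : Mat) := by
    refine ⟨⟨eps • (1 : Mat), ?_⟩, rfl⟩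
    rw [Matrix.mem_specialUnitaryGroup_iff, Matrix.mem_unitaryGroup_iff]
    constructor
    · rw [star_smul, star_one, smul_mul_smul_comm, eps_mul_conj, one_smul, one_mul]
    · simp [eps_pow_three]
  have h1 := congrArg (fun a : MulAut SU3 => (a g : Mat) 0 0) h
  simp only [mu_apply, hg, MulAut.one_apply] at h1
  simp [swapIdx, conj_eps] at h1
  have : eps * (eps - 1) = 0 := by linear_combination h1
  rcases mul_eq_zero.1 this with h | h
  · exact eps_ne_zero h
  · exact eps_ne_one (sub_eq_zero.1 h)

lemma orderOf_mu : orderOf mu = 2 := by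
  have : Fact (Nat.Prime 2) := ⟨Nat.prime_two⟩
  apply orderOf_eq_prime _ mu_ne_one
  rw [sq]
  apply MulEquiv.ext
  intro g
  exact muFun_muFun g

theorem orderOf_sigma : orderOf sigma = 6 := by
  rw [sigma, commute_mu_nu.orderOf_mul_eq_mul_orderOf_of_coprime
    (by rw [orderOf_mu, orderOf_nu]; decide), orderOf_mu, orderOf_nu]

lemma sigma_apply (g : SU3) (i j : Fin 3) : (sigma g : Mat) i j =
    epsPow i * (starRingEnd ℂ) ((g : Mat) (swapIdx i) (swapIdx j)) *
      (starRingEnd ℂ) (epsPow j) := by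
  have h : sigma g = nu (mu g) := by
    rw [sigma, commute_mu_nu.eq]; rfl
  rw [h, nu_apply, mu_apply]

lemma eps_sub_one_ne_zero : eps - 1 ≠ 0 := sub_ne_zero.2 eps_ne_one

theorem sigma_eq_self_iff (g : SU3) :
    sigma g = g ↔ ∃ a : ℂ, (g : Mat) = Matrix.diagonal ![1, a, a⁻¹] := by
  have h3 := eps_pow_three
  have hU := star_mul_coe g
  have hdet := det_coe g
  constructor
  · intro h
    have H : ∀ i j, epsPow i * (starRingEnd ℂ) ((g : Mat) (swapIdx i) (swapIdx j)) *
      (starRingEnd ℂ) (epsPow j) = (g : Mat) i j := fun i j => by rw [← sigma_apply, h]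
    -- An off-diagonal entry and its partner under the index exchange determine each other up to a
    -- root of unity and conjugation. Going round once gives `x = p q̄ x`, so the entry vanishes
    -- unless `p q̄ = 1`.
    have key : ∀ (x y p q : ℂ), p * (starRingEnd ℂ) y = x → q * (starRingEnd ℂ) x = y →
        p * (starRingEnd ℂ) q ≠ 1 → x = 0 := by
      intro x y p q h1 h2 hne
      have : x * (p * (starRingEnd ℂ) q - 1) = 0 := by
        have h2' := congrArg (starRingEnd ℂ) h2
        rw [map_mul, Complex.conj_conj] at h2'
        linear_combination h1 + p * h2'
      exact (mul_eq_zero.1 this).resolve_right (sub_ne_zero.2 hne)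
    have h01 := H 0 1
    have h02 := H 0 2
    have h10 := H 1 0
    have h20 := H 2 0
    have h12 := H 1 2
    have h21 := H 2 1
    have h11 := H 1 1
    simp only [epsPow, swapIdx, conj_eps, map_one, map_pow, Matrix.cons_val] at *
    have z01 : (g : Mat) 0 1 = 0 := by
      refine key _ _ (eps ^ 2) eps (by linear_combination h01) ?_ ?_
      · linear_combination h02 - eps * (starRingEnd ℂ) ((g : Mat) 0 1) * h3
      · rw [conj_eps]
        intro h
        apply eps_ne_one
        linear_combination h - eps * h3
    have z10 : (g : Mat) 1 0 = 0 := by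
      refine key _ _ eps (eps ^ 2) (by linear_combination h10) (by linear_combination h20) ?_
      rw [map_pow, conj_eps]
      intro h
      apply eps_ne_one
      linear_combination (-eps) * h + (1 + eps ^ 3) * h3
    have z12 : (g : Mat) 1 2 = 0 := by
      refine key _ ((g : Mat) 2 1) (eps ^ 2) eps ?_ ?_ ?_
      · linear_combination h12 - eps ^ 2 * (starRingEnd ℂ) ((g : Mat) 2 1) * h3
      · linear_combination h21 - eps * (starRingEnd ℂ) ((g : Mat) 1 2) * h3
      · rw [conj_eps]
        intro h
        apply eps_ne_one
        linear_combination h - eps * h3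
    have z02 : (g : Mat) 0 2 = 0 := by rw [← h02, z01]; simp
    have z20 : (g : Mat) 2 0 = 0 := by rw [← h20, z10]; simp
    have z21 : (g : Mat) 2 1 = 0 := by rw [← h21, z12]; simp
    have d11 : (starRingEnd ℂ) ((g : Mat) 2 2) = (g : Mat) 1 1 := by
      linear_combination h11 - (starRingEnd ℂ) ((g : Mat) 2 2) * h3
    have u2 : (starRingEnd ℂ) ((g : Mat) 2 2) * (g : Mat) 2 2 = 1 := by
      have := congrFun (congrFun hU 2) 2
      simpa [Matrix.mul_apply, Fin.sum_univ_three, z12, z02] using this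
    rw [d11] at u2
    rw [Matrix.det_fin_three, z01, z02, z12] at hdet
    have z00 : (g : Mat) 0 0 = 1 := by
      linear_combination hdet - (g : Mat) 0 0 * u2
    refine ⟨(g : Mat) 1 1, ?_⟩
    have z22 : (g : Mat) 2 2 = ((g : Mat) 1 1)⁻¹ := eq_inv_of_mul_eq_one_right u2
    ext i j
    fin_cases i <;> fin_cases j <;> simp [z00, z01, z02, z10, z20, z12, z21, z22]
  · rintro ⟨a, ha⟩
    have haa : (starRingEnd ℂ) a * a = 1 := by
      have := congrFun (congrFun hU 1) 1
      rw [ha] at this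
      simpa [Matrix.mul_apply, Fin.sum_univ_three] using this
    have hia : a⁻¹ = (starRingEnd ℂ) a := (eq_inv_of_mul_eq_one_left haa).symm
    apply Subtype.ext
    ext i j
    rw [sigma_apply, ha, hia]
    fin_cases i <;> fin_cases j <;>
      simp [epsPow, swapIdx, conj_eps]
    · linear_combination a * h3
    · linear_combination ((starRingEnd ℂ) a) * (eps ^ 3 + 1) * h3

/-- Fixing `e₁` clears the first column and, by orthogonality of the columns, the first row.
Preserving the plane clears the entry `(2,1)`, orthogonality clears `(1,2)`, and the determinant
relates the last two diagonal entries. -/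
theorem act_base_eq_base_iff (g : SU3) :
    FL2.act g FL2.base = FL2.base ↔ ∃ a : ℂ, (g : Mat) = Matrix.diagonal ![1, a, a⁻¹] := by
  have hspan : ∀ x : V, x ∈ FL2.base.W ↔ x 2 = 0 := by
    intro x
    rw [base_W, Submodule.mem_span_pair]
    constructor
    · rintro ⟨a, b, rfl⟩; simp
    · intro h
      refine ⟨x 0, x 1, ?_⟩
      ext i
      fin_cases i <;> simp [h]
  rw [act_base_eq_iff, hspan, op_stdE_apply]
  have hdet := det_coe g
  have hU := star_mul_coe g
  have hU' : ∀ i j, ∑ k, (starRingEnd ℂ) ((g : Mat) k i) * (g : Mat) k j = (1 : Mat) i j := by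
    intro i j
    rw [← hU, Matrix.mul_apply]; rfl
  constructor
  · rintro ⟨h0, h1⟩
    have c0 : ∀ i, (g : Mat) i 0 = stdE 0 i := fun i => by
      have := congrArg (fun v : V => v i) h0
      exact (op_stdE_apply (g : Mat) i 0).symm.trans this
    have z00 : (g : Mat) 0 0 = 1 := by simpa using c0 0
    have z10 : (g : Mat) 1 0 = 0 := by simpa using c0 1
    have z20 : (g : Mat) 2 0 = 0 := by simpa using c0 2
    have z01 : (g : Mat) 0 1 = 0 := by
      simpa [Fin.sum_univ_three, z00, z10, z20] using hU' 0 1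
    have z02 : (g : Mat) 0 2 = 0 := by
      simpa [Fin.sum_univ_three, z00, z10, z20] using hU' 0 2
    have n1 : (starRingEnd ℂ) ((g : Mat) 1 1) * (g : Mat) 1 1 = 1 := by
      simpa [Fin.sum_univ_three, z01, h1] using hU' 1 1
    have z12 : (g : Mat) 1 2 = 0 := by
      have h : (starRingEnd ℂ) ((g : Mat) 1 1) * (g : Mat) 1 2 = 0 := by
        simpa [Fin.sum_univ_three, z01, h1] using hU' 1 2
      exact (mul_eq_zero.1 h).resolve_left (left_ne_zero_of_mul_eq_one n1)
    have z22 : (g : Mat) 2 2 = ((g : Mat) 1 1)⁻¹ := by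
      rw [Matrix.det_fin_three, z00, z01, z02, z12] at hdet
      apply eq_inv_of_mul_eq_one_right
      linear_combination hdet
    refine ⟨(g : Mat) 1 1, ?_⟩
    ext i j
    fin_cases i <;> fin_cases j <;> simp [z00, z01, z02, z10, z20, z12, h1, z22]
  · rintro ⟨a, ha⟩
    refine ⟨?_, by simp [ha]⟩
    ext i
    rw [op_stdE_apply, ha]
    fin_cases i <;> simp [FL2.base]

/-! ### Eigenspaces and frames -/

/-- The matrix of an operator on `ℂ³`. -/
abbrev toMat (A : V →L[ℂ] V) : Mat := (Matrix.toEuclideanCLM (n := Fin 3) (𝕜 := ℂ)).symm A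

@[simp] lemma op_toMat (A : V →L[ℂ] V) : op (toMat A) = A :=
  (Matrix.toEuclideanCLM (n := Fin 3) (𝕜 := ℂ)).apply_symm_apply A

lemma op_injective : Function.Injective op := (Matrix.toEuclideanCLM (n := Fin 3) (𝕜 := ℂ)).injective

lemma op_conjTranspose (X : Mat) : op Xᴴ = ContinuousLinearMap.adjoint (op X) := by
  rw [← ContinuousLinearMap.star_eq_adjoint, ← Matrix.star_eq_conjTranspose]
  exact map_star _ _

/-- The `j`-th vector of the unitary frame given by `g ∈ SU₃`. -/
abbrev frame (g : SU3) (j : Fin 3) : V := op (g : Mat) (stdE j)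

lemma inner_frame (g : SU3) (i j : Fin 3) :
    inner ℂ (frame g i) (frame g j) = if i = j then 1 else 0 :=
  orthonormal_iff_ite.1 (orthonormal_columns g) i j

/-- Conditions on `Ad g⁻¹ X` become conditions on the coefficients of `X` in the frame of `g`; every
membership in `[𝔤₁]` or `[𝔭₂]` is tested through this formula. -/
lemma inv_mul_mul_apply (g : SU3) (X : Mat) (i j : Fin 3) :
    (((g⁻¹ : SU3) : Mat) * X * (g : Mat)) i j = inner ℂ (frame g i) (op X (frame g j)) := by
  rw [← op_stdE_apply (((g⁻¹ : SU3) : Mat) * X * (g : Mat)) i j, op_mul_apply,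
    op_mul_apply, coe_inv_eq, op_conjTranspose]
  have : ∀ v : V, v i = inner ℂ (stdE i) v := fun v => by
    rw [EuclideanSpace.inner_single_left]; simp
  rw [this, ContinuousLinearMap.adjoint_inner_right]

lemma dsigma_apply (X : Mat) (i j : Fin 3) : dsigma X i j =
    -(epsPow i * (starRingEnd ℂ) (epsPow j) * X (swapIdx j) (swapIdx i)) := by
  have hS : matS⁻¹ = matSᴴ := by
    apply Matrix.inv_eq_right_inv
    exact (Matrix.mem_unitaryGroup_iff (A := matS)).1
      (Matrix.mem_specialUnitaryGroup_iff.1 matS_mem).1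
  have hT : ∀ N : Mat, (matT * N * matT) i j = N (swapIdx i) (swapIdx j) := by
    intro N
    fin_cases i <;> fin_cases j <;>
      simp [matT, swapIdx, Matrix.mul_apply, Fin.sum_univ_three, Matrix.vecMul, dotProduct]
  have hc : ∀ k, epsPow (swapIdx k) = (starRingEnd ℂ) (epsPow k) := fun k => by
    rw [← conj_epsPow_swapIdx k, Complex.conj_conj]
  change -((matT * (matS * X * matS⁻¹)ᵀ * matT⁻¹) i j) = _
  rw [hS, matT_inv, hT, Matrix.transpose_apply, matS, Matrix.diagonal_conjTranspose,
    Matrix.mul_diagonal, Matrix.diagonal_mul]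
  change -(epsPow (swapIdx j) * X (swapIdx j) (swapIdx i) *
    (starRingEnd ℂ) (epsPow (swapIdx i))) = _
  rw [hc, conj_epsPow_swapIdx]
  ring

/-- Up to factors, the differential of `σ` sends the entry `(i,j)` to the entry obtained by
transposing and exchanging the last two indices. The orbits have one or two elements, so the
eigenvalue equation decouples. The eigenvalue is passed as `μ` so that reduced forms of `(-ε)^k` can
be inserted. -/
lemma mem_gPart_iff {k : ℕ} {μ : ℂ} (hμ : (-eps) ^ k = μ) (Y : Mat) :
    Y ∈ gPart k ↔ Y.trace = 0 ∧ (-Y 0 0 = μ * Y 0 0 ∧ -Y 2 2 = μ * Y 1 1 ∧ -Y 1 1 = μ * Y 2 2) ∧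
      (-eps ^ 2 * Y 2 0 = μ * Y 0 1 ∧ -eps ^ 2 * Y 0 1 = μ * Y 2 0 ∧
        -eps ^ 2 * Y 1 2 = μ * Y 1 2) ∧
      (-eps * Y 0 2 = μ * Y 1 0 ∧ -eps * Y 1 0 = μ * Y 0 2 ∧ -eps * Y 2 1 = μ * Y 2 1) := by
  have h4 : eps ^ 2 * eps ^ 2 = eps := by linear_combination eps * eps_pow_three
  rw [gPart, Submodule.mem_inf, LinearMap.mem_ker, Module.End.mem_eigenspace_iff,
    ← Matrix.ext_iff]
  simp only [dsigma_apply, Matrix.smul_apply, smul_eq_mul, Matrix.traceLinearMap_apply, hμ,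
    Fin.forall_fin_succ, IsEmpty.forall_iff, and_true, Fin.succ_zero_eq_one, Fin.succ_one_eq_two,
    epsPow_mul_conj]
  simp only [epsPow, swapIdx, conj_eps, map_one, map_pow, Matrix.cons_val, ← pow_two,
    one_mul, mul_one]
  have h5 : eps * (eps ^ 2) ^ 2 = eps ^ 2 := by linear_combination eps ^ 2 * eps_pow_three
  have h6 : (eps ^ 2) ^ 2 = eps := by rw [sq, h4]
  rw [h5, h6, sq eps]
  simp only [neg_mul]
  tauto

lemma neg_eps_pow_two : (-eps) ^ 2 = eps ^ 2 := by ring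
lemma neg_eps_pow_three : (-eps) ^ 3 = -1 := by linear_combination -eps_pow_three
lemma neg_eps_pow_four : (-eps) ^ 4 = eps := by linear_combination eps * eps_pow_three
lemma neg_eps_pow_five : (-eps) ^ 5 = -eps ^ 2 := by
  linear_combination -eps ^ 2 * eps_pow_three

lemma neg_eps_pow_ne_one {k : ℕ} (hk : k ∈ Finset.Icc 1 5) : (-eps) ^ k ≠ 1 := by
  have h3 := eps_pow_three
  have hs := eps_sq
  have h0 := eps_ne_zero
  have h1 := eps_ne_one
  rw [Finset.mem_Icc] at hk
  obtain ⟨hk1, hk2⟩ := hk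
  interval_cases k
  · rw [pow_one]
    intro h
    apply h0
    have : eps ^ 2 = 0 := by linear_combination hs + h
    simpa using this
  · rw [neg_eps_pow_two]
    intro h
    exact h1 (by linear_combination h3 - eps * h)
  · rw [neg_eps_pow_three]; norm_num
  · rw [neg_eps_pow_four]; exact h1
  · rw [neg_eps_pow_five]
    intro h
    exact h0 (by linear_combination h + hs)

theorem mem_gPart_one_iff (Y : Mat) :
    Y ∈ gPart 1 ↔ ∃ a b : ℂ, Y = !![0, 0, a; a, 0, 0; 0, b, 0] := by
  have h3 := eps_pow_three
  rw [mem_gPart_iff (pow_one _)]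
  constructor
  · rintro ⟨-, ⟨h00, h11, h22⟩, ⟨h01, h20, h12⟩, h10, h02, -⟩
    have z : ∀ {m x : ℂ}, m * x = 0 → m ≠ 0 → x = 0 :=
      fun h hm => (mul_eq_zero.1 h).resolve_left hm
    have hm : eps - 1 ≠ 0 := eps_sub_one_ne_zero
    have hp : eps + 1 ≠ 0 := by
      intro h
      have := neg_eps_pow_ne_one (k := 1) (by simp)
      exact this (by linear_combination -h)
    have h0 := eps_ne_zero
    have z00 : Y 0 0 = 0 := z (m := eps - 1) (by linear_combination h00) hm
    have z11 : Y 1 1 = 0 := z (m := (eps - 1) * (eps + 1))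
      (by linear_combination eps * h11 + h22) (mul_ne_zero hm hp)
    have z22 : Y 2 2 = 0 := by rw [z11] at h11; linear_combination -h11
    have z01 : Y 0 1 = 0 := z (m := -eps * ((eps - 1) * (eps + 1)))
      (by linear_combination eps * h20 + h01)
      (mul_ne_zero (neg_ne_zero.2 h0) (mul_ne_zero hm hp))
    have z20 : Y 2 0 = 0 := z (m := eps)
      (by rw [z01] at h20; linear_combination h20) h0
    have z12 : Y 1 2 = 0 := z (m := -eps * (eps - 1)) (by linear_combination h12)
      (mul_ne_zero (neg_ne_zero.2 h0) hm)
    have e10 : Y 0 2 = Y 1 0 := mul_left_cancel₀ (neg_ne_zero.2 h0) h10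
    refine ⟨Y 1 0, Y 2 1, ?_⟩
    ext i j
    fin_cases i <;> fin_cases j <;> simp [z00, z11, z22, z01, z20, z12, e10]
  · rintro ⟨a, b, rfl⟩
    simp [Matrix.trace_fin_three]

/-- The fixed algebra of `σ` is spanned by `diag(0, 1, -1)`, and the other eigenspaces fill its
orthogonal complement in the trace-free matrices. On an eigenvector with eigenvalue `λ ≠ 1` the
diagonal equations give `(λ - 1)(Y₁₁ - Y₂₂) = 0`. -/
theorem mem_pPartC_iff (Y : Mat) : Y ∈ pPartC ↔ Y.trace = 0 ∧ Y 1 1 = Y 2 2 := by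
  constructor
  · have hle : pPartC ≤ LinearMap.ker (Matrix.traceLinearMap (Fin 3) ℂ ℂ) ⊓
        LinearMap.ker (Matrix.entryLinearMap ℂ ℂ (1 : Fin 3) (1 : Fin 3) -
          Matrix.entryLinearMap ℂ ℂ (2 : Fin 3) (2 : Fin 3)) := by
      refine iSup₂_le fun k hk X hX => ?_
      obtain ⟨ht, ⟨-, h11, h22⟩, -⟩ := (mem_gPart_iff rfl _).1 hX
      rw [Submodule.mem_inf, LinearMap.mem_ker, LinearMap.mem_ker]
      refine ⟨ht, ?_⟩
      have : ((-eps) ^ k - 1) * (X 1 1 - X 2 2) = 0 := by linear_combination h22 - h11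
      exact (mul_eq_zero.1 this).resolve_left (sub_ne_zero.2 (neg_eps_pow_ne_one hk))
    intro h
    have := hle h
    rw [Submodule.mem_inf, LinearMap.mem_ker, LinearMap.mem_ker] at this
    exact ⟨this.1, sub_eq_zero.1 this.2⟩
  · rintro ⟨ht, hd⟩
    have h3 := eps_pow_three
    have m : ∀ k ∈ Finset.Icc 1 5, ∀ X ∈ gPart k, X ∈ pPartC := fun k hk X hX =>
      Submodule.mem_iSup_of_mem k (Submodule.mem_iSup_of_mem hk hX)
    rw [Matrix.trace_fin_three] at ht
    -- The components for the eigenvalues `(-ε)^k`, `k = 1, …, 5`, in this order: symmetric and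
    -- antisymmetric parts of the two pairs of exchanged entries, with the fixed entries `(2,1)` and
    -- `(1,2)` in the first and last and the diagonal in the third.
    have hY : Y = !![0, 0, (Y 0 2 + Y 1 0) / 2; (Y 0 2 + Y 1 0) / 2, 0, 0; 0, Y 2 1, 0] +
        (!![0, (Y 0 1 - Y 2 0) / 2, 0; 0, 0, 0; -(Y 0 1 - Y 2 0) / 2, 0, 0] +
        (!![-2 * Y 1 1, 0, 0; 0, Y 1 1, 0; 0, 0, Y 1 1] +
        (!![0, 0, (Y 0 2 - Y 1 0) / 2; -(Y 0 2 - Y 1 0) / 2, 0, 0; 0, 0, 0] +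
        !![0, (Y 0 1 + Y 2 0) / 2, 0; 0, 0, Y 1 2; (Y 0 1 + Y 2 0) / 2, 0, 0]))) := by
      ext i j
      fin_cases i <;> fin_cases j <;> simp
      · linear_combination ht + hd
      all_goals first | ring | exact hd.symm
    rw [hY]
    refine add_mem (m 1 (by simp) _ ((mem_gPart_one_iff _).2 ⟨_, _, rfl⟩))
      (add_mem (m 2 (by simp) _ ((mem_gPart_iff neg_eps_pow_two _).2 ?_))
      (add_mem (m 3 (by simp) _ ((mem_gPart_iff neg_eps_pow_three _).2 ?_))
      (add_mem (m 4 (by simp) _ ((mem_gPart_iff neg_eps_pow_four _).2 ?_))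
      (m 5 (by simp) _ ((mem_gPart_iff neg_eps_pow_five _).2 ?_)))))
    all_goals
      rw [Matrix.trace_fin_three]
      simp only [Matrix.of_apply, Matrix.cons_val]
      refine ⟨?_, ⟨?_, ?_, ?_⟩, ⟨?_, ?_, ?_⟩, ?_, ?_, ?_⟩ <;>
        first | trivial | ring

/-! ### The isomorphism of `[𝔭₂]` with the tangent space: independence of `g` and uniqueness -/

section

lemma act_mul (g h : SU3) (q : FL2) : FL2.act (g * h) q = FL2.act g (FL2.act h q) := by
  apply FL2.ext
  · exact Subtype.ext (op_mul_apply (g : Mat) (h : Mat) (q.w : V))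
  · change q.W.map (op ((g * h : SU3) : Mat)).toLinearMap =
      (q.W.map (op (h : Mat)).toLinearMap).map (op (g : Mat)).toLinearMap
    rw [← Submodule.map_comp]
    congr 1
    ext1 v
    exact op_mul_apply (g : Mat) (h : Mat) v

lemma act_one (q : FL2) : FL2.act 1 q = q := by
  have h : op ((1 : SU3) : Mat) = 1 := map_one _
  apply FL2.ext
  · apply Subtype.ext
    change op ((1 : SU3) : Mat) (q.w : V) = q.w
    rw [h]; rfl
  · change q.W.map (op ((1 : SU3) : Mat)).toLinearMap = q.W
    rw [h]; exact Submodule.map_id _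

/-- Membership in `Ad g · 𝔭₂^ℂ` does not depend on the choice of `g` with `g · q₀ = q`. -/
lemma mem_pPartC_of_act_eq {g h : SU3} (hgh : FL2.act g FL2.base = FL2.act h FL2.base) {X : Mat}
    (hX : ((g⁻¹ : SU3) : Mat) * X * (g : Mat) ∈ pPartC) :
    ((h⁻¹ : SU3) : Mat) * X * (h : Mat) ∈ pPartC := by
  -- The ambiguity `h⁻¹ g` lies in `K₂`, so it is a unitary diagonal matrix; conjugation by it
  -- preserves the trace and each diagonal entry.
  have hk : FL2.act (h⁻¹ * g) FL2.base = FL2.base := by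
    rw [act_mul, hgh, ← act_mul, inv_mul_cancel, act_one]
  obtain ⟨a, ha⟩ := (act_base_eq_base_iff _).1 hk
  set k := h⁻¹ * g with hkdef
  have hh : ((h⁻¹ : SU3) : Mat) * X * (h : Mat) =
      (k : Mat) * (((g⁻¹ : SU3) : Mat) * X * (g : Mat)) * ((k⁻¹ : SU3) : Mat) := by
    have e1 : (h⁻¹ : SU3) = k * g⁻¹ := by rw [hkdef]; group
    have e2 : h = g * k⁻¹ := by rw [hkdef]; group
    rw [e1]
    rw [show (h : Mat) = ((g * k⁻¹ : SU3) : Mat) from congrArg _ e2]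
    simp only [Submonoid.coe_mul, Matrix.mul_assoc]
  have ha1 : a * (starRingEnd ℂ) a = 1 := by
    have := congrFun (congrFun (mul_star_coe k) 1) 1
    rw [ha] at this
    simpa [Matrix.mul_apply, Fin.sum_univ_three] using this
  have ha2 : a⁻¹ * (starRingEnd ℂ) a⁻¹ = 1 := by
    rw [map_inv₀, ← mul_inv, ha1, inv_one]
  rw [mem_pPartC_iff] at hX ⊢
  rw [hh, coe_inv_eq, Matrix.trace_mul_cycle, ← coe_inv_eq, ← Submonoid.coe_mul, inv_mul_cancel,
    Submonoid.coe_one, Matrix.one_mul, coe_inv_eq k, ha, Matrix.diagonal_conjTranspose,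
    Matrix.mul_diagonal, Matrix.mul_diagonal, Matrix.diagonal_mul, Matrix.diagonal_mul]
  refine ⟨hX.1, ?_⟩
  simp only [Matrix.cons_val, Pi.star_apply, Complex.star_def]
  rw [hX.2]
  linear_combination (((g⁻¹ : SU3) : Mat) * X * (g : Mat)) 2 2 * (ha1 - ha2)

lemma ext_frame (g : SU3) {A B : V →L[ℂ] V} (h : ∀ j, A (frame g j) = B (frame g j)) : A = B := by
  have hm : toMat A * (g : Mat) = toMat B * (g : Mat) := by
    ext i j
    rw [← op_stdE_apply (toMat A * (g : Mat)) i j, ← op_stdE_apply (toMat B * (g : Mat)) i j,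
      op_mul_apply, op_mul_apply, op_toMat, op_toMat]
    exact congrArg (fun v : V => v i) (h j)
  have : toMat A = toMat B := by
    have := congrArg (· * star (g : Mat)) hm
    simpa only [Matrix.mul_assoc, mul_star_coe, Matrix.mul_one] using this
  rw [← op_toMat A, this, op_toMat]

lemma eq_zero_of_inner_frame (g : SU3) {v : V} (h : ∀ j, inner ℂ (frame g j) v = 0) : v = 0 := by
  have h1 : op ((g⁻¹ : SU3) : Mat) v = 0 := by
    ext i
    have h2 := h i
    rw [frame, ← ContinuousLinearMap.adjoint_inner_right, ← op_conjTranspose, ← coe_inv_eq,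
      EuclideanSpace.inner_single_left] at h2
    simpa using h2
  have h2 := op_inv_apply g⁻¹ v
  rw [h1] at h2
  simpa using h2.symm

lemma ext_inner_frame (g : SU3) {u v : V}
    (h : ∀ j, inner ℂ (frame g j) u = inner ℂ (frame g j) v) : u = v := by
  rw [← sub_eq_zero]
  exact eq_zero_of_inner_frame g fun j => by rw [inner_sub_right, h, sub_self]

section Frame
variable {g : SU3} {q : FL2} (hg : FL2.act g FL2.base = q)
include hg

lemma frame_zero : frame g 0 = q.w := ((act_base_eq_iff g q).1 hg).1

lemma frame_one_mem : frame g 1 ∈ q.W := ((act_base_eq_iff g q).1 hg).2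

lemma W_eq_span : q.W = Submodule.span ℂ {frame g 0, frame g 1} := by
  subst hg
  change (Submodule.span ℂ {stdE 0, stdE 1}).map (op (g : Mat)).toLinearMap = _
  rw [Submodule.map_span, Set.image_pair]
  rfl

lemma frame_two_mem : frame g 2 ∈ q.Wᗮ := by
  rw [W_eq_span hg, Submodule.mem_orthogonal]
  intro u hu
  obtain ⟨a, b, rfl⟩ := Submodule.mem_span_pair.1 hu
  rw [inner_add_left, inner_smul_left, inner_smul_left, inner_frame, inner_frame]
  simp

lemma proj_frame_zero : q.W.starProjection (frame g 0) = frame g 0 :=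
  Submodule.starProjection_eq_self_iff.2 (by rw [frame_zero hg]; exact q.w_mem)

lemma proj_frame_one : q.W.starProjection (frame g 1) = frame g 1 :=
  Submodule.starProjection_eq_self_iff.2 (frame_one_mem hg)

lemma proj_frame_two : q.W.starProjection (frame g 2) = 0 :=
  (Submodule.starProjection_apply_eq_zero_iff q.W).2 (frame_two_mem hg)

end Frame

lemma toMat_mem_su3 {A : V →L[ℂ] V} (hA : ContinuousLinearMap.adjoint A = -A) {g : SU3}
    (ht : ∑ j, inner ℂ (frame g j) (A (frame g j)) = 0) : toMat A ∈ su3 := by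
  constructor
  · apply op_injective
    rw [op_conjTranspose, op_toMat, hA]
    change _ = Matrix.toEuclideanCLM (n := Fin 3) (𝕜 := ℂ) (-toMat A)
    rw [map_neg]
    exact congrArg _ (op_toMat A).symm
  · have h1 : (((g⁻¹ : SU3) : Mat) * toMat A * (g : Mat)).trace = (toMat A).trace := by
      rw [Matrix.trace_mul_cycle, ← Submonoid.coe_mul, mul_inv_cancel, Submonoid.coe_one,
        Matrix.one_mul]
    rw [← h1, Matrix.trace, ← ht]
    refine Finset.sum_congr rfl fun j _ => ?_
    rw [Matrix.diag_apply, inv_mul_mul_apply, op_toMat]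

lemma toMat_mem_bundleP {g : SU3} {q : FL2} (hg : FL2.act g FL2.base = q) {A : V →L[ℂ] V}
    (hA : ContinuousLinearMap.adjoint A = -A)
    (ht : ∑ j, inner ℂ (frame g j) (A (frame g j)) = 0)
    (hd : inner ℂ (frame g 1) (A (frame g 1)) = inner ℂ (frame g 2) (A (frame g 2))) :
    toMat A ∈ bundleP q := by
  refine ⟨toMat_mem_su3 hA ht, g, hg, (mem_pPartC_iff _).2 ⟨?_, ?_⟩⟩
  · rw [← ht, Matrix.trace]
    refine Finset.sum_congr rfl fun j _ => ?_
    rw [Matrix.diag_apply, inv_mul_mul_apply, op_toMat]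
  · rw [inv_mul_mul_apply, inv_mul_mul_apply, op_toMat, hd]

/-- `X ↦ d/dt (exp (tX) · q)` is injective on `[𝔭₂]_q`. -/
lemma infAct_injOn (q : FL2) {X Y : Mat} (hX : X ∈ bundleP q) (hY : Y ∈ bundleP q)
    (h : infAct X q = infAct Y q) : X = Y := by
  obtain ⟨hX1, g, hg, hXg⟩ := hX
  obtain ⟨hY1, g', hg', hYg'⟩ := hY
  have hYg := mem_pPartC_of_act_eq (hg'.trans hg.symm) hYg'
  have hZ : ((g⁻¹ : SU3) : Mat) * (X - Y) * (g : Mat) ∈ pPartC := by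
    rw [Matrix.mul_sub, Matrix.sub_mul]
    exact sub_mem hXg hYg
  -- The difference is skew, kills `w` and commutes with the projection onto `W`, hence is diagonal
  -- in the frame with first entry zero. The other two entries are equal and have sum zero.
  set Z := X - Y with hZdef
  have hadj : ContinuousLinearMap.adjoint (op Z) = -op Z := by
    rw [← op_conjTranspose, hZdef, Matrix.conjTranspose_sub, hX1.1, hY1.1]
    unfold op
    rw [← map_neg]
    congr 1
    abel
  have hopZ : op Z = op X - op Y := map_sub _ _ _
  have h0 : op Z (frame g 0) = 0 := by
    rw [frame_zero hg, hopZ]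
    exact sub_eq_zero.2 (congrArg Prod.fst h)
  have h1 : ∀ v, op Z (q.W.starProjection v) = q.W.starProjection (op Z v) := by
    intro v
    have h2 : op X (q.W.starProjection v) - q.W.starProjection (op X v) =
        op Y (q.W.starProjection v) - q.W.starProjection (op Y v) :=
      congrArg (fun a : V × (V →L[ℂ] V) => a.2 v) h
    rw [hopZ]
    simp only [sub_apply, map_sub]
    linear_combination (norm := abel) h2
  rw [mem_pPartC_iff, Matrix.trace_fin_three] at hZ
  simp only [inv_mul_mul_apply] at hZ
  obtain ⟨ht, hd⟩ := hZ
  rw [h0, inner_zero_right, zero_add, hd] at ht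
  have d2 : inner ℂ (frame g 2) (op Z (frame g 2)) = 0 := by linear_combination ht / 2
  have d1 := hd.trans d2
  have skew : ∀ i j, inner ℂ (frame g i) (op Z (frame g j)) =
      -(starRingEnd ℂ) (inner ℂ (frame g j) (op Z (frame g i))) := by
    intro i j
    rw [inner_conj_symm, ← ContinuousLinearMap.adjoint_inner_left, hadj]
    simp
  have z0 : ∀ j, inner ℂ (frame g 0) (op Z (frame g j)) = 0 := by
    intro j
    rw [skew, h0, inner_zero_right, map_zero, neg_zero]
  have z21 : inner ℂ (frame g 2) (op Z (frame g 1)) = 0 := by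
    have := h1 (frame g 1)
    rw [proj_frame_one hg] at this
    rw [this, ← Submodule.inner_starProjection_left_eq_right, proj_frame_two hg, inner_zero_left]
  have z12 : inner ℂ (frame g 1) (op Z (frame g 2)) = 0 := by
    rw [skew, z21, map_zero, neg_zero]
  have hz : op Z = 0 := by
    apply ext_frame g
    intro j
    apply eq_zero_of_inner_frame g
    intro i
    fin_cases i
    · exact z0 j
    · fin_cases j
      · exact (congrArg _ h0).trans (inner_zero_right _)
      · exact d1
      · exact z12
    · fin_cases j
      · exact (congrArg _ h0).trans (inner_zero_right _)
      · exact z21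
      · exact d2
  have : Z = 0 := op_injective (hz.trans (map_zero _).symm)
  exact sub_eq_zero.1 this

/-- Uniqueness makes the choice in `tangentRep` computable: any element of `[𝔭₂]` with the right
infinitesimal action is the chosen one. -/
lemma tangentRep_eq {q : FL2} {ξ : V × (V →L[ℂ] V)} {X : Mat} (hX : X ∈ bundleP q)
    (h : infAct X q = ξ) : tangentRep q ξ = X := by
  have hex : ∃ X ∈ bundleP q, infAct X q = ξ := ⟨X, hX, h⟩
  rw [tangentRep, dif_pos hex]
  exact infAct_injOn q hex.choose_spec.1 hX (hex.choose_spec.2.trans h.symm)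

end

/-! ### An explicit element of `[𝔭₂]` for each tangent vector -/

section

section Ring
variable {A : Type*} [Ring A] {p p' r r' : A}

/-- Here `p` and `r` play the projections onto `W` and onto the line of `w`, and `p'`, `r'` their
derivatives; `h1`–`h4` are the derivatives of `p² = p`, `r² = r`, `pr = r`, `rp = r`. The element is
`∑ P_j' P_j` for the projections `r`, `p - r`, `1 - p`. Its adjoint is `∑ P_j P_j' = ∑ (P_j' - P_j'
P_j)`, and `∑ P_j' = 0`. -/
lemma star_projRep_eq_neg [StarRing A] (sp : star p = p) (sp' : star p' = p') (sr : star r = r)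
    (sr' : star r' = r') (h1 : p' * p + p * p' = p') (h2 : r' * r + r * r' = r')
    (h3 : p' * r + p * r' = r') (h4 : r' * p + r * p' = r') :
    star (r' * r + (p' - r') * (p - r) - p' * (1 - p)) =
      -(r' * r + (p' - r') * (p - r) - p' * (1 - p)) := by
  simp only [star_sub, star_add, star_mul, sp, sp', sr, sr', star_one]
  linear_combination (norm := noncomm_ring) 2 * h1 + 2 * h2 - h3 - h4

/-- Orthogonality of the projections gives `P_k P_j' = -P_k' P_j` for `j ≠ k`, while `P_k P_k' P_k =
0`. Hence `[∑ P_j' P_j, P_k] = P_k' P_k + P_k' (1 - P_k) = P_k'`; adding the cases of the two lines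
in `W` gives the claim. -/
lemma projRep_commutator (hp : p * p = p) (hr : r * r = r) (hpr : p * r = r) (hrp : r * p = r)
    (h1 : p' * p + p * p' = p') (h3 : p' * r + p * r' = r') :
    (r' * r + (p' - r') * (p - r) - p' * (1 - p)) * p -
      p * (r' * r + (p' - r') * (p - r) - p' * (1 - p)) = p' := by
  have a1 : p * p' * p = 0 := by
    linear_combination (norm := noncomm_ring) p * h1 - hp * p'
  have a2 : p * r' = r' - p' * r := by
    linear_combination (norm := noncomm_ring) h3
  have a5 : p * p' * r = 0 := by
    linear_combination (norm := noncomm_ring) h1 * r - p' * hpr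
  linear_combination (norm := noncomm_ring) 2 * (r' * hrp) + 2 * (p' * hp) - p' * hrp - r' * hp
    - 2 * (a2 * r) - 2 * a1 + a5 + a2 * p + h1
    - p' * hrp + 2 * (p' * hr)

/-- Compressed to one of the three lines, `∑ P_j' P_j` becomes `P_k P_k' P_k`, which vanishes for
any derivative of a projection. The next two lemmas are the same fact for the other lines. -/
lemma mul_projRep_mul_line (hr : r * r = r) (hpr : p * r = r)
    (h2 : r' * r + r * r' = r') :
    r * (r' * r + (p' - r') * (p - r) - p' * (1 - p)) * r = 0 := by
  have a : r * r' * r = 0 := by linear_combination (norm := noncomm_ring) r * h2 - hr * r'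
  have z1 : (p - r) * r = 0 := by rw [sub_mul, hpr, hr, sub_self]
  have z2 : (1 - p) * r = 0 := by rw [sub_mul, one_mul, hpr, sub_self]
  linear_combination (norm := noncomm_ring) r * r' * hr + a + r * (p' - r') * z1 - r * p' * z2

lemma mul_projRep_mul_plane (hp : p * p = p) (hr : r * r = r) (hpr : p * r = r) (hrp : r * p = r)
    (h1 : p' * p + p * p' = p') (h2 : r' * r + r * r' = r')
    (h3 : p' * r + p * r' = r') (h4 : r' * p + r * p' = r') :
    (p - r) * (r' * r + (p' - r') * (p - r) - p' * (1 - p)) * (p - r) = 0 := by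
  have z1 : r * (p - r) = 0 := by rw [mul_sub, hrp, hr, sub_self]
  have z2 : (1 - p) * (p - r) = 0 := by rw [sub_mul, one_mul, mul_sub, hp, hpr, sub_self]
  have z3 : (p - r) * (p - r) = p - r := by
    rw [sub_mul, mul_sub, hp, hpr, z1, sub_zero]
  have z4 : (p' - r') * (p - r) + (p - r) * (p' - r') = p' - r' := by
    linear_combination (norm := noncomm_ring) h1 + h2 - h3 - h4
  have z5 : (p - r) * (p' - r') * (p - r) = 0 := by
    calc (p - r) * (p' - r') * (p - r)
        = (p - r) * ((p' - r') * (p - r) + (p - r) * (p' - r')) -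
            (p - r) * (p - r) * (p' - r') := by noncomm_ring
      _ = 0 := by rw [z4, z3, sub_self]
  rw [mul_assoc, sub_mul (r' * r + _) (p' * _), add_mul, mul_assoc r', z1, mul_assoc p',
    z2, mul_assoc (p' - r'),
    z3, mul_zero, zero_add, mul_zero, sub_zero, ← mul_assoc, z5]

lemma mul_projRep_mul_normal (hp : p * p = p) (hrp : r * p = r)
    (h1 : p' * p + p * p' = p') :
    (1 - p) * (r' * r + (p' - r') * (p - r) - p' * (1 - p)) * (1 - p) = 0 := by
  have z1 : r * (1 - p) = 0 := by rw [mul_sub, mul_one, hrp, sub_self]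
  have z2 : (p - r) * (1 - p) = 0 := by
    rw [sub_mul, z1, mul_sub, mul_one, hp, sub_self, sub_zero]
  have z3 : (1 - p) * (1 - p) = 1 - p := by
    rw [sub_mul, one_mul, mul_sub, mul_one, hp, sub_self, sub_zero]
  have z5 : (1 - p) * p' * (1 - p) = 0 := by
    linear_combination (norm := noncomm_ring) p * h1 - h1 - hp * p'
  rw [mul_assoc, sub_mul (r' * r + _) (p' * _), add_mul, mul_assoc r', z1, mul_assoc p',
    z3, mul_assoc (p' - r'),
    z2, mul_zero, zero_add, mul_zero, zero_sub, mul_neg, ← mul_assoc, z5, neg_zero]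

lemma star_relation [StarRing A] (sp : star p = p) (sp' : star p' = p') (sr : star r = r)
    (sr' : star r' = r') (h3 : p' * r + p * r' = r') : r' * p + r * p' = r' := by
  have := congrArg star h3
  rw [star_add, star_mul, star_mul, sp, sp', sr, sr'] at this
  rwa [add_comm]

lemma star_sub_eq_self [StarRing A] {a b : A} (ha : star a = a) (hb : star b = b) :
    star (a - b) = a - b := by rw [star_sub, ha, hb]

/-- The projections do not see the phase of `w`, so a correction along `w` is needed. The operator
`(3r - 1)/2` is `diag(1, -1/2, -1/2)` in an adapted frame: it fixes `w`, commutes with `p` and stays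
in `𝔭₂^ℂ`. The coefficient is imaginary because `|w|` is constant. -/
lemma star_add_smul_eq_neg [StarRing A] [Algebra ℂ A] [StarModule ℂ A] {X : A}
    (hX : star X = -X) (sr : star r = r) {c : ℂ} (hc : (starRingEnd ℂ) c = -c) :
    star (X + c • ((3 / 2 : ℂ) • r - (1 / 2 : ℂ) • 1)) =
      -(X + c • ((3 / 2 : ℂ) • r - (1 / 2 : ℂ) • 1)) := by
  rw [star_add, hX, star_smul, star_sub, star_smul, star_smul, sr, star_one, Complex.star_def, hc, map_div₀,
    map_div₀, Complex.conj_ofNat, Complex.conj_ofNat, map_one]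
  module

lemma commutator_add_smul [Algebra ℂ A] {X Y : A} (hX : X * p - p * X = Y)
    (hpr : p * r = r) (hrp : r * p = r) (c : ℂ) :
    (X + c • ((3 / 2 : ℂ) • r - (1 / 2 : ℂ) • 1)) * p -
      p * (X + c • ((3 / 2 : ℂ) • r - (1 / 2 : ℂ) • 1)) = Y := by
  rw [add_mul, mul_add, smul_mul_assoc, mul_smul_comm, sub_mul, mul_sub, smul_mul_assoc,
    smul_mul_assoc, mul_smul_comm, mul_smul_comm, hpr, hrp, one_mul, mul_one, ← hX]
  abel

end Ring

/-- The element of `[𝔭₂]_q` representing the tangent vector `(w', P')` at `q = (w, W)`, where `P` is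
the projection onto `W`: with the projections `P₀ = w w^*`, `P₁ = P - P₀`, `P₂ = 1 - P` it is
`∑ P_j' P_j + ⟨w, w'⟩ (3 P₀ - 1) / 2`. -/
def projRep (w w' : V) (P P' : V →L[ℂ] V) : V →L[ℂ] V :=
  ((rankOne ℂ w' w + rankOne ℂ w w') * rankOne ℂ w w +
    (P' - (rankOne ℂ w' w + rankOne ℂ w w')) * (P - rankOne ℂ w w) - P' * (1 - P)) +
    inner ℂ w w' • ((3 / 2 : ℂ) • rankOne ℂ w w - (1 / 2 : ℂ) • 1)

/-- The linear relations satisfied by the tangent vectors of `FL₂`. -/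
structure IsTangent (q : FL2) (w' : V) (P' : V →L[ℂ] V) : Prop where
  adjoint_eq : ContinuousLinearMap.adjoint P' = P'
  idem : P' * q.W.starProjection + q.W.starProjection * P' = P'
  apply_w : P' (q.w : V) + q.W.starProjection w' = w'
  inner_w : inner ℂ (q.w : V) w' + inner ℂ w' (q.w : V) = 0

section
variable {q : FL2} {w' : V} {P' : V →L[ℂ] V}

lemma starProjection_mul_self (W : Submodule ℂ V) :
    W.starProjection * W.starProjection = W.starProjection := W.isIdempotentElem_starProjection

lemma inner_apply_eq_zero_of_mul_mul {s X : V →L[ℂ] V} (hs : star s = s) (h : s * X * s = 0)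
    {e : V} (he : s e = e) : inner ℂ e (X e) = 0 := by
  have h1 : s (X (s e)) = 0 := congrArg (fun A : V →L[ℂ] V => A e) h
  rw [he] at h1
  nth_rewrite 1 [← he]
  rw [← ContinuousLinearMap.adjoint_inner_right, ← ContinuousLinearMap.star_eq_adjoint, hs, h1,
    inner_zero_right]

lemma star_starProjection (W : Submodule ℂ V) : star W.starProjection = W.starProjection :=
  isSelfAdjoint_starProjection W

lemma rankOne_mul_rankOne (a b c d : V) :
    rankOne ℂ a b * rankOne ℂ c d = inner ℂ b c • rankOne ℂ a d := by
  ext1 v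
  simp [smul_smul, mul_comm]

lemma mul_rankOne (A : V →L[ℂ] V) (u v : V) : A * rankOne ℂ u v = rankOne ℂ (A u) v := by
  ext1 x
  simp

lemma rankOne_mul (A : V →L[ℂ] V) (u v : V) : rankOne ℂ u v * A = rankOne ℂ u (star A v) := by
  ext1 x
  simp [ContinuousLinearMap.star_eq_adjoint, ContinuousLinearMap.adjoint_inner_left]

lemma star_rankOne (u v : V) : star (rankOne ℂ u v) = rankOne ℂ v u := by
  simp [ContinuousLinearMap.star_eq_adjoint]

lemma inner_w_self (q : FL2) : inner ℂ (q.w : V) (q.w : V) = 1 := by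
  simp [inner_self_eq_norm_sq_to_K]

lemma proj_w (q : FL2) : q.W.starProjection (q.w : V) = q.w :=
  Submodule.starProjection_eq_self_iff.2 q.w_mem

theorem IsTangent.projRep_spec (h : IsTangent q w' P') :
    toMat (projRep (q.w : V) w' q.W.starProjection P') ∈ bundleP q ∧
      infAct (toMat (projRep (q.w : V) w' q.W.starProjection P')) q = (w', P') := by
  set p := q.W.starProjection with hp
  set w : V := (q.w : V) with hw
  set r := rankOne ℂ w w with hr
  set r' := rankOne ℂ w' w + rankOne ℂ w w' with hr'
  set κ := inner ℂ w w' with hκ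
  have ww : inner ℂ w w = 1 := inner_w_self q
  have κ' : inner ℂ w' w = -κ := by linear_combination h.inner_w
  have cκ : (starRingEnd ℂ) κ = -κ := by rw [hκ, inner_conj_symm, κ']
  have pw : p w = w := proj_w q
  have sp : star p = p := star_starProjection _
  have sp' : star P' = P' := h.adjoint_eq
  have sr : star r = r := star_rankOne _ _
  have sr' : star r' = r' := by rw [hr', star_add, star_rankOne, star_rankOne, add_comm]
  have pp : p * p = p := starProjection_mul_self _
  have rr : r * r = r := by rw [hr, rankOne_mul_rankOne, ww, one_smul]
  have pr : p * r = r := by rw [hr, mul_rankOne, pw]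
  have rp : r * p = r := by rw [hr, rankOne_mul, sp, pw]
  have h1 : P' * p + p * P' = P' := h.idem
  have h2 : r' * r + r * r' = r' := by
    rw [hr, hr', add_mul, mul_add]
    simp only [rankOne_mul_rankOne, ww, κ', ← hκ]
    module
  have h3 : P' * r + p * r' = r' := by
    rw [hr, hr', mul_add]
    simp only [mul_rankOne, pw]
    have e : rankOne ℂ (P' w) w + rankOne ℂ (p w') w = rankOne ℂ w' w := by
      ext1 v
      simp only [add_apply, InnerProductSpace.rankOne_apply, ← smul_add]
      exact congrArg _ h.apply_w
    rw [← add_assoc, e]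
  have h4 : r' * p + r * P' = r' := by
    exact star_relation sp sp' sr sr' h3
  obtain ⟨g, hg⟩ := exists_act_base_eq q
  have hR : projRep w w' p P' = (r' * r + (P' - r') * (p - r) - P' * (1 - p)) +
    κ • ((3 / 2 : ℂ) • r - (1 / 2 : ℂ) • 1) := rfl
  set X₀ := r' * r + (P' - r') * (p - r) - P' * (1 - p) with hX₀
  have skew : star X₀ = -X₀ := star_projRep_eq_neg sp sp' sr sr' h1 h2 h3 h4
  have comm : X₀ * p - p * X₀ = P' := projRep_commutator pp rr pr rp h1 h3
  have c0 : r * X₀ * r = 0 := mul_projRep_mul_line rr pr h2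
  have c1 : (p - r) * X₀ * (p - r) = 0 := mul_projRep_mul_plane pp rr pr rp h1 h2 h3 h4
  have c2 : (1 - p) * X₀ * (1 - p) = 0 := mul_projRep_mul_normal pp rp h1
  have hdiag : ∀ j, inner ℂ (frame g j) (X₀ (frame g j)) = 0 := by
    have hr1 : r (frame g 1) = 0 := by
      rw [hr, InnerProductSpace.rankOne_apply, hw, ← frame_zero hg, inner_frame]; simp
    have hr2 : r (frame g 2) = 0 := by
      rw [hr, InnerProductSpace.rankOne_apply, hw, ← frame_zero hg, inner_frame]; simp
    intro j
    fin_cases j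
    · refine inner_apply_eq_zero_of_mul_mul sr c0 ?_
      rw [hr, InnerProductSpace.rankOne_apply, hw, ← frame_zero hg, inner_frame]; simp
    · refine inner_apply_eq_zero_of_mul_mul (star_sub_eq_self sp sr) c1 ?_
      change p (frame g 1) - r (frame g 1) = frame g 1
      rw [hr1, sub_zero, proj_frame_one hg]
    · refine inner_apply_eq_zero_of_mul_mul (star_sub_eq_self (star_one _) sp) c2 ?_
      change frame g 2 - p (frame g 2) = frame g 2
      rw [proj_frame_two hg, sub_zero]
  -- The diagonal is `κ (1, -1/2, -1/2)`: trace zero with equal last two entries, as membership in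
  -- `𝔭₂^ℂ` demands.
  have hrep : ∀ j, inner ℂ (frame g j) (projRep w w' p P' (frame g j)) =
      κ * ((3 / 2) * (if j = 0 then 1 else 0) - 1 / 2) := by
    intro j
    have e : projRep w w' p P' (frame g j) = X₀ (frame g j) +
      κ • ((3 / 2 : ℂ) • (inner ℂ w (frame g j) • w) - (1 / 2 : ℂ) • frame g j) := rfl
    rw [e, inner_add_right, hdiag, inner_smul_right, inner_sub_right, inner_smul_right,
      inner_smul_right, inner_smul_right, hw, ← frame_zero hg, inner_frame, inner_frame,
      inner_frame]
    fin_cases j <;> simp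
  refine ⟨toMat_mem_bundleP hg ?_ ?_ ?_, ?_⟩
  · exact star_add_smul_eq_neg skew sr cκ
  · simp only [hrep, Fin.sum_univ_three]
    simp
    ring
  · rw [hrep, hrep]; simp
  · rw [infAct, op_toMat]
    refine Prod.ext ?_ ?_
    · change projRep w w' p P' w = w'
      have e : projRep w w' p P' w = (r' (inner ℂ w w • w) + (P' - r') (p w - inner ℂ w w • w)
        - P' (w - p w)) + κ • ((3 / 2 : ℂ) • (inner ℂ w w • w) - (1 / 2 : ℂ) • w) := rfl
      have e' : r' w = inner ℂ w w • w' + inner ℂ w' w • w := rfl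
      rw [e, ww, pw, one_smul, sub_self, map_zero, map_zero, e', κ', ww]
      module
    · change projRep w w' p P' * p - p * projRep w w' p P' = P'
      exact commutator_add_smul comm pr rp κ
end

end

/-! ### Calculus of `∂/∂z` and `∂/∂z̄` for vector-valued maps -/

section

section Calculus
variable {E F G : Type*} [NormedAddCommGroup E] [NormedSpace ℂ E] [NormedAddCommGroup F]
  [NormedSpace ℂ F] [NormedAddCommGroup G] [NormedSpace ℂ G]

/-- `(∂s/∂x - c ∂s/∂y) / 2`: the operator `∂/∂z` for `c = i` and `∂/∂z̄` for `c = -i`. -/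
def wd (c : ℂ) (s : ℂ → F) (z : ℂ) : F :=
  (1 / 2 : ℂ) • (fderiv ℝ s z 1 - c • fderiv ℝ s z I)

lemma dz_eq_wd (s : ℂ → F) (z : ℂ) : dz s z = wd I s z := rfl

lemma fderiv_one_eq (s : ℂ → F) (z : ℂ) : fderiv ℝ s z 1 = wd I s z + wd (-I) s z := by
  simp only [wd]; module

lemma fderiv_I_eq (s : ℂ → F) (z : ℂ) : fderiv ℝ s z I = I • (wd I s z - wd (-I) s z) := by
  simp only [wd]
  have : I • ((1 / 2 : ℂ) • (fderiv ℝ s z 1 - I • fderiv ℝ s z I) -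
      (1 / 2 : ℂ) • (fderiv ℝ s z 1 - -I • fderiv ℝ s z I)) =
      (-(I * I)) • fderiv ℝ s z I := by module
  rw [this, I_mul_I, neg_neg, one_smul]

lemma fderiv_eq_re_im (s : ℂ → F) (z v : ℂ) :
    fderiv ℝ s z v = (v.re : ℂ) • fderiv ℝ s z 1 + (v.im : ℂ) • fderiv ℝ s z I := by
  have hv : v = v.re • (1 : ℂ) + v.im • I := by
    rw [Complex.real_smul, Complex.real_smul, mul_one, Complex.re_add_im]
  conv_lhs => rw [hv, map_add, map_smul, map_smul]
  rw [Complex.coe_smul, Complex.coe_smul]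

lemma wd_congr {s t : ℂ → F} {z : ℂ} (c : ℂ) (h : s =ᶠ[nhds z] t) : wd c s z = wd c t z := by
  rw [wd, wd, h.fderiv_eq]

lemma wd_const (c : ℂ) (a : F) (z : ℂ) : wd c (fun _ => a) z = 0 := by
  simp [wd]

lemma wd_add {s t : ℂ → F} {z : ℂ} (c : ℂ) (hs : DifferentiableAt ℝ s z)
    (ht : DifferentiableAt ℝ t z) : wd c (fun x => s x + t x) z = wd c s z + wd c t z := by
  simp only [wd]
  rw [fderiv_fun_add hs ht, add_apply, add_apply]
  module

lemma wd_sub {s t : ℂ → F} {z : ℂ} (c : ℂ) (hs : DifferentiableAt ℝ s z)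
    (ht : DifferentiableAt ℝ t z) : wd c (fun x => s x - t x) z = wd c s z - wd c t z := by
  simp only [wd]
  rw [fderiv_fun_sub hs ht, sub_apply, sub_apply]
  module

lemma wd_const_smul {s : ℂ → F} {z : ℂ} (c a : ℂ) (hs : DifferentiableAt ℝ s z) :
    wd c (fun x => a • s x) z = a • wd c s z := by
  simp only [wd]
  rw [fderiv_fun_const_smul hs, smul_apply, smul_apply]
  module

lemma contDiffAt_wd {s : ℂ → F} {z : ℂ} (c : ℂ) (hs : ContDiffAt ℝ ∞ s z) :
    ContDiffAt ℝ ∞ (wd c s) z := by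
  have h : ContDiffAt ℝ ∞ (fderiv ℝ s) z := hs.fderiv_right (m := ∞) (by simp)
  have h1 : ∀ v : ℂ, ContDiffAt ℝ ∞ (fun x => fderiv ℝ s x v) z := fun v =>
    h.clm_apply contDiffAt_const
  exact ((h1 1).sub ((h1 I).const_smul c)).const_smul (1 / 2 : ℂ)

/-- The Leibniz rule for maps which are real bilinear. -/
lemma fderiv_bilin {B : E → F → G} (hB : IsBoundedBilinearMap ℝ fun p : E × F => B p.1 p.2)
    {u : ℂ → E} {v : ℂ → F} {z : ℂ} (hu : DifferentiableAt ℝ u z) (hv : DifferentiableAt ℝ v z)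
    (h : ℂ) : fderiv ℝ (fun x => B (u x) (v x)) z h =
      B (u z) (fderiv ℝ v z h) + B (fderiv ℝ u z h) (v z) := by
  have h1 := (hB.hasFDerivAt (u z, v z)).comp z (hu.hasFDerivAt.prodMk hv.hasFDerivAt)
  have h2 : fderiv ℝ (fun x => B (u x) (v x)) z = _ := h1.fderiv
  rw [h2]
  rfl

lemma contDiffAt_bilin {B : E → F → G}
    (hB : IsBoundedBilinearMap ℝ fun p : E × F => B p.1 p.2)
    {u : ℂ → E} {v : ℂ → F} {z : ℂ} (hu : ContDiffAt ℝ ∞ u z) (hv : ContDiffAt ℝ ∞ v z) :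
    ContDiffAt ℝ ∞ (fun x => B (u x) (v x)) z := by
  have h : ContDiff ℝ ∞ fun p : E × F => B p.1 p.2 := hB.contDiff
  exact ContDiffAt.comp z h.contDiffAt (hu.prodMk hv)

lemma wd_bilin {B : E → F → G} (hB : IsBoundedBilinearMap ℝ fun p : E × F => B p.1 p.2)
    (hl : ∀ (a : ℂ) u v, B (a • u) v = a • B u v) (hr : ∀ (a : ℂ) u v, B u (a • v) = a • B u v)
    {u : ℂ → E} {v : ℂ → F} {z : ℂ} (c : ℂ) (hu : DifferentiableAt ℝ u z)
    (hv : DifferentiableAt ℝ v z) :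
    wd c (fun x => B (u x) (v x)) z = B (wd c u z) (v z) + B (u z) (wd c v z) := by
  have hsl : ∀ u u' v, B (u - u') v = B u v - B u' v := fun u u' v => hB.map_sub_left
  have hsr : ∀ u v v', B u (v - v') = B u v - B u v' := fun u v v' => hB.map_sub_right
  simp only [wd, fderiv_bilin hB hu hv, hl, hr, hsl, hsr]
  module

/-- The coefficient `c` leaves a conjugate-linear slot conjugated; for `c = ±i` this exchanges `∂`
and `∂̄` in that slot. -/
lemma wd_sesq_left {B : E → F → G} (hB : IsBoundedBilinearMap ℝ fun p : E × F => B p.1 p.2)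
    (hl : ∀ (a : ℂ) u v, B (a • u) v = (starRingEnd ℂ) a • B u v)
    (hr : ∀ (a : ℂ) u v, B u (a • v) = a • B u v)
    {u : ℂ → E} {v : ℂ → F} {z : ℂ} (c : ℂ) (hu : DifferentiableAt ℝ u z)
    (hv : DifferentiableAt ℝ v z) : wd c (fun x => B (u x) (v x)) z =
      B (wd ((starRingEnd ℂ) c) u z) (v z) + B (u z) (wd c v z) := by
  have hsl : ∀ u u' v, B (u - u') v = B u v - B u' v := fun u u' v => hB.map_sub_left
  have hsr : ∀ u v v', B u (v - v') = B u v - B u v' := fun u v v' => hB.map_sub_right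
  simp only [wd, fderiv_bilin hB hu hv, hl, hr, hsl, hsr, Complex.conj_conj, map_div₀, map_one,
    Complex.conj_ofNat]
  module

lemma wd_sesq_right {B : E → F → G} (hB : IsBoundedBilinearMap ℝ fun p : E × F => B p.1 p.2)
    (hl : ∀ (a : ℂ) u v, B (a • u) v = a • B u v)
    (hr : ∀ (a : ℂ) u v, B u (a • v) = (starRingEnd ℂ) a • B u v)
    {u : ℂ → E} {v : ℂ → F} {z : ℂ} (c : ℂ) (hu : DifferentiableAt ℝ u z)
    (hv : DifferentiableAt ℝ v z) : wd c (fun x => B (u x) (v x)) z =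
      B (wd c u z) (v z) + B (u z) (wd ((starRingEnd ℂ) c) v z) := by
  have hsl : ∀ u u' v, B (u - u') v = B u v - B u' v := fun u u' v => hB.map_sub_left
  have hsr : ∀ u v v', B u (v - v') = B u v - B u v' := fun u v v' => hB.map_sub_right
  simp only [wd, fderiv_bilin hB hu hv, hl, hr, hsl, hsr, Complex.conj_conj, map_div₀, map_one,
    Complex.conj_ofNat]
  module

lemma isBoundedBilinearMap_of_clm (B : E →L[ℂ] F →L[ℂ] G) :
    IsBoundedBilinearMap ℝ fun p : E × F => B p.1 p.2 :=
  (B.bilinearRestrictScalars ℝ).isBoundedBilinearMap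

lemma isBoundedBilinearMap_clm_apply :
    IsBoundedBilinearMap ℝ fun p : (E →L[ℂ] F) × E => p.1 p.2 :=
  isBoundedBilinearMap_of_clm (ContinuousLinearMap.id ℂ (E →L[ℂ] F))

lemma wd_apply {A : ℂ → E →L[ℂ] F} {u : ℂ → E} {z : ℂ} (c : ℂ) (hA : DifferentiableAt ℝ A z)
    (hu : DifferentiableAt ℝ u z) :
    wd c (fun x => A x (u x)) z = wd c A z (u z) + A z (wd c u z) :=
  wd_bilin (B := fun (A : E →L[ℂ] F) u => A u) isBoundedBilinearMap_clm_apply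
    (fun _ _ _ => rfl) (fun _ _ _ => map_smul _ _ _) c hA hu

lemma wd_clm (L : E →L[ℂ] F) {u : ℂ → E} {z : ℂ} (c : ℂ) (hu : DifferentiableAt ℝ u z) :
    wd c (fun x => L (u x)) z = L (wd c u z) := by
  have := wd_apply (A := fun _ => L) c (differentiableAt_const _) hu
  rw [this, wd_const, zero_apply, zero_add]

lemma wd_smul {a : ℂ → ℂ} {u : ℂ → E} {z : ℂ} (c : ℂ) (ha : DifferentiableAt ℝ a z)
    (hu : DifferentiableAt ℝ u z) :
    wd c (fun x => a x • u x) z = wd c a z • u z + a z • wd c u z :=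
  wd_bilin (B := fun (a : ℂ) (u : E) => a • u) isBoundedBilinearMap_smul
    (fun _ _ _ => smul_assoc _ _ _) (fun _ _ _ => smul_comm _ _ _) c ha hu

/-- Symmetry of the second derivative cancels the mixed terms. Leaving the sign of `c` open covers
both `4∂∂̄` and `4∂̄∂`. -/
lemma laplacian_eq_wd {s : ℂ → F} {z : ℂ} (hs : ContDiffAt ℝ ∞ s z) {c : ℂ} (hc : c * c = -1) :
    Laplacian.laplacian s z = (4 : ℂ) • wd c (wd (-c) s) z := by
  have h2 : ContDiffAt ℝ 2 s z := hs.of_le (WithTop.coe_le_coe.2 (le_top : (2 : ℕ∞) ≤ ⊤))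
  have hd : DifferentiableAt ℝ (fderiv ℝ s) z :=
    (hs.fderiv_right (m := ∞) (by simp)).differentiableAt (by simp)
  have hdv : ∀ v : ℂ, DifferentiableAt ℝ (fun x => fderiv ℝ s x v) z := fun v =>
    hd.clm_apply (differentiableAt_const v)
  have hv : ∀ v w : ℂ, fderiv ℝ (fun x => fderiv ℝ s x v) z w = fderiv ℝ (fderiv ℝ s) z w v := by
    intro v w
    rw [fderiv_clm_apply hd (differentiableAt_const v)]
    simp
  have hsymm : fderiv ℝ (fderiv ℝ s) z 1 I = fderiv ℝ (fderiv ℝ s) z I 1 :=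
    h2.isSymmSndFDerivAt (by simp) 1 I
  have hw : ∀ w : ℂ, fderiv ℝ (wd (-c) s) z w = (1 / 2 : ℂ) • (fderiv ℝ (fderiv ℝ s) z w 1 +
      c • fderiv ℝ (fderiv ℝ s) z w I) := by
    intro w
    have e : wd (-c) s = fun x => (1 / 2 : ℂ) • (fderiv ℝ s x 1 - (-c) • fderiv ℝ s x I) := rfl
    have hsm : DifferentiableAt ℝ (fun x => (-c) • fderiv ℝ s x I) z := (hdv I).const_smul _
    have hsub : DifferentiableAt ℝ (fun x => fderiv ℝ s x 1 - (-c) • fderiv ℝ s x I) z :=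
      (hdv 1).sub hsm
    rw [e, fderiv_fun_const_smul hsub, smul_apply,
      fderiv_fun_sub (hdv 1) hsm, sub_apply,
      fderiv_fun_const_smul (hdv I), smul_apply, hv, hv]
    module
  rw [InnerProductSpace.laplacian_eq_iteratedFDeriv_complexPlane]
  simp only [iteratedFDeriv_two_apply, wd, hw]
  simp only [Matrix.cons_val_zero, Matrix.cons_val_one]
  rw [hsymm]
  have h4 : ∀ a b d : F, (4 : ℂ) • ((1 / 2 : ℂ) • ((1 / 2 : ℂ) • (a + c • d) -
      c • (1 / 2 : ℂ) • (d + c • b))) = a - (c * c) • b := by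
    intro a b d; module
  have := h4 (fderiv ℝ (fderiv ℝ s) z 1 1) (fderiv ℝ (fderiv ℝ s) z I I)
    (fderiv ℝ (fderiv ℝ s) z I 1)
  rw [hc, neg_one_smul, sub_neg_eq_add] at this
  exact this.symm

/-- Both orders compute a quarter of the Laplacian. -/
lemma wd_wd_comm {s : ℂ → F} {z : ℂ} (hs : ContDiffAt ℝ ∞ s z) :
    wd (-I) (wd I s) z = wd I (wd (-I) s) z := by
  have h1 := laplacian_eq_wd hs (c := I) I_mul_I
  have h2 := laplacian_eq_wd hs (c := -I) (by rw [neg_mul_neg, I_mul_I])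
  rw [neg_neg] at h2
  rw [h1] at h2
  exact (smul_right_injective F (by norm_num : (4 : ℂ) ≠ 0) h2).symm

end Calculus

section Inner

lemma isBoundedBilinearMap_inner_V : IsBoundedBilinearMap ℝ fun p : V × V => inner ℂ p.1 p.2 :=
  isBoundedBilinearMap_inner (𝕜 := ℂ)

lemma wd_inner {u v : ℂ → V} {z : ℂ} (c : ℂ) (hu : DifferentiableAt ℝ u z)
    (hv : DifferentiableAt ℝ v z) : wd c (fun x => inner ℂ (u x) (v x)) z =
      inner ℂ (wd ((starRingEnd ℂ) c) u z) (v z) + inner ℂ (u z) (wd c v z) :=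
  wd_sesq_left (B := fun u v : V => inner ℂ u v) isBoundedBilinearMap_inner_V
    (fun _ _ _ => inner_smul_left _ _ _) (fun _ _ _ => inner_smul_right _ _ _) c hu hv

lemma rankOne_smul_left (a : ℂ) (u v : V) : rankOne ℂ (a • u) v = a • rankOne ℂ u v := by
  rw [map_smul]; rfl

lemma rankOne_smul_right (a : ℂ) (u v : V) :
    rankOne ℂ u (a • v) = (starRingEnd ℂ) a • rankOne ℂ u v := map_smulₛₗ _ _ _

lemma isBoundedBilinearMap_rankOne :
    IsBoundedBilinearMap ℝ fun p : V × V => rankOne ℂ p.1 p.2 where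
  add_left _ _ _ := by ext1 v; simp
  smul_left a x y := by
    rw [← Complex.coe_smul, rankOne_smul_left, Complex.coe_smul]
  add_right _ _ _ := by ext1 v; simp
  smul_right a x y := by
    rw [← Complex.coe_smul, rankOne_smul_right, Complex.conj_ofReal, Complex.coe_smul]
  bound := ⟨1, one_pos, fun x y => by simp⟩

lemma wd_rankOne {u v : ℂ → V} {z : ℂ} (c : ℂ) (hu : DifferentiableAt ℝ u z)
    (hv : DifferentiableAt ℝ v z) : wd c (fun x => rankOne ℂ (u x) (v x)) z =
      rankOne ℂ (wd c u z) (v z) + rankOne ℂ (u z) (wd ((starRingEnd ℂ) c) v z) :=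
  wd_sesq_right (B := fun u v : V => rankOne ℂ u v) isBoundedBilinearMap_rankOne
    rankOne_smul_left rankOne_smul_right c hu hv

lemma contDiffAt_inner {u v : ℂ → V} {z : ℂ} (hu : ContDiffAt ℝ ∞ u z)
    (hv : ContDiffAt ℝ ∞ v z) : ContDiffAt ℝ ∞ (fun x => inner ℂ (u x) (v x)) z :=
  contDiffAt_bilin (B := fun u v : V => inner ℂ u v) isBoundedBilinearMap_inner_V hu hv

lemma contDiffAt_rankOne {u v : ℂ → V} {z : ℂ} (hu : ContDiffAt ℝ ∞ u z)
    (hv : ContDiffAt ℝ ∞ v z) : ContDiffAt ℝ ∞ (fun x => rankOne ℂ (u x) (v x)) z :=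
  contDiffAt_bilin (B := fun u v : V => rankOne ℂ u v) isBoundedBilinearMap_rankOne hu hv

lemma isBoundedBilinearMap_mul_clm :
    IsBoundedBilinearMap ℝ fun p : (V →L[ℂ] V) × (V →L[ℂ] V) => p.1 * p.2 :=
  isBoundedBilinearMap_of_clm (ContinuousLinearMap.mul ℂ (V →L[ℂ] V))

lemma fderiv_mul_clm {A B : ℂ → V →L[ℂ] V} {z : ℂ} (hA : DifferentiableAt ℝ A z)
    (hB : DifferentiableAt ℝ B z) (h : ℂ) : fderiv ℝ (fun x => A x * B x) z h =
      A z * fderiv ℝ B z h + fderiv ℝ A z h * B z :=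
  fderiv_bilin (B := fun A B : V →L[ℂ] V => A * B) isBoundedBilinearMap_mul_clm hA hB h

/-- The adjoint as a real linear map. -/
def adjointL : (V →L[ℂ] V) →L[ℝ] (V →L[ℂ] V) :=
  LinearMap.toContinuousLinearMap
    { toFun := fun A => ContinuousLinearMap.adjoint A
      map_add' := fun _ _ => map_add _ _ _
      map_smul' := fun a A => by
        rw [← Complex.coe_smul, ← Complex.coe_smul, map_smulₛₗ]
        simp }

end Inner

end

/-! ### Pointwise equations of conformal harmonic Legendrian maps; derivatives of maps into `FL₂` -/

section

/-- The equations of a weakly conformal harmonic horizontal map `f` into `S⁵` at the point `z` of a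
coordinate domain. -/
structure IsLegendrianAt (f : ℂ → V) (z : ℂ) : Prop where
  smooth : ContDiffAt ℝ ∞ f z
  unit : inner ℂ (f z) (f z) = 1
  inner_dz : inner ℂ (f z) (wd I f z) = 0
  inner_dzb : inner ℂ (f z) (wd (-I) f z) = 0
  inner_dz_dzb : inner ℂ (wd I f z) (wd (-I) f z) = 0
  norm_eq : inner ℂ (wd I f z) (wd I f z) = inner ℂ (wd (-I) f z) (wd (-I) f z)
  dz_dzb : wd I (wd (-I) f) z = -inner ℂ (wd I f z) (wd I f z) • f z

namespace IsLegendrianAt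
variable {f : ℂ → V} {z : ℂ} (h : IsLegendrianAt f z)
include h

lemma differentiableAt : DifferentiableAt ℝ f z := h.smooth.differentiableAt (by simp)

lemma inner_fderiv (v : ℂ) : inner ℂ (f z) (fderiv ℝ f z v) = 0 := by
  rw [fderiv_eq_re_im, fderiv_one_eq, fderiv_I_eq]
  simp only [inner_add_right, inner_smul_right, inner_sub_right, h.inner_dz, h.inner_dzb, add_zero,
    sub_zero, mul_zero]

lemma inner_fderiv_left (v : ℂ) : inner ℂ (fderiv ℝ f z v) (f z) = 0 :=
  inner_eq_zero_symm.1 (h.inner_fderiv v)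

lemma inner_dzb_dz : inner ℂ (wd (-I) f z) (wd I f z) = 0 := inner_eq_zero_symm.1 h.inner_dz_dzb

/-- The real part of this Hermitian product expresses conformality, the imaginary part the
Lagrangian condition. -/
lemma inner_fderiv_fderiv : inner ℂ (fderiv ℝ f z 1) (fderiv ℝ f z I) = 0 := by
  rw [fderiv_one_eq, fderiv_I_eq]
  simp only [inner_add_left, inner_smul_right, inner_sub_right, h.inner_dz_dzb, h.inner_dzb_dz,
    h.norm_eq]
  ring

lemma inner_fderiv_one : inner ℂ (fderiv ℝ f z 1) (fderiv ℝ f z 1) =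
    2 * inner ℂ (wd I f z) (wd I f z) := by
  rw [fderiv_one_eq]
  simp only [inner_add_left, inner_add_right, h.inner_dz_dzb, h.inner_dzb_dz, ← h.norm_eq]
  ring

lemma inner_fderiv_I : inner ℂ (fderiv ℝ f z I) (fderiv ℝ f z I) =
    2 * inner ℂ (wd I f z) (wd I f z) := by
  rw [fderiv_I_eq]
  simp only [inner_smul_left, inner_smul_right, inner_sub_left, inner_sub_right, h.inner_dz_dzb,
    h.inner_dzb_dz, ← h.norm_eq, conj_I]
  linear_combination (-2 * inner ℂ (wd I f z) (wd I f z)) * I_mul_I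

lemma norm_fderiv_eq : ‖fderiv ℝ f z 1‖ = ‖fderiv ℝ f z I‖ := by
  rw [@norm_eq_sqrt_re_inner ℂ, @norm_eq_sqrt_re_inner ℂ _ _ _ _ (fderiv ℝ f z I),
    h.inner_fderiv_one, h.inner_fderiv_I]

lemma laplacian_eq : Laplacian.laplacian f z =
    -(4 * inner ℂ (wd I f z) (wd I f z)) • f z := by
  rw [laplacian_eq_wd h.smooth I_mul_I, h.dz_dzb]
  module

/-- With `φ = [f]` embedded as `f f^*`, horizontality kills the term that differentiates `f^*`. So
`dφ`, seen in `Hom(ℓ, ℓ^⊥)`, is `df`, and metric properties pass between `f` and `φ`. -/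
lemma fderiv_rankOne_apply (v : ℂ) {u : V} (hu : u ∈ ℂ ∙ f z) :
    fderiv ℝ (fun x => rankOne ℂ (f x) (f x)) z v u = inner ℂ (f z) u • fderiv ℝ f z v := by
  rw [fderiv_bilin (B := fun u v : V => rankOne ℂ u v) isBoundedBilinearMap_rankOne
    h.differentiableAt h.differentiableAt]
  obtain ⟨a, rfl⟩ := Submodule.mem_span_singleton.1 hu
  simp only [add_apply, InnerProductSpace.rankOne_apply, inner_smul_right, h.inner_fderiv_left,
    mul_zero, zero_smul, zero_add]

/-- Of the four terms of `∂∂̄(f f^*)`, the two with first derivatives of `f` in the right slot kill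
`f` by horizontality. The term `f (∂̄∂f)^*` takes values in the line of `f`, and `(∂∂̄f) f^*` does
so by harmonicity. -/
lemma laplacian_rankOne_apply {u : V} (hu : u ∈ ℂ ∙ f z) :
    Laplacian.laplacian (fun x => rankOne ℂ (f x) (f x)) z u ∈ ℂ ∙ f z := by
  have hs := h.smooth
  have d : ∀ {g : ℂ → V}, ContDiffAt ℝ ∞ g z → DifferentiableAt ℝ g z := fun hg =>
    hg.differentiableAt (by simp)
  have e : wd (-I) (fun x => rankOne ℂ (f x) (f x)) =ᶠ[nhds z] fun x =>
      rankOne ℂ (wd (-I) f x) (f x) + rankOne ℂ (f x) (wd I f x) := by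
    have : ∀ᶠ x in nhds z, DifferentiableAt ℝ f x :=
      ((hs.of_le (m := 1) (by simp)).eventually (by simp)).mono fun x hx =>
        hx.differentiableAt (by simp)
    filter_upwards [this] with x hx
    rw [wd_rankOne _ hx hx, map_neg, conj_I, neg_neg]
  have s1 := contDiffAt_wd I hs
  have s2 := contDiffAt_wd (-I) hs
  rw [laplacian_eq_wd (contDiffAt_rankOne hs hs) I_mul_I, wd_congr I e,
    wd_add I ((contDiffAt_rankOne s2 hs).differentiableAt (by simp))
      ((contDiffAt_rankOne hs s1).differentiableAt (by simp)),
    wd_rankOne I (d s2) (d hs), wd_rankOne I (d hs) (d s1), conj_I, h.dz_dzb]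
  obtain ⟨a, rfl⟩ := Submodule.mem_span_singleton.1 hu
  have z1 : inner ℂ (wd I f z) (f z) = 0 := inner_eq_zero_symm.1 h.inner_dz
  have z2 : inner ℂ (wd (-I) f z) (f z) = 0 := inner_eq_zero_symm.1 h.inner_dzb
  have hmem : f z ∈ ℂ ∙ f z := Submodule.mem_span_singleton_self _
  simp only [smul_apply, add_apply, InnerProductSpace.rankOne_apply, inner_smul_right, z1, z2,
    mul_zero, zero_smul, add_zero, zero_add]
  refine Submodule.smul_mem _ _ (add_mem ?_ ?_)
  · exact Submodule.smul_mem _ _ (Submodule.smul_mem _ _ hmem)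
  · exact Submodule.smul_mem _ _ hmem

/-- The vectors `f_x`, `f_y` are orthogonal with the same squared length `2|∂f|²`, so either `df =
0` or they are independent. -/
lemma fderiv_injective (hne : fderiv ℝ f z ≠ 0) : Function.Injective (fderiv ℝ f z) := by
  set N := inner ℂ (wd I f z) (wd I f z) with hN
  have hN0 : N ≠ 0 := by
    intro h0
    apply hne
    have h1 : fderiv ℝ f z 1 = 0 := by
      rw [← inner_self_eq_zero (𝕜 := ℂ), h.inner_fderiv_one, ← hN, h0, mul_zero]
    have h2 : fderiv ℝ f z I = 0 := by
      rw [← inner_self_eq_zero (𝕜 := ℂ), h.inner_fderiv_I, ← hN, h0, mul_zero]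
    ext1 v
    rw [fderiv_eq_re_im, h1, h2]
    simp
  rw [injective_iff_map_eq_zero]
  intro v hv
  rw [fderiv_eq_re_im] at hv
  have h1 := congrArg (fun u => inner ℂ (fderiv ℝ f z 1) u) hv
  have h2 := congrArg (fun u => inner ℂ (fderiv ℝ f z I) u) hv
  have h3 : inner ℂ (fderiv ℝ f z I) (fderiv ℝ f z 1) = 0 :=
    inner_eq_zero_symm.1 h.inner_fderiv_fderiv
  simp only [inner_add_right, inner_smul_right, h.inner_fderiv_fderiv, h3, h.inner_fderiv_one,
    h.inner_fderiv_I, inner_zero_right, mul_zero, zero_add, add_zero, ← hN] at h1 h2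
  have n2 : (2 : ℂ) * N ≠ 0 := mul_ne_zero two_ne_zero hN0
  have h1' := (mul_eq_zero.1 h1).resolve_right n2
  have h2' := (mul_eq_zero.1 h2).resolve_right n2
  exact Complex.ext (by exact_mod_cast h1') (by exact_mod_cast h2')

lemma fderiv_rankOne_injective (hne : fderiv ℝ f z ≠ 0) :
    Function.Injective (fderiv ℝ (fun x => rankOne ℂ (f x) (f x)) z) := by
  have hi := h.fderiv_injective hne
  rw [injective_iff_map_eq_zero] at hi ⊢
  intro v hv
  apply hi
  have := h.fderiv_rankOne_apply v (Submodule.mem_span_singleton_self (f z))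
  rw [hv, h.unit, one_smul] at this
  exact this.symm

end IsLegendrianAt

lemma submodule_hopf (w : S5) : (hopf w).submodule = ℂ ∙ (w : V) :=
  Projectivization.submodule_mk (w : V) _

lemma emb_hopf (w : S5) : CP2.emb (hopf w) = rankOne ℂ (w : V) (w : V) := by
  have h : ∀ (K : Submodule ℂ V), K = ℂ ∙ (w : V) →
      K.starProjection = rankOne ℂ (w : V) (w : V) := by
    rintro _ rfl
    ext1 v
    rw [Submodule.starProjection_unit_singleton ℂ (by simp)]
    simp
  exact h _ (submodule_hopf w)

section Primitive

variable {q : ℂ → FL2} {z : ℂ}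

lemma contDiffAt_w (hq : ContDiffAt ℝ ∞ (fun x => FL2.emb (q x)) z) :
    ContDiffAt ℝ ∞ (fun x => ((q x).w : V)) z := hq.fst

lemma contDiffAt_proj (hq : ContDiffAt ℝ ∞ (fun x => FL2.emb (q x)) z) :
    ContDiffAt ℝ ∞ (fun x => (q x).W.starProjection) z := hq.snd

lemma fderiv_emb (hq : ContDiffAt ℝ ∞ (fun x => FL2.emb (q x)) z) (v : ℂ) :
    fderiv ℝ (fun x => FL2.emb (q x)) z v =
      (fderiv ℝ (fun x => ((q x).w : V)) z v, fderiv ℝ (fun x => (q x).W.starProjection) z v) := by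
  have h1 := (contDiffAt_w hq).differentiableAt (by simp)
  have h2 := (contDiffAt_proj hq).differentiableAt (by simp)
  have := (h1.hasFDerivAt.prodMk h2.hasFDerivAt).fderiv
  exact congrArg (fun L => L v) this

/-- The four relations are the derivatives of `P^* = P`, `P² = P`, `P w = w` and `⟨w, w⟩ = 1`. -/
lemma isTangent_fderiv (hq : ContDiffAt ℝ ∞ (fun x => FL2.emb (q x)) z) (v : ℂ) :
    IsTangent (q z) (fderiv ℝ (fun x => ((q x).w : V)) z v)
      (fderiv ℝ (fun x => (q x).W.starProjection) z v) := by
  have h1 := (contDiffAt_w hq).differentiableAt (by simp)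
  have h2 := (contDiffAt_proj hq).differentiableAt (by simp)
  constructor
  · have e : (fun x => adjointL (q x).W.starProjection) = fun x => (q x).W.starProjection :=
      funext fun x => star_starProjection _
    have := (adjointL.hasFDerivAt.comp z h2.hasFDerivAt).fderiv
    have h3 : fderiv ℝ (fun x => adjointL (q x).W.starProjection) z v =
      adjointL (fderiv ℝ (fun x => (q x).W.starProjection) z v) := congrArg (fun L => L v) this
    rw [e] at h3
    exact h3.symm
  · have h3 := fderiv_mul_clm h2 h2 v
    simp only [starProjection_mul_self] at h3
    rw [add_comm]
    exact h3.symm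
  · have h3 := fderiv_bilin (B := fun (A : V →L[ℂ] V) (u : V) => A u)
      isBoundedBilinearMap_clm_apply h2 h1 v
    simp only [proj_w] at h3
    rw [add_comm]
    exact h3.symm
  · have h3 := fderiv_bilin (B := fun u v : V => inner ℂ u v) isBoundedBilinearMap_inner_V h1 h1 v
    simp only [inner_w_self] at h3
    rw [← h3]
    simp

lemma tangentRep_fderiv (hq : ContDiffAt ℝ ∞ (fun x => FL2.emb (q x)) z) (v : ℂ) :
    tangentRep (q z) (fderiv ℝ (fun x => FL2.emb (q x)) z v) =
      toMat (projRep ((q z).w : V) (fderiv ℝ (fun x => ((q x).w : V)) z v) (q z).W.starProjection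
        (fderiv ℝ (fun x => (q x).W.starProjection) z v)) := by
  have := (isTangent_fderiv hq v).projRep_spec
  rw [fderiv_emb hq]
  exact tangentRep_eq this.1 this.2

end Primitive

end

/-! ### From primitive maps to Legendrian maps -/

section

section
variable {q : FL2} {w' : V} {P' : V →L[ℂ] V}

lemma IsTangent.adjoint_projRep (h : IsTangent q w' P') :
    ContinuousLinearMap.adjoint (projRep (q.w : V) w' q.W.starProjection P') =
      -projRep (q.w : V) w' q.W.starProjection P' := by
  have := h.projRep_spec.1.1.1
  have h2 := op_conjTranspose (toMat (projRep (q.w : V) w' q.W.starProjection P'))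
  rw [this, op_toMat] at h2
  rw [← h2]
  exact (map_neg (Matrix.toEuclideanCLM (n := Fin 3) (𝕜 := ℂ)) _).trans (congrArg _ (op_toMat _))

lemma IsTangent.projRep_w (h : IsTangent q w' P') :
    projRep (q.w : V) w' q.W.starProjection P' (q.w : V) = w' := by
  have := congrArg Prod.fst h.projRep_spec.2
  rwa [infAct, op_toMat] at this

lemma IsTangent.projRep_comm (h : IsTangent q w' P') (u : V) :
    projRep (q.w : V) w' q.W.starProjection P' (q.W.starProjection u) -
      q.W.starProjection (projRep (q.w : V) w' q.W.starProjection P' u) = P' u := by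
  have := congrArg (fun a => a.2 u) h.projRep_spec.2
  simp only [infAct, op_toMat] at this
  exact this
end

lemma star_half_sub_smul_I {A : Type*} [Ring A] [StarRing A] [Module ℂ A] [StarModule ℂ A]
    {X Y : A} (hX : star X = -X) (hY : star Y = -Y) :
    star ((1 / 2 : ℂ) • (X - I • Y)) = -((1 / 2 : ℂ) • (X - (-I) • Y)) := by
  rw [star_smul, star_sub, star_smul, hX, hY, Complex.star_def, map_div₀, map_one,
    Complex.conj_ofNat, conj_I]
  module

variable {q : ℂ → FL2} {z : ℂ}

/-- The equations of a primitive map in a frame adapted to the primitive distribution. -/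
lemma exists_frame_of_primitive (hq : ContDiffAt ℝ ∞ (fun x => FL2.emb (q x)) z)
    (hp : (1 / 2 : ℂ) • (tangentRep (q z) (fderiv ℝ (fun x => FL2.emb (q x)) z 1) -
      I • tangentRep (q z) (fderiv ℝ (fun x => FL2.emb (q x)) z I)) ∈ bundleG1 (q z)) :
    ∃ (g : SU3) (a : ℂ), FL2.act g FL2.base = q z ∧
      wd I (fun x => ((q x).w : V)) z = a • frame g 1 ∧
      wd (-I) (fun x => ((q x).w : V)) z = -(starRingEnd ℂ) a • frame g 2 ∧
      wd I (fun x => (q x).W.starProjection) z (frame g 2) = -a • frame g 0 ∧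
      wd (-I) (fun x => (q x).W.starProjection) z (frame g 1) = 0 := by
  rw [tangentRep_fderiv hq, tangentRep_fderiv hq] at hp
  have t1 := isTangent_fderiv hq 1
  have t2 := isTangent_fderiv hq I
  set A₁ := projRep ((q z).w : V) (fderiv ℝ (fun x => ((q x).w : V)) z 1) (q z).W.starProjection
        (fderiv ℝ (fun x => (q x).W.starProjection) z 1) with hA₁
  set A₂ := projRep ((q z).w : V) (fderiv ℝ (fun x => ((q x).w : V)) z I) (q z).W.starProjection
        (fderiv ℝ (fun x => (q x).W.starProjection) z I) with hA₂
  set B : V →L[ℂ] V := (1 / 2 : ℂ) • (A₁ - I • A₂) with hB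
  set B' : V →L[ℂ] V := (1 / 2 : ℂ) • (A₁ - (-I) • A₂) with hB'
  have hM : (1 / 2 : ℂ) • (toMat A₁ - I • toMat A₂) = toMat B := by
    simp only [hB, toMat, map_smul, map_sub]
  rw [hM] at hp
  obtain ⟨g, hg, hG⟩ := hp
  obtain ⟨a, b, hY⟩ := (mem_gPart_one_iff _).1 hG
  have ent : ∀ i j, inner ℂ (frame g i) (B (frame g j)) =
      (!![0, 0, a; a, 0, 0; 0, b, 0] : Mat) i j := by
    intro i j
    rw [← hY, inv_mul_mul_apply, op_toMat]
  -- The representatives of `dψ(∂/∂x)` and `dψ(∂/∂y)` are skew-Hermitian, so the element for `∂/∂z̄`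
  -- is minus the adjoint of the one for `∂/∂z` and needs no separate hypothesis.
  have adj : ContinuousLinearMap.adjoint B = -B' := by
    exact star_half_sub_smul_I t1.adjoint_projRep t2.adjoint_projRep
  have ent' : ∀ i j, inner ℂ (frame g i) (B' (frame g j)) =
      -(starRingEnd ℂ) ((!![0, 0, a; a, 0, 0; 0, b, 0] : Mat) j i) := by
    intro i j
    rw [← ent, inner_conj_symm, ← ContinuousLinearMap.adjoint_inner_right B, adj, neg_apply,
      inner_neg_right, neg_neg]
  have fr := inner_frame g
  have B0 : B (frame g 0) = a • frame g 1 := by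
    apply ext_inner_frame g
    intro j
    rw [ent, inner_smul_right, fr]
    fin_cases j <;> simp
  have B2 : B (frame g 2) = a • frame g 0 := by
    apply ext_inner_frame g
    intro j
    rw [ent, inner_smul_right, fr]
    fin_cases j <;> simp
  have B'0 : B' (frame g 0) = -(starRingEnd ℂ) a • frame g 2 := by
    apply ext_inner_frame g
    intro j
    rw [ent', inner_smul_right, fr]
    fin_cases j <;> simp
  have B'1 : B' (frame g 1) = -(starRingEnd ℂ) a • frame g 0 := by
    apply ext_inner_frame g
    intro j
    rw [ent', inner_smul_right, fr]
    fin_cases j <;> simp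
  have hw : ∀ c : ℂ, ((1 / 2 : ℂ) • (A₁ - c • A₂)) (frame g 0) =
      wd c (fun x => ((q x).w : V)) z := by
    intro c
    rw [frame_zero hg, wd, ← t1.projRep_w, ← t2.projRep_w]
    rfl
  have hP : ∀ (c : ℂ) (u : V), ((1 / 2 : ℂ) • (A₁ - c • A₂)) ((q z).W.starProjection u) -
      (q z).W.starProjection (((1 / 2 : ℂ) • (A₁ - c • A₂)) u) =
      wd c (fun x => (q x).W.starProjection) z u := by
    intro c u
    have e1 := t1.projRep_comm u
    have e2 := t2.projRep_comm u
    simp only [wd, smul_apply, sub_apply, ← e1, ← e2, ← hA₁, ← hA₂, map_smul, map_sub]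
    module
  refine ⟨g, a, hg, ?_, ?_, ?_, ?_⟩
  · rw [← hw, ← hB, B0]
  · rw [← hw, ← hB', B'0]
  · rw [← hP, ← hB, proj_frame_two hg, B2, map_smul, proj_frame_zero hg, map_zero]
    module
  · rw [← hP, ← hB', proj_frame_one hg, B'1, map_smul, proj_frame_zero hg, sub_self]

/-- A primitive map projects to a solution of the equations of conformal harmonic Legendrian
maps. -/
theorem isLegendrianAt_of_primitive {U : Set ℂ} (hU : IsOpen U)
    (hq : ∀ x ∈ U, ContDiffAt ℝ ∞ (fun x => FL2.emb (q x)) x)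
    (hp : ∀ x ∈ U, (1 / 2 : ℂ) • (tangentRep (q x) (fderiv ℝ (fun x => FL2.emb (q x)) x 1) -
      I • tangentRep (q x) (fderiv ℝ (fun x => FL2.emb (q x)) x I)) ∈ bundleG1 (q x))
    (hz : z ∈ U) : IsLegendrianAt (fun x => ((q x).w : V)) z := by
  obtain ⟨g, a, hg, h1, h2, h3, h4⟩ := exists_frame_of_primitive (hq z hz) (hp z hz)
  set f : ℂ → V := fun x => ((q x).w : V) with hf
  set P : ℂ → V →L[ℂ] V := fun x => (q x).W.starProjection with hP
  have fr := inner_frame g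
  have f0 : f z = frame g 0 := (frame_zero hg).symm
  have hs := contDiffAt_w (hq z hz)
  have hPs := contDiffAt_proj (hq z hz)
  have d : ∀ {g : ℂ → V}, ContDiffAt ℝ ∞ g z → DifferentiableAt ℝ g z := fun hg =>
    hg.differentiableAt (by simp)
  have dP := hPs.differentiableAt (by simp)
  have s1 := contDiffAt_wd I hs
  have s2 := contDiffAt_wd (-I) hs
  -- The adapted frame is chosen point by point and need not be smooth. Only relations free of the
  -- frame are differentiated: `P ∂f = ∂f` and `P ∂̄f = 0`.
  have e1 : (fun x => P x (wd I f x)) =ᶠ[nhds z] wd I f := by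
    filter_upwards [hU.mem_nhds hz] with x hx
    obtain ⟨k, b, hk, hb, -⟩ := exists_frame_of_primitive (hq x hx) (hp x hx)
    rw [hb, map_smul, hP, proj_frame_one hk]
  have e2 : (fun x => P x (wd (-I) f x)) =ᶠ[nhds z] fun _ => 0 := by
    filter_upwards [hU.mem_nhds hz] with x hx
    obtain ⟨k, b, hk, -, hb, -⟩ := exists_frame_of_primitive (hq x hx) (hp x hx)
    rw [hb, map_smul, hP, proj_frame_two hk, smul_zero]
  -- Applying `∂̄` to the first relation shows `∂̄∂f ∈ W`, since `∂̄P` kills `e₁`. Applying `∂` to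
  -- the second then computes `P ∂∂̄f = ∂∂̄f` from `(∂P) e₂ = -a e₀`.
  have l1 := wd_congr (-I) e1
  rw [wd_apply (-I) dP (d s1), h1, map_smul, h4, smul_zero, zero_add] at l1
  have l2 := wd_congr I e2
  rw [wd_apply I dP (d s2), h2, map_smul, h3, wd_const, ← wd_wd_comm hs, l1] at l2
  have key : wd I (wd (-I) f) z = -(a * (starRingEnd ℂ) a) • frame g 0 := by
    rw [← wd_wd_comm hs]
    linear_combination (norm := module) l2
  constructor
  · exact hs
  · exact inner_w_self _
  · rw [h1, f0, inner_smul_right, fr]; simp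
  · rw [h2, f0, inner_smul_right, fr]; simp
  · rw [h1, h2, inner_smul_left, inner_smul_right, fr]; simp
  · rw [h1, h2, inner_smul_left, inner_smul_right, inner_smul_left, inner_smul_right, fr, fr]
    simp [mul_comm]
  · rw [key, h1, f0, inner_smul_left, inner_smul_right, fr]
    simp [mul_comm]

end

/-! ### Determinants and orthogonal frames of `ℂ³` -/

section

/-- The determinant of three vectors of `ℂ³`. -/
def det3 (u v w : V) : ℂ := (Matrix.of fun i j => ![u, v, w] j i : Mat).det

lemma det3_eq (u v w : V) : det3 u v w = u 0 * v 1 * w 2 - u 0 * w 1 * v 2 - v 0 * u 1 * w 2 +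
    v 0 * w 1 * u 2 + w 0 * u 1 * v 2 - w 0 * v 1 * u 2 := by
  rw [det3, Matrix.det_fin_three]
  rfl

lemma det3_smul (a b c : ℂ) (u v w : V) :
    det3 (a • u) (b • v) (c • w) = a * b * c * det3 u v w := by
  simp only [det3_eq, PiLp.smul_apply, smul_eq_mul]
  ring

lemma contDiffAt_coord {u : ℂ → V} {z : ℂ} (hu : ContDiffAt ℝ ∞ u z) (i : Fin 3) :
    ContDiffAt ℝ ∞ (fun x => u x i) z := by
  have h : (fun x => u x i) = fun x => inner ℂ (stdE i) (u x) := by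
    funext x
    rw [EuclideanSpace.inner_single_left]; simp
  rw [h]
  exact contDiffAt_inner contDiffAt_const hu

lemma wd_coord {u : ℂ → V} {z : ℂ} (c : ℂ) (hu : DifferentiableAt ℝ u z) (i : Fin 3) :
    wd c (fun x => u x i) z = wd c u z i :=
  wd_clm (EuclideanSpace.proj (𝕜 := ℂ) i : V →L[ℂ] ℂ) c hu

lemma contDiffAt_det3 {u v w : ℂ → V} {z : ℂ} (hu : ContDiffAt ℝ ∞ u z) (hv : ContDiffAt ℝ ∞ v z)
    (hw : ContDiffAt ℝ ∞ w z) : ContDiffAt ℝ ∞ (fun x => det3 (u x) (v x) (w x)) z := by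
  have hu' := contDiffAt_coord hu
  have hv' := contDiffAt_coord hv
  have hw' := contDiffAt_coord hw
  simp only [det3_eq]
  exact (((((((hu' 0).mul (hv' 1)).mul (hw' 2)).sub (((hu' 0).mul (hw' 1)).mul (hv' 2))).sub
    (((hv' 0).mul (hu' 1)).mul (hw' 2))).add (((hv' 0).mul (hw' 1)).mul (hu' 2))).add
    (((hw' 0).mul (hu' 1)).mul (hv' 2))).sub (((hw' 0).mul (hv' 1)).mul (hu' 2))

lemma wd_mul {a b : ℂ → ℂ} {z : ℂ} (c : ℂ) (ha : DifferentiableAt ℝ a z)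
    (hb : DifferentiableAt ℝ b z) :
    wd c (fun x => a x * b x) z = wd c a z * b z + a z * wd c b z := wd_smul c ha hb

lemma wd_mul_mul {a b d : ℂ → ℂ} {z : ℂ} (c : ℂ) (ha : DifferentiableAt ℝ a z)
    (hb : DifferentiableAt ℝ b z) (hd : DifferentiableAt ℝ d z) :
    wd c (fun x => a x * b x * d x) z =
      wd c a z * b z * d z + a z * wd c b z * d z + a z * b z * wd c d z := by
  rw [wd_mul c (ha.fun_mul hb) hd, wd_mul c ha hb]
  ring

lemma wd_det3 {u v w : ℂ → V} {z : ℂ} (c : ℂ) (hu : DifferentiableAt ℝ u z)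
    (hv : DifferentiableAt ℝ v z) (hw : DifferentiableAt ℝ w z) :
    wd c (fun x => det3 (u x) (v x) (w x)) z = det3 (wd c u z) (v z) (w z) +
      det3 (u z) (wd c v z) (w z) + det3 (u z) (v z) (wd c w z) := by
  have hd : ∀ {u : ℂ → V}, DifferentiableAt ℝ u z → ∀ i, DifferentiableAt ℝ (fun x => u x i) z :=
    fun hu i => ((EuclideanSpace.proj (𝕜 := ℂ) i : V →L[ℂ] ℂ).restrictScalars ℝ).differentiableAt.comp
      z hu
  have hu' := hd hu
  have hv' := hd hv
  have hw' := hd hw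
  have m : ∀ {a b d : ℂ → ℂ}, DifferentiableAt ℝ a z → DifferentiableAt ℝ b z →
      DifferentiableAt ℝ d z → DifferentiableAt ℝ (fun x => a x * b x * d x) z :=
    fun ha hb hd => (ha.mul hb).mul hd
  have m1 := m (hu' 0) (hv' 1) (hw' 2)
  have m2 := m (hu' 0) (hw' 1) (hv' 2)
  have m3 := m (hv' 0) (hu' 1) (hw' 2)
  have m4 := m (hv' 0) (hw' 1) (hu' 2)
  have m5 := m (hw' 0) (hu' 1) (hv' 2)
  have m6 := m (hw' 0) (hv' 1) (hu' 2)
  simp only [det3_eq]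
  have a2 := m1.fun_sub m2
  have a3 := a2.fun_sub m3
  have a4 := a3.fun_add m4
  have a5 := a4.fun_add m5
  rw [wd_sub c a5 m6, wd_add c a4 m5, wd_add c a3 m4, wd_sub c a2 m3, wd_sub c m1 m2]
  simp only [wd_mul_mul c, hu', hv', hw', wd_coord c hu, wd_coord c hv, wd_coord c hw]
  ring

lemma inner_self_eq_mul_norm (s : V) : inner ℂ s s = (‖s‖ : ℂ) * ‖s‖ := by
  rw [inner_self_eq_norm_sq_to_K, sq]; rfl

/-- Three vectors of `ℂ³` which are orthogonal, the first of unit length and the other two of the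
same positive length. -/
structure IsLegendrianFrame (f s t : V) : Prop where
  unit : inner ℂ f f = 1
  fs : inner ℂ f s = 0
  ft : inner ℂ f t = 0
  st : inner ℂ s t = 0
  norm_eq : inner ℂ s s = inner ℂ t t
  ne_zero : s ≠ 0

namespace IsLegendrianFrame
variable {f s t : V} (h : IsLegendrianFrame f s t)
include h

lemma norm_ne_zero : (‖s‖ : ℂ) ≠ 0 := by
  exact_mod_cast norm_ne_zero_iff.2 h.ne_zero

lemma orthonormal : Orthonormal ℂ ![f, (‖s‖ : ℂ)⁻¹ • s, -(‖s‖ : ℂ)⁻¹ • t] := by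
  have h1 := inner_eq_zero_symm.1 h.fs
  have h2 := inner_eq_zero_symm.1 h.ft
  have h3 := inner_eq_zero_symm.1 h.st
  have hn := h.norm_ne_zero
  have hss := inner_self_eq_mul_norm s
  have htt := h.norm_eq.symm.trans hss
  rw [orthonormal_iff_ite]
  intro i j
  fin_cases i <;> fin_cases j <;>
    simp [-inner_self_eq_norm_sq_to_K, inner_smul_left, inner_smul_right, h.fs, h.ft, h.st, h1, h2,
      h3, hss, htt, h.unit, hn]

lemma ext_inner {u v : V} (h0 : inner ℂ f u = inner ℂ f v) (h1 : inner ℂ s u = inner ℂ s v)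
    (h2 : inner ℂ t u = inner ℂ t v) : u = v := by
  have ho := h.orthonormal
  obtain ⟨b, hb⟩ := Orthonormal.exists_orthonormalBasis_extension_of_card_eq (ι := Fin 3)
    (𝕜 := ℂ) (E := V) (by simp) (s := Set.univ)
    (v := ![f, (‖s‖ : ℂ)⁻¹ • s, -(‖s‖ : ℂ)⁻¹ • t]) (ho.comp _ Subtype.val_injective)
  apply b.repr.injective
  ext i
  rw [b.repr_apply_apply, b.repr_apply_apply, hb i trivial]
  fin_cases i <;> simp [inner_smul_left, h0, h1, h2]

lemma norm_det3 : ‖det3 f s t / inner ℂ s s‖ = 1 := by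
  have h1 := norm_det_of_orthonormal h.orthonormal
  have h2 : det3 f ((‖s‖ : ℂ)⁻¹ • s) (-(‖s‖ : ℂ)⁻¹ • t) = -(det3 f s t / inner ℂ s s) := by
    have := det3_smul 1 (‖s‖ : ℂ)⁻¹ (-(‖s‖ : ℂ)⁻¹) f s t
    rw [one_smul] at this
    rw [this, inner_self_eq_mul_norm s]
    field_simp
  rw [← norm_neg, ← h2]
  exact h1

/-- The minus sign in the third column is imposed by the shape of `𝔤₁`, where `∂f = a e₁` goes with
`∂̄f = -ā e₂`. It is the reason why the normalised phase is `-1` rather than `1`. -/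
lemma exists_frame (hd : det3 f s t = -inner ℂ s s) : ∃ g : SU3,
    frame g 0 = f ∧ frame g 1 = (‖s‖ : ℂ)⁻¹ • s ∧ frame g 2 = -(‖s‖ : ℂ)⁻¹ • t := by
  have hn := h.norm_ne_zero
  obtain ⟨g, hg⟩ := exists_SU3_of_columns h.orthonormal (by
    have := det3_smul 1 (‖s‖ : ℂ)⁻¹ (-(‖s‖ : ℂ)⁻¹) f s t
    rw [one_smul, hd, inner_self_eq_mul_norm s] at this
    refine this.trans ?_
    field_simp)
  exact ⟨g, hg 0, hg 1, hg 2⟩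

lemma symm : IsLegendrianFrame f t s where
  unit := h.unit
  fs := h.ft
  ft := h.fs
  st := inner_eq_zero_symm.1 h.st
  norm_eq := h.norm_eq.symm
  ne_zero := by
    rw [← inner_self_ne_zero (𝕜 := ℂ), ← h.norm_eq]
    exact inner_self_ne_zero.2 h.ne_zero

/-- The resolution of the identity given by an orthogonal frame. -/
lemma rankOne_add : rankOne ℂ f f + (inner ℂ s s)⁻¹ • rankOne ℂ s s +
    (inner ℂ t t)⁻¹ • rankOne ℂ t t = 1 := by
  have h1 := inner_eq_zero_symm.1 h.fs
  have h2 := inner_eq_zero_symm.1 h.ft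
  have h3 := inner_eq_zero_symm.1 h.st
  have hs : inner ℂ s s ≠ 0 := inner_self_ne_zero.2 h.ne_zero
  have ht : inner ℂ t t ≠ 0 := inner_self_ne_zero.2 h.symm.ne_zero
  ext1 v
  apply h.ext_inner
  all_goals
    simp only [add_apply, smul_apply, InnerProductSpace.rankOne_apply, inner_add_right,
      inner_smul_right, h.fs, h.ft, h.st, h1, h2, h3, h.unit, one_apply_eq_self]
    field_simp
    try ring

end IsLegendrianFrame

end

/-! ### Structure equations, the constant phase and the harmonic line bundles -/

section

/-- `f` is a conformal harmonic horizontal immersion of the open set `U`. -/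
structure IsLegendrianOn (f : ℂ → V) (U : Set ℂ) : Prop where
  isOpen : IsOpen U
  legendrian : ∀ x ∈ U, IsLegendrianAt f x
  ne_zero : ∀ x ∈ U, wd I f x ≠ 0

lemma sign_mul_self {c : ℂ} (hc : c = I ∨ c = -I) : c * c = -1 := by
  rcases hc with rfl | rfl <;> simp

lemma sign_conj {c : ℂ} (hc : c = I ∨ c = -I) : (starRingEnd ℂ) c = -c := by
  rcases hc with rfl | rfl <;> simp

lemma sign_neg {c : ℂ} (hc : c = I ∨ c = -I) : -c = I ∨ -c = -I := by
  rcases hc with rfl | rfl <;> simp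

/-- The phase of `det (f, ∂f, ∂̄f)`. -/
def phase (f : ℂ → V) (x : ℂ) : ℂ :=
  det3 (f x) (wd I f x) (wd (-I) f x) / inner ℂ (wd I f x) (wd I f x)

/-- The orthogonal projection onto the line spanned by `∂f/∂z` (for `c = i`) or `∂f/∂z̄` (for
`c = -i`). -/
def lineProj (c : ℂ) (f : ℂ → V) (x : ℂ) : V →L[ℂ] V :=
  (inner ℂ (wd c f x) (wd c f x))⁻¹ • rankOne ℂ (wd c f x) (wd c f x)

namespace IsLegendrianOn
variable {f : ℂ → V} {U : Set ℂ} (h : IsLegendrianOn f U) {c : ℂ} (hc : c = I ∨ c = -I) {z : ℂ}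
  (hz : z ∈ U)

include h hz

lemma smooth : ContDiffAt ℝ ∞ f z := (h.legendrian z hz).smooth

lemma diff : DifferentiableAt ℝ f z := (h.smooth hz).differentiableAt (by simp)

lemma diff_wd (c : ℂ) : DifferentiableAt ℝ (wd c f) z :=
  (contDiffAt_wd c (h.smooth hz)).differentiableAt (by simp)

lemma eventually_of_forall {p : ℂ → Prop} (hp : ∀ x ∈ U, p x) : ∀ᶠ x in nhds z, p x :=
  Filter.eventually_of_mem (h.isOpen.mem_nhds hz) hp

include hc

lemma isLegendrianFrame : IsLegendrianFrame (f z) (wd c f z) (wd (-c) f z) := by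
  have hl := h.legendrian z hz
  have hI : IsLegendrianFrame (f z) (wd I f z) (wd (-I) f z) :=
    ⟨hl.unit, hl.inner_dz, hl.inner_dzb, hl.inner_dz_dzb, hl.norm_eq, h.ne_zero z hz⟩
  rcases hc with rfl | rfl
  · exact hI
  · rw [neg_neg]; exact hI.symm

lemma wd_wd : wd c (wd (-c) f) z = -inner ℂ (wd c f z) (wd c f z) • f z := by
  have hl := h.legendrian z hz
  rcases hc with rfl | rfl
  · exact hl.dz_dzb
  · rw [neg_neg, wd_wd_comm hl.smooth, hl.dz_dzb, hl.norm_eq]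

lemma inner_wd_self_ne_zero : inner ℂ (wd c f z) (wd c f z) ≠ 0 :=
  inner_self_ne_zero.2 (h.isLegendrianFrame hc hz).ne_zero

/-- `∂s` for `s = ∂f` is a combination of `∂f` and `∂̄f`; the first coefficient is the logarithmic
derivative of `|∂f|²`. -/
lemma exists_wd_wd_self : ∃ μ : ℂ, wd c (wd c f) z =
    (wd c (fun x => inner ℂ (wd c f x) (wd c f x)) z / inner ℂ (wd c f z) (wd c f z)) • wd c f z +
      μ • wd (-c) f z := by
  have F := h.isLegendrianFrame hc hz
  have hN := h.inner_wd_self_ne_zero hc hz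
  have hN' := h.inner_wd_self_ne_zero (sign_neg hc) hz
  have hw : wd (-c) (wd c f) z = -inner ℂ (wd c f z) (wd c f z) • f z := by
    have := h.wd_wd (sign_neg hc) hz
    rwa [neg_neg, ← F.norm_eq] at this
  -- Differentiating `⟨f, ∂f⟩ = 0` leaves `⟨∂̄f, ∂f⟩`, which vanishes, so there is no component
  -- along `f`.
  have h0 : inner ℂ (f z) (wd c (wd c f) z) = 0 := by
    have e : (fun x => inner ℂ (f x) (wd c f x)) =ᶠ[nhds z] fun _ => 0 :=
      h.eventually_of_forall hz fun x hx => (h.isLegendrianFrame hc hx).fs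
    have := wd_congr c e
    rw [wd_inner c (h.diff hz) (h.diff_wd hz c), wd_const, sign_conj hc, F.symm.st, zero_add] at this
    exact this
  have h1 : wd c (fun x => inner ℂ (wd c f x) (wd c f x)) z =
      inner ℂ (wd c f z) (wd c (wd c f) z) := by
    rw [wd_inner c (h.diff_wd hz c) (h.diff_wd hz c), sign_conj hc, hw, inner_smul_left, F.fs,
      mul_zero, zero_add]
  refine ⟨inner ℂ (wd (-c) f z) (wd c (wd c f) z) / inner ℂ (wd (-c) f z) (wd (-c) f z), ?_⟩
  rw [h1]
  apply F.ext_inner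
  · rw [h0, inner_add_right, inner_smul_right, inner_smul_right, F.fs, F.ft]; simp
  · rw [inner_add_right, inner_smul_right, inner_smul_right, F.st, div_mul_cancel₀ _ hN]; simp
  · rw [inner_add_right, inner_smul_right, inner_smul_right, F.symm.st, div_mul_cancel₀ _ hN']
    simp

lemma wd_norm_neg : wd c (fun x => inner ℂ (wd c f x) (wd c f x)) z =
    wd c (fun x => inner ℂ (wd (-c) f x) (wd (-c) f x)) z :=
  wd_congr c (h.eventually_of_forall hz fun _ hx => (h.isLegendrianFrame hc hx).norm_eq)

omit hc in
-- In the Leibniz rule two of the three determinants have dependent columns, because `∂∂̄f` is a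
-- multiple of `f`. In the third only the logarithmic derivative of `|∂f|²` counts. The determinant
-- and `|∂f|²` thus have the same logarithmic derivative.
lemma wd_det3_aux {c : ℂ} (hc : c = I ∨ c = -I) :
    wd c (fun x => det3 (f x) (wd I f x) (wd (-I) f x)) z =
      wd c (fun x => inner ℂ (wd I f x) (wd I f x)) z / inner ℂ (wd I f z) (wd I f z) *
        det3 (f z) (wd I f z) (wd (-I) f z) := by
  rw [wd_det3 c (h.diff hz) (h.diff_wd hz I) (h.diff_wd hz (-I))]
  obtain ⟨μ, hμ⟩ := h.exists_wd_wd_self hc hz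
  have hF := h.isLegendrianFrame (Or.inl rfl) hz
  rcases hc with rfl | rfl
  · rw [hμ, h.wd_wd (Or.inl rfl) hz]
    simp only [det3_eq, PiLp.smul_apply, PiLp.add_apply, smul_eq_mul]
    ring
  · have hw := h.wd_wd (Or.inr rfl) hz
    rw [neg_neg] at hw
    rw [h.wd_norm_neg (Or.inr rfl) hz, neg_neg] at hμ
    rw [hμ, hw, hF.norm_eq]
    simp only [det3_eq, PiLp.smul_apply, PiLp.add_apply, smul_eq_mul]
    ring

omit hc in
lemma differentiableAt_phase : DifferentiableAt ℝ (phase f) z := by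
  have s1 := contDiffAt_wd I (h.smooth hz)
  have s2 := contDiffAt_wd (-I) (h.smooth hz)
  have si := (contDiffAt_inner s1 s1).inv (h.inner_wd_self_ne_zero (Or.inl rfl) hz)
  have e : phase f = fun x =>
      det3 (f x) (wd I f x) (wd (-I) f x) * (inner ℂ (wd I f x) (wd I f x))⁻¹ :=
    funext fun x => div_eq_mul_inv _ _
  rw [e]
  exact ((contDiffAt_det3 (h.smooth hz) s1 s2).differentiableAt (by simp)).fun_mul
    (si.differentiableAt (by simp))

omit hc in
/-- The phase of `det (f, ∂f, ∂̄f)` is locally constant: the Lagrangian angle of a minimal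
Lagrangian immersion. -/
lemma fderiv_phase : fderiv ℝ (phase f) z = 0 := by
  have s1 := contDiffAt_wd I (h.smooth hz)
  have hN := h.inner_wd_self_ne_zero (Or.inl rfl) hz
  set D := fun x => det3 (f x) (wd I f x) (wd (-I) f x) with hD
  set N := fun x => inner ℂ (wd I f x) (wd I f x) with hNdef
  have dN : DifferentiableAt ℝ N z := (contDiffAt_inner s1 s1).differentiableAt (by simp)
  have dθ : DifferentiableAt ℝ (fun x => D x / N x) z := h.differentiableAt_phase hz
  have key : ∀ {c : ℂ}, c = I ∨ c = -I → wd c (fun x => D x / N x) z = 0 := by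
    intro c hc
    -- Differentiating the product `θ N = D` instead of the quotient leaves `(∂θ) N = 0`.
    have e : (fun x => D x / N x * N x) =ᶠ[nhds z] D :=
      h.eventually_of_forall hz fun x hx =>
        div_mul_cancel₀ _ (h.inner_wd_self_ne_zero (Or.inl rfl) hx)
    have h1 := wd_congr c e
    rw [wd_mul c dθ dN, h.wd_det3_aux hz hc] at h1
    have h2 : wd c (fun x => D x / N x) z * N z = 0 := by
      have hN' : N z ≠ 0 := hN
      change _ = wd c N z / N z * D z at h1
      linear_combination h1
    exact (mul_eq_zero.1 h2).resolve_right hN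
  change fderiv ℝ (fun x => D x / N x) z = 0
  ext1 v
  rw [fderiv_eq_re_im, fderiv_one_eq, fderiv_I_eq, key (Or.inl rfl), key (Or.inr rfl)]
  simp

lemma lineProj_apply_self : lineProj c f z (wd c f z) = wd c f z := by
  rw [lineProj, smul_apply, InnerProductSpace.rankOne_apply, smul_smul,
    inv_mul_cancel₀ (h.inner_wd_self_ne_zero hc hz), one_smul]

lemma lineProj_apply_f : lineProj c f z (f z) = 0 := by
  rw [lineProj, smul_apply, InnerProductSpace.rankOne_apply,
    inner_eq_zero_symm.1 (h.isLegendrianFrame hc hz).fs, zero_smul, smul_zero]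

lemma lineProj_apply_neg : lineProj c f z (wd (-c) f z) = 0 := by
  rw [lineProj, smul_apply, InnerProductSpace.rankOne_apply,
    (h.isLegendrianFrame hc hz).st, zero_smul, smul_zero]

lemma contDiffAt_lineProj : ContDiffAt ℝ ∞ (lineProj c f) z := by
  have s1 := contDiffAt_wd c (h.smooth hz)
  exact contDiffAt_bilin (B := fun (a : ℂ) (A : V →L[ℂ] V) => a • A) isBoundedBilinearMap_smul
    ((contDiffAt_inner s1 s1).inv (h.inner_wd_self_ne_zero hc hz)) (contDiffAt_rankOne s1 s1)

/-- The line bundles spanned by `∂f/∂z` and `∂f/∂z̄` are harmonic. -/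
lemma laplacian_lineProj : ∃ κ : ℂ,
    Laplacian.laplacian (lineProj c f) z (wd c f z) = κ • wd c f z := by
  have sP : ∀ x ∈ U, ContDiffAt ℝ ∞ (lineProj c f) x := fun x hx => h.contDiffAt_lineProj hc hx
  have dP : ∀ x ∈ U, DifferentiableAt ℝ (lineProj c f) x := fun x hx =>
    (sP x hx).differentiableAt (by simp)
  have hw : ∀ x ∈ U, wd (-c) (wd c f) x = -inner ℂ (wd c f x) (wd c f x) • f x := by
    intro x hx
    have := h.wd_wd (sign_neg hc) hx
    rwa [neg_neg, ← (h.isLegendrianFrame hc hx).norm_eq] at this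
  -- With `P` the line projection and `∂` for `wd c`: apply `∂̄` to `P ∂f = ∂f`, using that `∂̄∂f`
  -- is a multiple of `f` and `P f = 0`.
  have e1 : ∀ x ∈ U, wd (-c) (lineProj c f) x (wd c f x) =
      -inner ℂ (wd c f x) (wd c f x) • f x := by
    intro x hx
    have e : (fun y => lineProj c f y (wd c f y)) =ᶠ[nhds x] wd c f :=
      h.eventually_of_forall hx fun y hy => h.lineProj_apply_self hc hy
    have h1 := wd_congr (-c) e
    rw [wd_apply (-c) (dP x hx) (h.diff_wd hx c), hw x hx, map_smul, h.lineProj_apply_f hc hx,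
      smul_zero, add_zero] at h1
    exact h1
  obtain ⟨μ, hμ⟩ := h.exists_wd_wd_self hc hz
  obtain ⟨μ', hμ'⟩ := h.exists_wd_wd_self (sign_neg hc) hz
  rw [neg_neg] at hμ'
  have e2 : wd (-c) (lineProj c f) z (wd (-c) f z) = -μ' • wd c f z := by
    have e : (fun y => lineProj c f y (wd (-c) f y)) =ᶠ[nhds z] fun _ => 0 :=
      h.eventually_of_forall hz fun y hy => h.lineProj_apply_neg hc hy
    have h1 := wd_congr (-c) e
    rw [wd_apply (-c) (dP z hz) (h.diff_wd hz (-c)), hμ', map_add, map_smul, map_smul,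
      h.lineProj_apply_neg hc hz, h.lineProj_apply_self hc hz, wd_const] at h1
    linear_combination (norm := module) h1
  have dw : DifferentiableAt ℝ (wd (-c) (lineProj c f)) z :=
    (contDiffAt_wd (-c) (sP z hz)).differentiableAt (by simp)
  have s1 := contDiffAt_wd c (h.smooth hz)
  have dN : DifferentiableAt ℝ (fun x => -inner ℂ (wd c f x) (wd c f x)) z :=
    ((contDiffAt_inner s1 s1).neg).differentiableAt (by simp)
  -- Differentiating once more, the multiples of `f` cancel because the `∂f` coefficient of `∂∂f` is
  -- the logarithmic derivative of `|∂f|²`. What remains is `∂∂̄P (∂f) = (μ μ' - |∂f|²) ∂f`, and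
  -- four times this coefficient is the witness.
  have h3 := wd_congr c (h.eventually_of_forall hz e1)
  rw [wd_apply c dw (h.diff_wd hz c), wd_smul c dN (h.diff hz), hμ, map_add, map_smul, map_smul,
    e1 z hz, e2] at h3
  have hneg : wd c (fun x => -inner ℂ (wd c f x) (wd c f x)) z =
      -wd c (fun x => inner ℂ (wd c f x) (wd c f x)) z := by
    have := wd_const_smul c (-1) ((contDiffAt_inner s1 s1).differentiableAt (by simp))
    simpa using this
  have hN := h.inner_wd_self_ne_zero hc hz
  rw [hneg, smul_smul, mul_neg, div_mul_cancel₀ _ hN] at h3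
  refine ⟨4 * (μ * μ' - inner ℂ (wd c f z) (wd c f z)), ?_⟩
  rw [laplacian_eq_wd (sP z hz) (sign_mul_self hc), smul_apply]
  linear_combination (norm := module) (4 : ℂ) • h3

end IsLegendrianOn

end

/-! ### The divergence of `dQ Q` for a harmonic projection `Q` -/

section

section Projections
variable {Q : ℂ → V →L[ℂ] V} {z : ℂ}

lemma differentiableAt_fderiv_apply {F : Type*} [NormedAddCommGroup F] [NormedSpace ℝ F]
    {s : ℂ → F} (hs : ContDiffAt ℝ ∞ s z) (v : ℂ) :
    DifferentiableAt ℝ (fun x => fderiv ℝ s x v) z := by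
  have hd : DifferentiableAt ℝ (fderiv ℝ s) z :=
    (hs.fderiv_right (m := ∞) (by simp)).differentiableAt (by simp)
  exact hd.clm_apply (differentiableAt_const v)

lemma laplacian_eq_fderiv {F : Type*} [NormedAddCommGroup F] [NormedSpace ℝ F]
    {s : ℂ → F} (hs : ContDiffAt ℝ ∞ s z) : Laplacian.laplacian s z =
      fderiv ℝ (fun x => fderiv ℝ s x 1) z 1 + fderiv ℝ (fun x => fderiv ℝ s x I) z I := by
  have hd : DifferentiableAt ℝ (fderiv ℝ s) z :=
    (hs.fderiv_right (m := ∞) (by simp)).differentiableAt (by simp)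
  rw [InnerProductSpace.laplacian_eq_iteratedFDeriv_complexPlane,
    fderiv_clm_apply hd (differentiableAt_const _), fderiv_clm_apply hd (differentiableAt_const _)]
  simp [iteratedFDeriv_two_apply]

lemma eventually_contDiffAt {F : Type*} [NormedAddCommGroup F] [NormedSpace ℝ F]
    {s : ℂ → F} (hs : ContDiffAt ℝ ∞ s z) : ∀ᶠ x in nhds z, DifferentiableAt ℝ s x :=
  ((hs.of_le (m := 1) (by simp)).eventually (by simp)).mono fun _ hx =>
    hx.differentiableAt (by simp)

/-- For a projection-valued map `Q` which is harmonic, the divergence of `dQ Q` is half the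
Laplacian of `Q`. -/
lemma fderiv_fderiv_mul_self (hs : ContDiffAt ℝ ∞ Q z) (hQ : ∀ᶠ x in nhds z, Q x * Q x = Q x)
    (hc : Laplacian.laplacian Q z * Q z = Q z * Laplacian.laplacian Q z) :
    fderiv ℝ (fun x => fderiv ℝ Q x 1 * Q x) z 1 + fderiv ℝ (fun x => fderiv ℝ Q x I * Q x) z I =
      (1 / 2 : ℂ) • Laplacian.laplacian Q z := by
  have dQ : DifferentiableAt ℝ Q z := hs.differentiableAt (by simp)
  have dA := differentiableAt_fderiv_apply hs
  have e1 : ∀ v, (fun x => fderiv ℝ Q x v) =ᶠ[nhds z]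
      fun x => Q x * fderiv ℝ Q x v + fderiv ℝ Q x v * Q x := by
    intro v
    filter_upwards [hQ.eventually_nhds, eventually_contDiffAt hs] with x hx hdx
    rw [← fderiv_mul_clm hdx hdx]
    have hx' : (fun y => Q y * Q y) =ᶠ[nhds x] Q := hx
    rw [hx'.fderiv_eq]
  have dm : ∀ {A B : ℂ → V →L[ℂ] V}, DifferentiableAt ℝ A z → DifferentiableAt ℝ B z →
      DifferentiableAt ℝ (fun x => A x * B x) z := by
    intro A B hA hB
    have h : Differentiable ℝ fun p : (V →L[ℂ] V) × (V →L[ℂ] V) => p.1 * p.2 := fun p =>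
      isBoundedBilinearMap_mul_clm.differentiableAt p
    exact DifferentiableAt.comp z (h (A z, B z)) (hA.prodMk hB)
  -- The second derivative of `Q² = Q`: `Q'' = Q Q'' + 2 Q' Q' + Q'' Q`. When `ΔQ` commutes with
  -- `Q`, summing over both directions gives `ΔQ = 2 (ΔQ Q + ∑ Q' Q')`, twice the divergence sought.
  have e2 : ∀ v, fderiv ℝ (fun x => fderiv ℝ Q x v) z v =
      Q z * fderiv ℝ (fun x => fderiv ℝ Q x v) z v + fderiv ℝ Q z v * fderiv ℝ Q z v +
      (fderiv ℝ Q z v * fderiv ℝ Q z v + fderiv ℝ (fun x => fderiv ℝ Q x v) z v * Q z) := by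
    intro v
    conv_lhs => rw [(e1 v).fderiv_eq]
    rw [fderiv_fun_add (dm dQ (dA v)) (dm (dA v) dQ), add_apply, fderiv_mul_clm dQ (dA v),
      fderiv_mul_clm (dA v) dQ]
  rw [fderiv_mul_clm (dA 1) dQ, fderiv_mul_clm (dA I) dQ]
  rw [laplacian_eq_fderiv hs] at hc ⊢
  have h1 := e2 1
  have hI := e2 I
  rw [add_mul, mul_add] at hc
  linear_combination (norm := module) (-1 / 2 : ℂ) • h1 + (-1 / 2 : ℂ) • hI + (1 / 2 : ℂ) • hc

/-- The Laplacian of a self-adjoint family is self-adjoint; preserving the line, it also preserves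
the orthogonal complement. This is harmonicity of the line bundle in commutator form. -/
lemma laplacian_comm_of_line (hs : ContDiffAt ℝ ∞ Q z) (hstar : ∀ᶠ x in nhds z, star (Q x) = Q x)
    {e : V} (hQ : ∀ u, Q z u ∈ ℂ ∙ e) (he : Q z e = e)
    (hL : Laplacian.laplacian Q z e ∈ ℂ ∙ e) :
    Laplacian.laplacian Q z * Q z = Q z * Laplacian.laplacian Q z := by
  set A := Laplacian.laplacian Q z with hA
  have hAs : star A = A := by
    have h2 : ContDiffAt ℝ 2 Q z := hs.of_le (WithTop.coe_le_coe.2 (le_top : (2 : ℕ∞) ≤ ⊤))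
    have h3 := h2.laplacian_CLM_comp_left (l := adjointL)
    have h4 : (adjointL ∘ Q) =ᶠ[nhds z] Q := hstar
    rw [InnerProductSpace.laplacian_congr_nhds h4 |>.self_of_nhds] at h3
    exact h3.symm
  have h1 : A * Q z = Q z * A * Q z := by
    ext1 u
    change A (Q z u) = Q z (A (Q z u))
    obtain ⟨a, ha⟩ := Submodule.mem_span_singleton.1 (hQ u)
    obtain ⟨b, hb⟩ := Submodule.mem_span_singleton.1 hL
    rw [← ha, map_smul, ← hb, map_smul, map_smul, he]
  have h2 := congrArg star h1
  rw [star_mul, star_mul, star_mul, hAs, hstar.self_of_nhds, ← mul_assoc] at h2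
  exact h1.trans h2.symm

end Projections

namespace IsLegendrianOn
variable {f : ℂ → V} {U : Set ℂ} (h : IsLegendrianOn f U) {z : ℂ}

lemma star_lineProj (c : ℂ) (f : ℂ → V) (x : ℂ) : star (lineProj c f x) = lineProj c f x := by
  rw [lineProj, star_smul, star_rankOne, Complex.star_def, map_inv₀, inner_conj_symm]

include h

lemma lineProj_mul_self {c : ℂ} (hc : c = I ∨ c = -I) (hz : z ∈ U) :
    lineProj c f z * lineProj c f z = lineProj c f z := by
  have hN := h.inner_wd_self_ne_zero hc hz
  rw [lineProj, smul_mul_smul_comm, rankOne_mul_rankOne, smul_smul, mul_assoc,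
    inv_mul_cancel₀ hN, mul_one]

lemma rankOne_add_lineProj (hz : z ∈ U) :
    rankOne ℂ (f z) (f z) + lineProj I f z + lineProj (-I) f z = 1 :=
  (h.isLegendrianFrame (Or.inl rfl) hz).rankOne_add

lemma tension_lineProj {c : ℂ} (hc : c = I ∨ c = -I) (hz : z ∈ U) :
    fderiv ℝ (fun x => fderiv ℝ (lineProj c f) x 1 * lineProj c f x) z 1 +
      fderiv ℝ (fun x => fderiv ℝ (lineProj c f) x I * lineProj c f x) z I =
      (1 / 2 : ℂ) • Laplacian.laplacian (lineProj c f) z := by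
  have hs := h.contDiffAt_lineProj hc hz
  obtain ⟨κ, hκ⟩ := h.laplacian_lineProj hc hz
  refine fderiv_fderiv_mul_self hs (h.eventually_of_forall hz fun x hx => h.lineProj_mul_self hc hx)
    (laplacian_comm_of_line (e := wd c f z) hs (Filter.Eventually.of_forall fun x =>
      star_lineProj c f x) ?_ (h.lineProj_apply_self hc hz) ?_)
  · intro u
    rw [lineProj, smul_apply, InnerProductSpace.rankOne_apply]
    exact Submodule.smul_mem _ _ (Submodule.smul_mem _ _ (Submodule.mem_span_singleton_self _))
  · rw [hκ]
    exact Submodule.smul_mem _ _ (Submodule.mem_span_singleton_self _)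

lemma tension_rankOne (hz : z ∈ U) :
    fderiv ℝ (fun x => fderiv ℝ (fun y => rankOne ℂ (f y) (f y)) x 1 * rankOne ℂ (f x) (f x)) z 1 +
      fderiv ℝ (fun x => fderiv ℝ (fun y => rankOne ℂ (f y) (f y)) x I * rankOne ℂ (f x) (f x)) z I =
      (1 / 2 : ℂ) • Laplacian.laplacian (fun y => rankOne ℂ (f y) (f y)) z := by
  have hs := contDiffAt_rankOne (h.smooth hz) (h.smooth hz)
  have hm := Submodule.mem_span_singleton_self (R := ℂ) (f z)
  refine fderiv_fderiv_mul_self hs (h.eventually_of_forall hz fun x hx => ?_)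
    (laplacian_comm_of_line (e := f z) hs (Filter.Eventually.of_forall fun x =>
      star_rankOne _ _) ?_ ?_ ((h.legendrian z hz).laplacian_rankOne_apply hm))
  · rw [rankOne_mul_rankOne, (h.legendrian x hx).unit, one_smul]
  · intro u
    rw [InnerProductSpace.rankOne_apply]
    exact Submodule.smul_mem _ _ hm
  · rw [InnerProductSpace.rankOne_apply, (h.legendrian z hz).unit, one_smul]

end IsLegendrianOn

end

/-! ### The lift to `FL₂` in a coordinate domain -/

section

/-- `q` is the lift `(f, span {f, ∂f})` to `FL₂` of the Legendrian immersion `f` with constant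
phase `-1`. -/
structure IsLiftOn (q : ℂ → FL2) (f : ℂ → V) (U : Set ℂ) : Prop extends IsLegendrianOn f U where
  w_eq : ∀ x ∈ U, ((q x).w : V) = f x
  dz_mem : ∀ x ∈ U, wd I f x ∈ (q x).W
  det_eq : ∀ x ∈ U, det3 (f x) (wd I f x) (wd (-I) f x) = -inner ℂ (wd I f x) (wd I f x)

namespace IsLiftOn
variable {q : ℂ → FL2} {f : ℂ → V} {U : Set ℂ} (h : IsLiftOn q f U) {z : ℂ} (hz : z ∈ U)
include h hz

lemma exists_adapted_frame : ∃ g : SU3, FL2.act g FL2.base = q z ∧ frame g 0 = f z ∧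
    frame g 1 = (‖wd I f z‖ : ℂ)⁻¹ • wd I f z ∧ frame g 2 = -(‖wd I f z‖ : ℂ)⁻¹ • wd (-I) f z := by
  obtain ⟨g, g0, g1, g2⟩ :=
    (h.isLegendrianFrame (Or.inl rfl) hz).exists_frame (h.det_eq z hz)
  refine ⟨g, (act_base_eq_iff g (q z)).2 ⟨?_, ?_⟩, g0, g1, g2⟩
  · rw [h.w_eq z hz]; exact g0
  · have : op (g : Mat) (stdE 1) = _ := g1
    rw [this]
    exact Submodule.smul_mem _ _ (h.dz_mem z hz)

lemma starProjection_eq :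
    (q z).W.starProjection = rankOne ℂ (f z) (f z) + lineProj I f z := by
  obtain ⟨g, hg, g0, g1, g2⟩ := h.exists_adapted_frame hz
  have F := h.isLegendrianFrame (Or.inl rfl) hz
  apply ext_frame g
  intro j
  fin_cases j
  · change (q z).W.starProjection (frame g 0) = (rankOne ℂ (f z) (f z) + lineProj I f z) (frame g 0)
    rw [proj_frame_zero hg, g0, add_apply, h.lineProj_apply_f (Or.inl rfl) hz,
      InnerProductSpace.rankOne_apply, F.unit, one_smul, add_zero]
  · change (q z).W.starProjection (frame g 1) = (rankOne ℂ (f z) (f z) + lineProj I f z) (frame g 1)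
    rw [proj_frame_one hg, g1, map_smul, add_apply, h.lineProj_apply_self (Or.inl rfl) hz,
      InnerProductSpace.rankOne_apply, F.fs, zero_smul, zero_add]
  · change (q z).W.starProjection (frame g 2) = (rankOne ℂ (f z) (f z) + lineProj I f z) (frame g 2)
    rw [proj_frame_two hg, g2, map_smul, add_apply, h.lineProj_apply_neg (Or.inl rfl) hz,
      InnerProductSpace.rankOne_apply, F.ft, zero_smul, zero_add, smul_zero]

lemma eventuallyEq_w : (fun x => ((q x).w : V)) =ᶠ[nhds z] f :=
  h.eventually_of_forall hz h.w_eq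

lemma eventuallyEq_proj : (fun x => (q x).W.starProjection) =ᶠ[nhds z]
    fun x => rankOne ℂ (f x) (f x) + lineProj I f x :=
  h.eventually_of_forall hz fun _ hx => h.starProjection_eq hx

lemma contDiffAt_emb : ContDiffAt ℝ ∞ (fun x => FL2.emb (q x)) z := by
  have h1 : ContDiffAt ℝ ∞ (fun x => ((q x).w : V)) z :=
    (h.smooth hz).congr_of_eventuallyEq (h.eventuallyEq_w hz)
  have h2 : ContDiffAt ℝ ∞ (fun x => (q x).W.starProjection) z :=
    ((contDiffAt_rankOne (h.smooth hz) (h.smooth hz)).add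
      (h.contDiffAt_lineProj (Or.inl rfl) hz)).congr_of_eventuallyEq (h.eventuallyEq_proj hz)
  exact h1.prodMk h2

/-- The tangent vectors of the lift are represented by `∑ dP_j P_j`, with the projections `P_j` onto
the lines spanned by `f`, `∂f` and `∂̄f`. -/
lemma projRep_eq (v : ℂ) : projRep ((q z).w : V) (fderiv ℝ (fun x => ((q x).w : V)) z v)
      (q z).W.starProjection (fderiv ℝ (fun x => (q x).W.starProjection) z v) =
    fderiv ℝ (fun y => rankOne ℂ (f y) (f y)) z v * rankOne ℂ (f z) (f z) +
      fderiv ℝ (lineProj I f) z v * lineProj I f z +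
      fderiv ℝ (lineProj (-I) f) z v * lineProj (-I) f z := by
  have hl := h.legendrian z hz
  have d0 : DifferentiableAt ℝ (fun y => rankOne ℂ (f y) (f y)) z :=
    (contDiffAt_rankOne hl.smooth hl.smooth).differentiableAt (by simp)
  have d1 : DifferentiableAt ℝ (lineProj I f) z :=
    (h.contDiffAt_lineProj (Or.inl rfl) hz).differentiableAt (by simp)
  have d2 : DifferentiableAt ℝ (lineProj (-I) f) z :=
    (h.contDiffAt_lineProj (Or.inr rfl) hz).differentiableAt (by simp)
  have e0 : fderiv ℝ (fun y => rankOne ℂ (f y) (f y)) z v =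
      rankOne ℂ (fderiv ℝ f z v) (f z) + rankOne ℂ (f z) (fderiv ℝ f z v) := by
    rw [add_comm]
    exact fderiv_bilin (B := fun u v : V => rankOne ℂ u v) isBoundedBilinearMap_rankOne
      hl.differentiableAt hl.differentiableAt v
  have eP : fderiv ℝ (fun x => (q x).W.starProjection) z v =
      fderiv ℝ (fun y => rankOne ℂ (f y) (f y)) z v + fderiv ℝ (lineProj I f) z v := by
    rw [(h.eventuallyEq_proj hz).fderiv_eq, fderiv_fun_add d0 d1, add_apply]
  -- The three projections sum to `1`, so their derivatives sum to zero and `-P' (1 - P)` becomes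
  -- the third term. The correction term of `projRep` drops out since `f` is horizontal.
  have e1 : fderiv ℝ (fun y => rankOne ℂ (f y) (f y)) z v + fderiv ℝ (lineProj I f) z v +
      fderiv ℝ (lineProj (-I) f) z v = 0 := by
    have e : (fun x => rankOne ℂ (f x) (f x) + lineProj I f x + lineProj (-I) f x) =ᶠ[nhds z]
        fun _ => 1 := h.eventually_of_forall hz fun x hx => h.rankOne_add_lineProj hx
    have h1 : fderiv ℝ (fun x => rankOne ℂ (f x) (f x) + lineProj I f x + lineProj (-I) f x) z v =
        0 := by
      rw [e.fderiv_eq]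
      simp
    rw [fderiv_fun_add (d0.fun_add d1) d2, add_apply, fderiv_fun_add d0 d1, add_apply] at h1
    exact h1
  have hone := h.rankOne_add_lineProj hz
  rw [(h.eventuallyEq_w hz).fderiv_eq, h.w_eq z hz, projRep, eP, h.starProjection_eq hz,
    hl.inner_fderiv, zero_smul, add_zero, ← e0, add_sub_cancel_left, add_sub_cancel_left, ← hone,
    add_sub_cancel_left, sub_eq_add_neg, ← neg_mul, ← eq_neg_of_add_eq_zero_right e1]

lemma tangentRep_eq (v : ℂ) :
    op (tangentRep (q z) (fderiv ℝ (fun x => FL2.emb (q x)) z v)) =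
    fderiv ℝ (fun y => rankOne ℂ (f y) (f y)) z v * rankOne ℂ (f z) (f z) +
      fderiv ℝ (lineProj I f) z v * lineProj I f z +
      fderiv ℝ (lineProj (-I) f) z v * lineProj (-I) f z := by
  rw [tangentRep_fderiv (h.contDiffAt_emb hz), op_toMat, h.projRep_eq hz]

/-- The lift is harmonic. -/
theorem tension_eq_zero :
    fderiv ℝ (fun x => op (tangentRep (q x) (fderiv ℝ (fun x => FL2.emb (q x)) x 1))) z 1 +
      fderiv ℝ (fun x => op (tangentRep (q x) (fderiv ℝ (fun x => FL2.emb (q x)) x I))) z I =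
      0 := by
  have hs := h.smooth hz
  have s0 := contDiffAt_rankOne hs hs
  have s1 := h.contDiffAt_lineProj (Or.inl rfl) hz
  have s2 := h.contDiffAt_lineProj (Or.inr rfl) hz
  have d : ∀ {Q : ℂ → V →L[ℂ] V}, ContDiffAt ℝ ∞ Q z → ∀ v,
      DifferentiableAt ℝ (fun x => fderiv ℝ Q x v * Q x) z := by
    intro Q hQ v
    have h : Differentiable ℝ fun p : (V →L[ℂ] V) × (V →L[ℂ] V) => p.1 * p.2 := fun p =>
      isBoundedBilinearMap_mul_clm.differentiableAt p
    exact DifferentiableAt.comp z (h (fderiv ℝ Q z v, Q z))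
      ((differentiableAt_fderiv_apply hQ v).prodMk (hQ.differentiableAt (by simp)))
  have key : ∀ v, fderiv ℝ
      (fun x => op (tangentRep (q x) (fderiv ℝ (fun x => FL2.emb (q x)) x v))) z v =
      fderiv ℝ (fun x => fderiv ℝ (fun y => rankOne ℂ (f y) (f y)) x v * rankOne ℂ (f x) (f x)) z v
        + fderiv ℝ (fun x => fderiv ℝ (lineProj I f) x v * lineProj I f x) z v
        + fderiv ℝ (fun x => fderiv ℝ (lineProj (-I) f) x v * lineProj (-I) f x) z v := by
    intro v
    have e : (fun x => op (tangentRep (q x) (fderiv ℝ (fun x => FL2.emb (q x)) x v))) =ᶠ[nhds z]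
        fun x => fderiv ℝ (fun y => rankOne ℂ (f y) (f y)) x v * rankOne ℂ (f x) (f x) +
      fderiv ℝ (lineProj I f) x v * lineProj I f x +
      fderiv ℝ (lineProj (-I) f) x v * lineProj (-I) f x :=
      h.eventually_of_forall hz fun x hx => h.tangentRep_eq hx v
    rw [e.fderiv_eq, fderiv_fun_add ((d s0 v).fun_add (d s1 v)) (d s2 v),
      fderiv_fun_add (d s0 v) (d s1 v), add_apply, add_apply]
  have t0 := h.tension_rankOne hz
  have t1 := h.tension_lineProj (Or.inl rfl) hz
  have t2 := h.tension_lineProj (Or.inr rfl) hz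
  -- Each divergence is half a Laplacian, and the three projections sum to a constant.
  have tsum : Laplacian.laplacian (fun y => rankOne ℂ (f y) (f y)) z +
      Laplacian.laplacian (lineProj I f) z + Laplacian.laplacian (lineProj (-I) f) z = 0 := by
    have le : (2 : ℕ∞ω) ≤ ∞ := WithTop.coe_le_coe.2 (le_top : (2 : ℕ∞) ≤ ⊤)
    have e : ((fun x => rankOne ℂ (f x) (f x)) + lineProj I f + lineProj (-I) f) =ᶠ[nhds z]
        fun _ => 1 := h.eventually_of_forall hz fun x hx => h.rankOne_add_lineProj hx
    have h1 : Laplacian.laplacian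
        ((fun x => rankOne ℂ (f x) (f x)) + lineProj I f + lineProj (-I) f) z = 0 := by
      rw [(InnerProductSpace.laplacian_congr_nhds e).self_of_nhds]
      simp
    have s01 : ContDiffAt ℝ 2 ((fun x => rankOne ℂ (f x) (f x)) + lineProj I f) z :=
      (s0.of_le le).add (s1.of_le le)
    rw [s01.laplacian_add (s2.of_le le), (s0.of_le le).laplacian_add (s1.of_le le)] at h1
    exact h1
  rw [key, key]
  linear_combination (norm := module) t0 + t1 + t2 + (1 / 2 : ℂ) • tsum

/-- The lift is primitive. -/
theorem primitive : (1 / 2 : ℂ) • (tangentRep (q z) (fderiv ℝ (fun x => FL2.emb (q x)) z 1) -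
    I • tangentRep (q z) (fderiv ℝ (fun x => FL2.emb (q x)) z I)) ∈ bundleG1 (q z) := by
  obtain ⟨g, hg, g0, g1, g2⟩ := h.exists_adapted_frame hz
  have hs := h.smooth hz
  have F := h.isLegendrianFrame (Or.inl rfl) hz
  have hI : (I = I ∨ I = -I) := Or.inl rfl
  have hI' : (-I = I ∨ -I = -I) := Or.inr rfl
  set B : V →L[ℂ] V := wd I (fun y => rankOne ℂ (f y) (f y)) z * rankOne ℂ (f z) (f z) +
    wd I (lineProj I f) z * lineProj I f z + wd I (lineProj (-I) f) z * lineProj (-I) f z with hB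
  have hM : (1 / 2 : ℂ) • (tangentRep (q z) (fderiv ℝ (fun x => FL2.emb (q x)) z 1) -
      I • tangentRep (q z) (fderiv ℝ (fun x => FL2.emb (q x)) z I)) = toMat B := by
    apply op_injective
    have e : ∀ X Y : Mat, op ((1 / 2 : ℂ) • (X - I • Y)) = (1 / 2 : ℂ) • (op X - I • op Y) := by
      intro X Y
      simp only [op, map_smul, map_sub]
    rw [e, h.tangentRep_eq hz, h.tangentRep_eq hz, op_toMat, hB]
    simp only [wd, smul_mul_assoc, sub_mul]
    module
  have d1 : DifferentiableAt ℝ (lineProj I f) z :=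
    (h.contDiffAt_lineProj hI hz).differentiableAt (by simp)
  have d2 : DifferentiableAt ℝ (lineProj (-I) f) z :=
    (h.contDiffAt_lineProj hI' hz).differentiableAt (by simp)
  have n1 := h.lineProj_apply_neg hI' hz
  rw [neg_neg] at n1
  -- On each vector of the frame only the summand with the projection onto its own line acts; its
  -- value comes from differentiating `P_j s = s` for `s = ∂f`, `∂̄f`, and from the product rule for
  -- `f f^*`.
  have B0 : B (f z) = wd I f z := by
    have e : B (f z) = wd I (fun y => rankOne ℂ (f y) (f y)) z (rankOne ℂ (f z) (f z) (f z)) +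
      wd I (lineProj I f) z (lineProj I f z (f z)) +
      wd I (lineProj (-I) f) z (lineProj (-I) f z (f z)) := rfl
    rw [e, h.lineProj_apply_f hI hz, h.lineProj_apply_f hI' hz, InnerProductSpace.rankOne_apply,
      F.unit, one_smul, map_zero, map_zero, add_zero, add_zero, wd_rankOne I (h.diff hz) (h.diff hz),
      conj_I, add_apply, InnerProductSpace.rankOne_apply, InnerProductSpace.rankOne_apply, F.unit,
      inner_eq_zero_symm.1 F.ft, one_smul, zero_smul, add_zero]
  obtain ⟨μ, hμ⟩ := h.exists_wd_wd_self hI hz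
  have B1 : B (wd I f z) = μ • wd (-I) f z := by
    have e : B (wd I f z) =
      wd I (fun y => rankOne ℂ (f y) (f y)) z (rankOne ℂ (f z) (f z) (wd I f z)) +
      wd I (lineProj I f) z (lineProj I f z (wd I f z)) +
      wd I (lineProj (-I) f) z (lineProj (-I) f z (wd I f z)) := rfl
    have e1 : (fun x => lineProj I f x (wd I f x)) =ᶠ[nhds z] wd I f :=
      h.eventually_of_forall hz fun x hx => h.lineProj_apply_self hI hx
    have h1 := wd_congr I e1
    rw [wd_apply I d1 (h.diff_wd hz I), hμ, map_add, map_smul, map_smul,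
      h.lineProj_apply_self hI hz, h.lineProj_apply_neg hI hz] at h1
    rw [e, h.lineProj_apply_self hI hz, n1, InnerProductSpace.rankOne_apply, F.fs]
    rw [zero_smul, map_zero, map_zero, zero_add, add_zero]
    linear_combination (norm := module) h1
  have B2 : B (wd (-I) f z) = -inner ℂ (wd I f z) (wd I f z) • f z := by
    have e : B (wd (-I) f z) =
      wd I (fun y => rankOne ℂ (f y) (f y)) z (rankOne ℂ (f z) (f z) (wd (-I) f z)) +
      wd I (lineProj I f) z (lineProj I f z (wd (-I) f z)) +
      wd I (lineProj (-I) f) z (lineProj (-I) f z (wd (-I) f z)) := rfl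
    have e1 : (fun x => lineProj (-I) f x (wd (-I) f x)) =ᶠ[nhds z] wd (-I) f :=
      h.eventually_of_forall hz fun x hx => h.lineProj_apply_self hI' hx
    have h1 := wd_congr I e1
    rw [wd_apply I d2 (h.diff_wd hz (-I)), h.wd_wd hI hz, map_smul, h.lineProj_apply_f hI' hz,
      smul_zero, add_zero] at h1
    rw [e, h.lineProj_apply_self hI' hz, h.lineProj_apply_neg hI hz,
      InnerProductSpace.rankOne_apply, F.ft, zero_smul, map_zero, map_zero, zero_add, zero_add, h1]
  have hn := F.norm_ne_zero
  rw [hM]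
  -- The repeated entry is `|∂f|`. The entry `(2,1)` is minus the `∂̄f` coefficient of `∂∂f`, the
  -- sign being that of `e₂ = -∂̄f/|∂f|`.
  refine ⟨g, hg, (mem_gPart_one_iff _).2 ⟨‖wd I f z‖, -μ, ?_⟩⟩
  have f0 : B (frame g 0) = (‖wd I f z‖ : ℂ) • frame g 1 := by
    rw [g0, B0, g1, smul_smul, mul_inv_cancel₀ hn, one_smul]
  have f1 : B (frame g 1) = -μ • frame g 2 := by
    rw [g1, map_smul, B1, g2]
    module
  have f2 : B (frame g 2) = (‖wd I f z‖ : ℂ) • frame g 0 := by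
    rw [g2, map_smul, B2, g0, inner_self_eq_mul_norm, smul_smul]
    congr 1
    field_simp
  ext i j
  rw [inv_mul_mul_apply, op_toMat]
  fin_cases j
  · change inner ℂ (frame g i) (B (frame g 0)) = _
    rw [f0, inner_smul_right, inner_frame]
    fin_cases i <;> simp
  · change inner ℂ (frame g i) (B (frame g 1)) = _
    rw [f1, inner_smul_right, inner_frame]
    fin_cases i <;> simp
  · change inner ℂ (frame g i) (B (frame g 2)) = _
    rw [f2, inner_smul_right, inner_frame]
    fin_cases i <;> simp

end IsLiftOn

end

/-! ### Changes of holomorphic coordinates -/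

section

section Charts
variable {M : Type*} [TopologicalSpace M] {F : Type*} [NormedAddCommGroup F]
  [NormedSpace ℂ F] {c c' : OpenPartialHomeomorph M ℂ} {z : ℂ} {h : M → F}

lemma fderiv_comp_holomorphic {s : ℂ → F} {τ : ℂ → ℂ} (hs : DifferentiableAt ℝ s (τ z))
    (hτ : DifferentiableAt ℂ τ z) (v : ℂ) :
    fderiv ℝ (s ∘ τ) z v = fderiv ℝ s (τ z) (deriv τ z * v) := by
  rw [fderiv_comp z hs (hτ.restrictScalars ℝ), ContinuousLinearMap.comp_apply,
    (hτ.hasFDerivAt.restrictScalars ℝ).fderiv, ContinuousLinearMap.coe_restrictScalars',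
    fderiv_eq_smul_deriv, smul_eq_mul, mul_comm]

/-- For holomorphic `τ` the chain rule does not mix `∂` and `∂̄`. Hence the line of `∂f` is
independent of the coordinate. -/
lemma wd_comp_holomorphic {s : ℂ → F} {τ : ℂ → ℂ} (hs : DifferentiableAt ℝ s (τ z))
    (hτ : DifferentiableAt ℂ τ z) :
    wd I (s ∘ τ) z = deriv τ z • wd I s (τ z) ∧
      wd (-I) (s ∘ τ) z = (starRingEnd ℂ) (deriv τ z) • wd (-I) s (τ z) := by
  obtain ⟨x, y, hxy⟩ : ∃ x y : ℝ, deriv τ z = x + y * I := ⟨_, _, (re_add_im _).symm⟩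
  have h1 : fderiv ℝ (s ∘ τ) z 1 =
      (x : ℂ) • fderiv ℝ s (τ z) 1 + (y : ℂ) • fderiv ℝ s (τ z) I := by
    rw [fderiv_comp_holomorphic hs hτ, fderiv_eq_re_im, hxy]
    simp
  have h2 : fderiv ℝ (s ∘ τ) z I =
      (-y : ℂ) • fderiv ℝ s (τ z) 1 + (x : ℂ) • fderiv ℝ s (τ z) I := by
    rw [fderiv_comp_holomorphic hs hτ, fderiv_eq_re_im, hxy]
    simp
  simp only [wd, h1, h2, hxy, map_add, map_mul, conj_ofReal, conj_I]
  generalize fderiv ℝ s (τ z) 1 = X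
  generalize fderiv ℝ s (τ z) I = Y
  constructor <;> match_scalars
  · ring
  · linear_combination (y / 2 : ℂ) * I_mul_I
  · ring
  · linear_combination (y / 2 : ℂ) * I_mul_I

section
variable (hz : z ∈ c.target) (hz' : c.symm z ∈ c'.source)
include hz hz'

lemma eventually_transition_mem : ∀ᶠ x in nhds z, x ∈ c.target ∧ c.symm x ∈ c'.source :=
  (c.open_target.eventually_mem hz).and
    ((c.continuousAt_symm hz).preimage_mem_nhds (c'.open_source.mem_nhds hz'))

lemma inChart_eventuallyEq {Y : Type*} (h : M → Y) :
    inChart c h =ᶠ[nhds z] inChart c' h ∘ (c' ∘ c.symm) :=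
  (eventually_transition_mem hz hz').mono fun x hx => by
    simp only [inChart, Function.comp_apply]
    rw [c'.left_inv hx.2]

variable [ChartedSpace ℂ M] [IsManifold 𝓘(ℂ, ℂ) ω M] (hc : c ∈ atlas ℂ M) (hc' : c' ∈ atlas ℂ M)
include hc hc'

lemma contDiffAt_transition : ContDiffAt ℂ ω (c' ∘ c.symm) z := by
  have h1 := ((contDiffGroupoid ω 𝓘(ℂ, ℂ)).compatible hc hc').1
  have h2 : ContDiffOn ℂ ω (c' ∘ c.symm) (c.symm ≫ₕ c').source := by
    simpa [contDiffPregroupoid] using h1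
  exact h2.contDiffAt ((c.symm ≫ₕ c').open_source.mem_nhds (by simp [hz, hz']))

lemma differentiableAt_transition : DifferentiableAt ℂ (c' ∘ c.symm) z :=
  (contDiffAt_transition hz hz' hc hc').differentiableAt (by simp)

lemma deriv_transition_ne_zero : deriv (c' ∘ c.symm) z ≠ 0 := by
  have hw : c'.symm ((c' ∘ c.symm) z) = c.symm z := c'.left_inv hz'
  have h1 := differentiableAt_transition hz hz' hc hc'
  have h2 := differentiableAt_transition (c := c') (c' := c) (z := (c' ∘ c.symm) z)
    (c'.map_source hz') (by rw [hw]; exact c.map_target hz) hc' hc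
  have e : (c ∘ c'.symm) ∘ (c' ∘ c.symm) =ᶠ[nhds z] id :=
    (eventually_transition_mem hz hz').mono fun x hx => by
      simp only [Function.comp_apply, id]
      rw [c'.left_inv hx.2, c.right_inv hx.1]
  have h3 := e.deriv_eq
  rw [deriv_comp z h2 h1, deriv_id] at h3
  exact fun h0 => by simp [h0] at h3

end

variable [ChartedSpace ℂ M]

/-- Manifold smoothness speaks of preferred charts; the holomorphic transition maps carry it to
every chart of the atlas. -/
lemma IsSmooth.contDiffAt [IsManifold 𝓘(ℂ, ℂ) ω M] (hh : IsSmooth h) (hc : c ∈ atlas ℂ M)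
    (hz : z ∈ c.target) : ContDiffAt ℝ ∞ (inChart c h) z := by
  have h1 := (contMDiffAt_iff.1 (hh (c.symm z))).2
  simp only [mfld_simps] at h1
  rw [contDiffWithinAt_univ] at h1
  have hz' := mem_chart_source ℂ (c.symm z)
  have h2 : ContDiffAt ℝ ∞ (inChart (chartAt ℂ (c.symm z)) h ∘ (chartAt ℂ (c.symm z) ∘ c.symm)) z :=
    ContDiffAt.comp z (by exact h1)
      (((contDiffAt_transition hz hz' hc (chart_mem_atlas ℂ _)).restrict_scalars ℝ).of_le (by simp))
  exact h2.congr_of_eventuallyEq (inChart_eventuallyEq hz hz' h)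

lemma isSmooth_of_inChart
    (hh : ∀ p : M, ContDiffAt ℝ ∞ (inChart (chartAt ℂ p) h) (chartAt ℂ p p)) : IsSmooth h := by
  intro p
  refine contMDiffAt_iff.2 ⟨?_, ?_⟩
  · have h1 : ContinuousAt (inChart (chartAt ℂ p) h ∘ chartAt ℂ p) p :=
      (hh p).continuousAt.comp ((chartAt ℂ p).continuousAt (mem_chart_source ℂ p))
    refine h1.congr ?_
    filter_upwards [(chartAt ℂ p).open_source.mem_nhds (mem_chart_source ℂ p)] with x hx
    simp only [inChart, Function.comp_apply]
    rw [(chartAt ℂ p).left_inv hx]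
  · simp only [mfld_simps]
    rw [contDiffWithinAt_univ]
    exact hh p

section
variable [IsManifold 𝓘(ℂ, ℂ) ω M] (hh : IsSmooth h) (hz : z ∈ c.target) (hz' : c.symm z ∈ c'.source)
  (hc : c ∈ atlas ℂ M) (hc' : c' ∈ atlas ℂ M)
include hh hz hz' hc hc'

lemma wd_inChart : wd I (inChart c h) z =
    deriv (c' ∘ c.symm) z • wd I (inChart c' h) (c' (c.symm z)) := by
  rw [wd_congr I (inChart_eventuallyEq hz hz' h)]
  exact (wd_comp_holomorphic ((hh.contDiffAt hc' (c'.map_source hz')).differentiableAt (by simp))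
    (differentiableAt_transition hz hz' hc hc')).1

lemma wd_neg_inChart : wd (-I) (inChart c h) z =
    (starRingEnd ℂ) (deriv (c' ∘ c.symm) z) • wd (-I) (inChart c' h) (c' (c.symm z)) := by
  rw [wd_congr (-I) (inChart_eventuallyEq hz hz' h)]
  exact (wd_comp_holomorphic
    ((hh.contDiffAt hc' (c'.map_source hz')).differentiableAt (by simp))
    (differentiableAt_transition hz hz' hc hc')).2

end

end Charts

end

/-! ### Horizontal lifts satisfy the Legendrian equations -/

section

section Lift
variable {f : ℂ → V} {U : Set ℂ} {z : ℂ}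

lemma fderiv_rankOne_apply_of_horizontal (hs : ContDiffAt ℝ ∞ f z)
    (hu : inner ℂ (f z) (f z) = 1) (hh : ∀ v, inner ℂ (f z) (fderiv ℝ f z v) = 0) (v : ℂ) :
    fderiv ℝ (fun x => rankOne ℂ (f x) (f x)) z v (f z) = fderiv ℝ f z v := by
  have d : DifferentiableAt ℝ f z := hs.differentiableAt (by simp)
  rw [fderiv_bilin (B := fun u v : V => rankOne ℂ u v) isBoundedBilinearMap_rankOne d d, add_apply,
    InnerProductSpace.rankOne_apply, InnerProductSpace.rankOne_apply,
    inner_eq_zero_symm.1 (hh v), hu, zero_smul, zero_add, one_smul]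

lemma inner_wd_of_horizontal (hh : ∀ v, inner ℂ (f z) (fderiv ℝ f z v) = 0) (c : ℂ) :
    inner ℂ (f z) (wd c f z) = 0 := by
  rw [wd, inner_smul_right, inner_sub_right, inner_smul_right, hh, hh, mul_zero, sub_zero, mul_zero]

/-- A horizontal lift of a conformal harmonic Lagrangian map is conformal and harmonic. -/
theorem isLegendrianAt_of_lift (hU : IsOpen U) (hs : ∀ x ∈ U, ContDiffAt ℝ ∞ f x)
    (hu : ∀ x ∈ U, inner ℂ (f x) (f x) = 1)
    (hh : ∀ x ∈ U, ∀ v, inner ℂ (f x) (fderiv ℝ f x v) = 0) (hz : z ∈ U)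
    (hang : inner ℂ (fderiv ℝ f z 1) (fderiv ℝ f z I) = 0)
    (hnorm : ‖fderiv ℝ f z 1‖ = ‖fderiv ℝ f z I‖)
    (hharm : Laplacian.laplacian (fun x => rankOne ℂ (f x) (f x)) z (f z) ∈ ℂ ∙ f z) :
    IsLegendrianAt f z := by
  have hsz := hs z hz
  have d : ∀ {g : ℂ → V}, ContDiffAt ℝ ∞ g z → DifferentiableAt ℝ g z := fun hg =>
    hg.differentiableAt (by simp)
  have s1 := contDiffAt_wd I hsz
  have s2 := contDiffAt_wd (-I) hsz
  have hang' := inner_eq_zero_symm.1 hang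
  have hN : inner ℂ (fderiv ℝ f z 1) (fderiv ℝ f z 1) =
      inner ℂ (fderiv ℝ f z I) (fderiv ℝ f z I) := by
    rw [inner_self_eq_mul_norm, inner_self_eq_mul_norm, hnorm]
  have i1 := inner_wd_of_horizontal (hh z hz) I
  have i2 := inner_wd_of_horizontal (hh z hz) (-I)
  have i12 : inner ℂ (wd I f z) (wd (-I) f z) = 0 := by
    simp only [wd, inner_smul_left, inner_smul_right, inner_sub_left, inner_sub_right, hang, hang',
      hN, conj_I]
    linear_combination (1 / 2 * (starRingEnd ℂ) (1 / 2) *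
      inner ℂ (fderiv ℝ f z I) (fderiv ℝ f z I)) * I_mul_I
  have hn : inner ℂ (wd I f z) (wd I f z) = inner ℂ (wd (-I) f z) (wd (-I) f z) := by
    simp only [wd, inner_smul_left, inner_smul_right, inner_sub_left, inner_sub_right, hang, hang',
      map_neg, conj_I]
    ring
  refine ⟨hsz, hu z hz, i1, i2, i12, hn, ?_⟩
  have e : wd (-I) (fun x => rankOne ℂ (f x) (f x)) =ᶠ[nhds z] fun x =>
      rankOne ℂ (wd (-I) f x) (f x) + rankOne ℂ (f x) (wd I f x) := by
    filter_upwards [hU.mem_nhds hz] with x hx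
    have dx : DifferentiableAt ℝ f x := (hs x hx).differentiableAt (by simp)
    rw [wd_rankOne _ dx dx, map_neg, conj_I, neg_neg]
  rw [laplacian_eq_wd (contDiffAt_rankOne hsz hsz) I_mul_I, wd_congr I e,
    wd_add I ((contDiffAt_rankOne s2 hsz).differentiableAt (by simp))
      ((contDiffAt_rankOne hsz s1).differentiableAt (by simp)),
    wd_rankOne I (d s2) (d hsz), wd_rankOne I (d hsz) (d s1), conj_I] at hharm
  have z1 : inner ℂ (wd I f z) (f z) = 0 := inner_eq_zero_symm.1 i1
  have z2 : inner ℂ (wd (-I) f z) (f z) = 0 := inner_eq_zero_symm.1 i2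
  simp only [smul_apply, add_apply, InnerProductSpace.rankOne_apply, z1, z2, hu z hz,
    zero_smul, add_zero, zero_add, one_smul] at hharm
  obtain ⟨a, ha⟩ := Submodule.mem_span_singleton.1 hharm
  set b := inner ℂ (wd (-I) (wd I f) z) (f z)
  -- Harmonicity of `φ` yields only that `∂∂̄f` is proportional to `f`. The factor is found below by
  -- applying `∂` to `⟨f, ∂̄f⟩ = 0`, which gives `-|∂̄f|²`.
  have h1 : wd I (wd (-I) f) z = (a / 4 - b) • f z := by
    linear_combination (norm := module) (-1 / 4 : ℂ) • ha
  have e2 : (fun x => inner ℂ (f x) (wd (-I) f x)) =ᶠ[nhds z] fun _ => 0 := by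
    filter_upwards [hU.mem_nhds hz] with x hx
    exact inner_wd_of_horizontal (hh x hx) (-I)
  have h2 := wd_congr I e2
  rw [wd_const, wd_inner I (d hsz) (d s2), conj_I, h1, inner_smul_right, hu z hz, mul_one] at h2
  rw [h1, hn]
  congr 1
  linear_combination h2

end Lift

end

/-! ### Global maps on `M` and the converse statement -/

section

variable {M : Type*} [TopologicalSpace M]

lemma inChart_ofCP2_hopf (f : M → S5) (c : OpenPartialHomeomorph M ℂ) :
    inChart c (ofCP2 fun p => hopf (f p)) =
      fun x => rankOne ℂ (inChart c (ofS5 f) x) (inChart c (ofS5 f) x) :=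
  funext fun _ => emb_hopf _

variable [ChartedSpace ℂ M]

/-- `f : M → S⁵` is a weakly conformal harmonic horizontal map. -/
def IsLegendrianMap (f : M → S5) : Prop :=
  ∀ c ∈ atlas ℂ M, ∀ z ∈ c.target, IsLegendrianAt (inChart c (ofS5 f)) z

namespace IsLegendrianMap
variable {f : M → S5} (h : IsLegendrianMap f)
include h

lemma isSmooth : IsSmooth (ofS5 f) :=
  isSmooth_of_inChart fun p =>
    (h _ (chart_mem_atlas ℂ p) _ (mem_chart_target ℂ p)).smooth

theorem isConformalHarmonicLegendrian : IsConformalHarmonicLegendrian f where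
  smooth := h.isSmooth
  horizontal c hc z hz := (h c hc z hz).inner_fderiv
  conformal c hc z hz :=
    ⟨(h c hc z hz).norm_fderiv_eq, by rw [(h c hc z hz).inner_fderiv_fderiv]; rfl⟩
  harmonic c hc z hz v hv := by
    rw [(h c hc z hz).laplacian_eq, inner_self_eq_mul_norm, inner_smul_right]
    set r := ‖wd I (inChart c (ofS5 f)) z‖
    have : -(4 * ((r : ℂ) * r)) = ((-(4 * (r * r)) : ℝ) : ℂ) := by push_cast; ring
    rw [this, re_ofReal_mul, hv, mul_zero]

theorem isConformalHarmonicLagrangian :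
    IsConformalHarmonicLagrangian (fun p => hopf (f p)) where
  smooth := isSmooth_of_inChart fun p => by
    have := (h _ (chart_mem_atlas ℂ p) _ (mem_chart_target ℂ p)).smooth
    rw [inChart_ofCP2_hopf]
    exact contDiffAt_rankOne this this
  lagrangian c hc z hz u hu := by
    have hu' := (submodule_hopf (f (c.symm z))).le hu
    have hl := h c hc z hz
    rw [inChart_ofCP2_hopf, hl.fderiv_rankOne_apply 1 hu', hl.fderiv_rankOne_apply I hu',
      inner_smul_left, inner_smul_right, hl.inner_fderiv_fderiv, mul_zero, mul_zero]
    rfl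
  conformal c hc z hz u hu := by
    have hu' := (submodule_hopf (f (c.symm z))).le hu
    have hl := h c hc z hz
    rw [inChart_ofCP2_hopf, hl.fderiv_rankOne_apply 1 hu', hl.fderiv_rankOne_apply I hu',
      inner_smul_left, inner_smul_right, hl.inner_fderiv_fderiv, mul_zero, mul_zero, norm_smul,
      norm_smul, hl.norm_fderiv_eq]
    exact ⟨rfl, rfl⟩
  harmonic c hc z hz u hu := by
    have hu' := (submodule_hopf (f (c.symm z))).le hu
    rw [inChart_ofCP2_hopf]
    exact (submodule_hopf (f (c.symm z))).ge ((h c hc z hz).laplacian_rankOne_apply hu')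

end IsLegendrianMap

variable [IsManifold 𝓘(ℂ, ℂ) ω M]

lemma IsPrimitive.isLegendrianMap {ψ : M → FL2} (h : IsPrimitive ψ) :
    IsLegendrianMap fun p => (ψ p).w := fun c hc _ hz =>
  isLegendrianAt_of_primitive (q := inChart c ψ) c.open_target
    (fun _ hx => h.smooth.contDiffAt hc hx) (fun x hx => h.primitive c hc x hx) hz

/-- The first component of a primitive map is a weakly conformal harmonic Legendrian map. -/
theorem IsPrimitive.converse {ψ : M → FL2} (h : IsPrimitive ψ) :
    IsConformalHarmonicLegendrian (fun p => (ψ p).w) ∧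
    IsConformalHarmonicLagrangian (fun p => hopf (ψ p).w) ∧
    (∀ c ∈ atlas ℂ M, ∀ z ∈ c.target,
      fderiv ℝ (inChart c fun p => ((ψ p).w : V)) z ≠ 0 →
      Function.Injective (fderiv ℝ (inChart c fun p => ((ψ p).w : V)) z) ∧
      Function.Injective (fderiv ℝ (inChart c fun p => CP2.emb (hopf (ψ p).w)) z)) ∧
    (IsImmersive (fun p => ((ψ p).w : V)) →
      IsMinimalLegendrian (fun p => (ψ p).w) ∧ IsMinimalLagrangian (fun p => hopf (ψ p).w)) := by
  have hl := h.isLegendrianMap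
  have hinj : ∀ c ∈ atlas ℂ M, ∀ z ∈ c.target,
      fderiv ℝ (inChart c fun p => ((ψ p).w : V)) z ≠ 0 →
      Function.Injective (fderiv ℝ (inChart c fun p => ((ψ p).w : V)) z) ∧
      Function.Injective (fderiv ℝ (inChart c fun p => CP2.emb (hopf (ψ p).w)) z) := by
    intro c hc z hz hne
    refine ⟨(hl c hc z hz).fderiv_injective hne, ?_⟩
    have := (hl c hc z hz).fderiv_rankOne_injective hne
    rwa [← inChart_ofCP2_hopf] at this
  refine ⟨hl.isConformalHarmonicLegendrian, hl.isConformalHarmonicLagrangian, hinj, fun him =>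
    ⟨⟨hl.isConformalHarmonicLegendrian, him⟩, ⟨hl.isConformalHarmonicLagrangian, ?_⟩⟩⟩
  intro c hc z hz
  refine (hinj c hc z hz fun h0 => ?_).2
  have := him c hc z hz
  rw [h0] at this
  exact one_ne_zero (this (a₁ := 1) (a₂ := 0) rfl)

end

section

/-! ### The second bundle of the harmonic sequence -/

/-- A section is `⟨F, s⟩ F`. The derivative of its coefficient contributes along `F` and is
projected away, and `∂F` is already orthogonal to `F`. -/
lemma nextBundle_eq_span {ℓ : ℂ → Submodule ℂ V} {F : ℂ → V} {z : ℂ} (hℓ : ∀ x, ℓ x = ℂ ∙ F x)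
    (hF : IsLegendrianAt F z) (hunit : ∀ x, inner ℂ (F x) (F x) = 1) :
    nextBundle ℓ z = ℂ ∙ wd I F z := by
  have p0 : ∀ u ∈ ℓ z, (ℓ z)ᗮ.starProjection u = 0 := fun u hu => by
    rw [Submodule.starProjection_orthogonal', sub_apply, Submodule.starProjection_eq_self_iff.2 hu]
    exact sub_self _
  have p1 : (ℓ z)ᗮ.starProjection (wd I F z) = wd I F z := by
    rw [Submodule.starProjection_eq_self_iff, hℓ, Submodule.mem_orthogonal_singleton_iff_inner_right]
    exact hF.inner_dz
  have hFz : F z ∈ ℓ z := (hℓ z).ge (Submodule.mem_span_singleton_self _)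
  apply le_antisymm
  · refine Submodule.span_le.2 ?_
    rintro _ ⟨s, hs, hmem, rfl⟩
    have e : s =ᶠ[nhds z] fun x => inner ℂ (F x) (s x) • F x := by
      filter_upwards [hmem] with x hx
      rw [hℓ] at hx
      obtain ⟨a, ha⟩ := Submodule.mem_span_singleton.1 hx
      rw [← ha, inner_smul_right, hunit, mul_one]
    rw [dz_eq_wd, wd_congr I e,
      wd_smul I ((contDiffAt_inner hF.smooth hs).differentiableAt (by simp)) hF.differentiableAt,
      map_add, map_smul, map_smul, p0 _ hFz, p1, smul_zero, zero_add]
    exact Submodule.smul_mem _ _ (Submodule.mem_span_singleton_self _)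
  · rw [Submodule.span_singleton_le_iff_mem]
    refine Submodule.subset_span ⟨F, hF.smooth, .of_forall fun x => ?_, ?_⟩
    · rw [hℓ]; exact Submodule.mem_span_singleton_self _
    · rw [dz_eq_wd, p1]

lemma finrank_sup_span_of_inner_eq_zero {u v : V} (hu : u ≠ 0) (hv : v ≠ 0)
    (huv : inner ℂ u v = 0) : finrank ℂ ((ℂ ∙ u) ⊔ (ℂ ∙ v) : Submodule ℂ V) = 2 := by
  have h1 : LinearIndependent ℂ ![u, v] := by
    rw [LinearIndependent.pair_iff]
    intro a b hab
    have h1 := congrArg (fun w => inner ℂ u w) hab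
    have h2 := congrArg (fun w => inner ℂ v w) hab
    simp only [inner_add_right, inner_smul_right, huv, inner_eq_zero_symm.1 huv, inner_zero_right,
      mul_zero, add_zero, zero_add] at h1 h2
    exact ⟨(mul_eq_zero.1 h1).resolve_right (inner_self_ne_zero.2 hu),
      (mul_eq_zero.1 h2).resolve_right (inner_self_ne_zero.2 hv)⟩
  have h2 := finrank_span_eq_card h1
  have h3 : Set.range ![u, v] = {u, v} := by
    simp [Matrix.range_cons, Set.pair_comm]
  rwa [h3, Submodule.span_insert, Fintype.card_fin] at h2

variable {M : Type*} [TopologicalSpace M]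

lemma inner_ofS5 (f : M → S5) (c : OpenPartialHomeomorph M ℂ) (z : ℂ) :
    inner ℂ (inChart c (ofS5 f) z) (inChart c (ofS5 f) z) = 1 := by
  simp [inChart, inner_self_eq_norm_sq_to_K]

variable [ChartedSpace ℂ M]

/-- The determinant is cubic in `a`, while `|∂f|²` only sees `|a| = 1`. -/
lemma phase_const_smul {F : ℂ → V} {z : ℂ} (hF : DifferentiableAt ℝ F z) {a : ℂ} (ha : ‖a‖ = 1) :
    phase (fun x => a • F x) z = a ^ 3 * phase F z := by
  have h1 : (starRingEnd ℂ) a * a = 1 := by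
    rw [conj_mul', ha]; simp
  rw [phase, phase, wd_const_smul I a hF, wd_const_smul (-I) a hF, det3_smul, inner_smul_left,
    inner_smul_right, ← mul_assoc, h1, one_mul]
  ring

/-! ### The Lagrangian angle on `M` and the primitive harmonic lift -/

section
variable [IsManifold 𝓘(ℂ, ℂ) ω M] {φ : M → CP2} {f : M → S5}

lemma IsHorizontalLift.contDiffAt (hf : IsHorizontalLift φ f) {c : OpenPartialHomeomorph M ℂ}
    (hc : c ∈ atlas ℂ M) {z : ℂ} (hz : z ∈ c.target) : ContDiffAt ℝ ∞ (inChart c (ofS5 f)) z :=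
  hf.smooth.contDiffAt hc hz

/-- Evaluated on the unit vector `f` of the line, `dφ` is `df`, so the conformal and Lagrangian
conditions are the real and imaginary parts of `⟨f_x, f_y⟩ = 0`. -/
lemma isLegendrianMap_of_lift (hφ : IsConformalHarmonicLagrangian φ) (hf : IsHorizontalLift φ f) :
    IsLegendrianMap f := by
  obtain rfl : φ = fun p => hopf (f p) := funext fun p => (hf.lift p).symm
  intro c hc z hz
  have hu : inChart c (ofS5 f) z ∈ (inChart c (fun p => hopf (f p)) z).submodule :=
    (submodule_hopf (f (c.symm z))).ge (Submodule.mem_span_singleton_self _)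
  have hl := hφ.lagrangian c hc z hz _ hu
  have hcf := hφ.conformal c hc z hz _ hu
  have hh := (submodule_hopf (f (c.symm z))).le (hφ.harmonic c hc z hz _ hu)
  have key := fderiv_rankOne_apply_of_horizontal (hf.contDiffAt hc hz) (inner_ofS5 f c z)
    (hf.horizontal c hc z hz)
  rw [inChart_ofCP2_hopf] at hl hcf hh
  rw [key, key] at hl hcf
  exact isLegendrianAt_of_lift c.open_target (fun x hx => hf.contDiffAt hc hx)
    (fun x _ => inner_ofS5 f c x) (fun x hx => hf.horizontal c hc x hx) hz
    (Complex.ext hcf.2 hl) hcf.1 hh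

lemma isLegendrianOn_of_lift (hφ : IsMinimalLagrangian φ) (hf : IsHorizontalLift φ f)
    {c : OpenPartialHomeomorph M ℂ} (hc : c ∈ atlas ℂ M) :
    IsLegendrianOn (inChart c (ofS5 f)) c.target where
  isOpen := c.open_target
  legendrian := isLegendrianMap_of_lift hφ.toIsConformalHarmonicLagrangian hf c hc
  ne_zero z hz h0 := by
    have hl := isLegendrianMap_of_lift hφ.toIsConformalHarmonicLagrangian hf c hc z hz
    have hi := hφ.immersive c hc z hz
    obtain rfl : φ = fun p => hopf (f p) := funext fun p => (hf.lift p).symm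
    have h1 : fderiv ℝ (inChart c (ofS5 f)) z 1 = 0 := by
      rw [← inner_self_eq_zero (𝕜 := ℂ), hl.inner_fderiv_one, h0, inner_zero_right, mul_zero]
    have h2 : fderiv ℝ (inChart c (ofCP2 fun p => hopf (f p))) z 1 = 0 := by
      rw [inChart_ofCP2_hopf, fderiv_bilin (B := fun u v : V => rankOne ℂ u v)
        isBoundedBilinearMap_rankOne hl.differentiableAt hl.differentiableAt, h1, map_zero, map_zero,
        zero_apply, add_zero]
    exact one_ne_zero (hi (h2.trans (map_zero _).symm))

/-- The Lagrangian angle of `f` at `p`. -/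
def lagrangianAngle (f : M → S5) (p : M) : ℂ :=
  phase (inChart (chartAt ℂ p) (ofS5 f)) (chartAt ℂ p p)

/-- A change of coordinate multiplies `∂f` by `τ'` and `∂̄f` by its conjugate, so the determinant
and `|∂f|²` both acquire the factor `|τ'|²`. -/
lemma lagrangianAngle_eq (hs : IsSmooth (ofS5 f)) {c : OpenPartialHomeomorph M ℂ}
    (hc : c ∈ atlas ℂ M) {p : M} (hp : p ∈ c.source) :
    lagrangianAngle f p = phase (inChart c (ofS5 f)) (c p) := by
  have hz := mem_chart_target ℂ p
  have hp0 : (chartAt ℂ p).symm (chartAt ℂ p p) = p := (chartAt ℂ p).left_inv (mem_chart_source ℂ p)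
  have hz' : (chartAt ℂ p).symm (chartAt ℂ p p) ∈ c.source := by rwa [hp0]
  have h1 := wd_inChart hs hz hz' (chart_mem_atlas ℂ p) hc
  have h2 := wd_neg_inChart hs hz hz' (chart_mem_atlas ℂ p) hc
  have h3 := deriv_transition_ne_zero hz hz' (chart_mem_atlas ℂ p) hc
  have h0 : inChart (chartAt ℂ p) (ofS5 f) (chartAt ℂ p p) = inChart c (ofS5 f) (c p) := by
    simp only [inChart, Function.comp_apply]
    rw [hp0, c.left_inv hp]
  rw [hp0] at h1 h2
  set τ := deriv (c ∘ (chartAt ℂ p).symm) (chartAt ℂ p p)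
  have h4 : (starRingEnd ℂ) τ ≠ 0 := (map_ne_zero _).2 h3
  have h5 := det3_smul 1 τ ((starRingEnd ℂ) τ) (inChart c (ofS5 f) (c p))
    (wd I (inChart c (ofS5 f)) (c p)) (wd (-I) (inChart c (ofS5 f)) (c p))
  rw [one_smul, one_mul] at h5
  rw [lagrangianAngle, phase, phase, h0, h1, h2, h5, inner_smul_left, inner_smul_right, ← mul_assoc,
    mul_comm ((starRingEnd ℂ) τ) τ, mul_div_mul_left _ _ (mul_ne_zero h3 h4)]

lemma isLocallyConstant_lagrangianAngle (hφ : IsMinimalLagrangian φ) (hf : IsHorizontalLift φ f) :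
    IsLocallyConstant (lagrangianAngle f) := by
  rw [IsLocallyConstant.iff_eventually_eq]
  intro p
  have hc := chart_mem_atlas ℂ p
  have hp := mem_chart_source ℂ p
  have hL := isLegendrianOn_of_lift hφ hf hc
  have ho := hL.isOpen.isOpen_inter_preimage_of_fderiv_eq_zero (𝕜 := ℝ)
    (fun z hz => (hL.differentiableAt_phase hz).differentiableWithinAt)
    (fun z hz => hL.fderiv_phase hz) {lagrangianAngle f p}
  have hm := ho.mem_nhds ⟨mem_chart_target ℂ p, (rfl : lagrangianAngle f p = _)⟩
  filter_upwards [((chartAt ℂ p).continuousAt hp).preimage_mem_nhds hm,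
    (chartAt ℂ p).open_source.mem_nhds hp] with x hx hx'
  rw [lagrangianAngle_eq hf.smooth hc hx']
  exact hx.2

lemma isHorizontalLift_smul (hf : IsHorizontalLift φ f) {a : ℂ} {f' : M → S5}
    (hf' : ∀ p, (f' p : V) = a • (f p : V)) : IsHorizontalLift φ f' := by
  have e : ∀ c : OpenPartialHomeomorph M ℂ,
      inChart c (ofS5 f') = fun x => a • inChart c (ofS5 f) x := fun c => funext fun x => hf' _
  refine ⟨isSmooth_of_inChart fun p => ?_, fun p => ?_, fun c hc z hz v => ?_⟩
  · rw [e]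
    exact (hf.contDiffAt (chart_mem_atlas ℂ p) (mem_chart_target ℂ p)).const_smul a
  · rw [← hf.lift p]
    exact (Projectivization.mk_eq_mk_iff' ℂ _ _ _ _).2 ⟨a, (hf' p).symm⟩
  · rw [e, fderiv_fun_const_smul ((hf.contDiffAt hc hz).differentiableAt (by simp)),
      smul_apply, inner_smul_left, inner_smul_right, hf.horizontal c hc z hz v,
      mul_zero, mul_zero]

/-- A horizontal lift can be rotated by a constant phase to have Lagrangian angle `-1`. -/
lemma exists_lift_phase [ConnectedSpace M] (hφ : IsMinimalLagrangian φ)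
    (hf : IsHorizontalLift φ f) : ∃ f' : M → S5, IsHorizontalLift φ f' ∧
      (∃ a : ℂ, ‖a‖ = 1 ∧ ∀ p, (f' p : V) = a • (f p : V)) ∧
      ∀ c ∈ atlas ℂ M, ∀ z ∈ c.target, phase (inChart c (ofS5 f')) z = -1 := by
  obtain ⟨p₀⟩ := (inferInstance : Nonempty M)
  set θ := lagrangianAngle f p₀ with hθ
  have hph : ∀ c ∈ atlas ℂ M, ∀ z ∈ c.target, phase (inChart c (ofS5 f)) z = θ := by
    intro c hc z hz
    rw [hθ, (isLocallyConstant_lagrangianAngle hφ hf).apply_eq_of_preconnectedSpace p₀ (c.symm z),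
      lagrangianAngle_eq hf.smooth hc (c.map_target hz), c.right_inv hz]
  have hn : ‖θ‖ = 1 :=
    ((isLegendrianOn_of_lift hφ hf (chart_mem_atlas ℂ p₀)).isLegendrianFrame (Or.inl rfl)
      (mem_chart_target ℂ p₀)).norm_det3
  have hθ0 : θ ≠ 0 := fun h0 => by rw [h0, norm_zero] at hn; exact zero_ne_one hn
  -- The phase scales by `a³`, so reaching `-1` from `θ` requires `a³ = -θ⁻¹`.
  obtain ⟨a, ha⟩ := IsAlgClosed.exists_pow_nat_eq (-θ⁻¹) (n := 3) (by norm_num)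
  have han : ‖a‖ = 1 := by
    have := congrArg norm ha
    rw [norm_pow, norm_neg, norm_inv, hn, inv_one] at this
    exact (pow_eq_one_iff_of_nonneg (norm_nonneg a) (by norm_num)).1 this
  have hmem : ∀ p, a • (f p : V) ∈ Metric.sphere (0 : V) 1 := fun p => by
    rw [mem_sphere_zero_iff_norm, norm_smul, han, norm_eq_of_mem_sphere, mul_one]
  refine ⟨fun p => ⟨a • (f p : V), hmem p⟩, isHorizontalLift_smul hf fun _ => rfl,
    ⟨a, han, fun _ => rfl⟩, fun c hc z hz => ?_⟩
  have := phase_const_smul ((hf.contDiffAt hc hz).differentiableAt (by simp)) han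
  rw [hph c hc z hz, ha, neg_mul, inv_mul_cancel₀ hθ0] at this
  exact this

/-- The lift `(f, ℓ₀ ⊕ ℓ₁)` to `FL₂` of a minimal Lagrangian immersion is primitive and harmonic if
the horizontal lift `f` has Lagrangian angle `-1`. -/
theorem exists_primitive_harmonic_lift (hφ : IsMinimalLagrangian φ) (hf : IsHorizontalLift φ f)
    (hph : ∀ c ∈ atlas ℂ M, ∀ z ∈ c.target, phase (inChart c (ofS5 f)) z = -1) :
    ∃ ψ : M → FL2, (∀ p, (ψ p).w = f p ∧ (ψ p).W = ell0 φ p ⊔ ell1 φ p) ∧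
      IsPrimitive ψ ∧ IsHarmonicFL2 ψ := by
  have hL := fun {c : OpenPartialHomeomorph M ℂ} (hc : c ∈ atlas ℂ M) =>
    isLegendrianOn_of_lift hφ hf hc
  have h0 : ∀ p, ell0 φ p = ℂ ∙ (f p : V) := fun p => by
    rw [ell0, ← hf.lift p, submodule_hopf]
  have h1 : ∀ p, ell1 φ p = ℂ ∙ wd I (inChart (chartAt ℂ p) (ofS5 f)) (chartAt ℂ p p) := fun p =>
    nextBundle_eq_span (fun x => h0 _)
      ((hL (chart_mem_atlas ℂ p)).legendrian _ (mem_chart_target ℂ p)) (inner_ofS5 f _)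
  have hrank : ∀ p, finrank ℂ (ell0 φ p ⊔ ell1 φ p : Submodule ℂ V) = 2 := fun p => by
    rw [h0, h1]
    refine finrank_sup_span_of_inner_eq_zero (ne_zero_of_mem_unit_sphere (f p))
      ((hL (chart_mem_atlas ℂ p)).ne_zero _ (mem_chart_target ℂ p)) ?_
    have := ((hL (chart_mem_atlas ℂ p)).legendrian _ (mem_chart_target ℂ p)).inner_dz
    simp only [inChart, Function.comp_apply] at this
    rwa [(chartAt ℂ p).left_inv (mem_chart_source ℂ p)] at this
  let ψ : M → FL2 := fun p =>
    ⟨f p, ell0 φ p ⊔ ell1 φ p, hrank p,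
      Submodule.mem_sup_left ((h0 p).ge (Submodule.mem_span_singleton_self _))⟩
  have hψ : ∀ c ∈ atlas ℂ M, IsLiftOn (inChart c ψ) (inChart c (ofS5 f)) c.target := by
    intro c hc
    refine ⟨hL hc, fun _ _ => rfl, fun x hx => ?_, fun x hx => ?_⟩
    -- The bundle `ell1` is defined with the preferred chart at each point, hence the passage from
    -- `c` to that chart.
    · refine Submodule.mem_sup_right ?_
      rw [h1, wd_inChart hf.smooth hx (mem_chart_source ℂ (c.symm x)) hc (chart_mem_atlas ℂ _)]
      exact Submodule.smul_mem _ _ (Submodule.mem_span_singleton_self _)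
    · have h2 := hph c hc x hx
      rw [phase, div_eq_iff ((hL hc).inner_wd_self_ne_zero (Or.inl rfl) hx)] at h2
      rw [h2, neg_one_mul]
  have hsm : IsSmooth (ofFL2 ψ) := isSmooth_of_inChart fun p =>
    (hψ _ (chart_mem_atlas ℂ p)).contDiffAt_emb (mem_chart_target ℂ p)
  refine ⟨ψ, fun p => ⟨rfl, rfl⟩, ⟨hsm, fun c hc z hz => ?_, fun c hc z hz => ?_⟩,
    ⟨hsm, fun c hc z hz => ?_⟩⟩
  -- The first component of the lift is already an immersion.
  · have hne : fderiv ℝ (inChart c (ofS5 f)) z ≠ 0 := fun h => (hL hc).ne_zero z hz (by simp [wd, h])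
    have hi := ((hL hc).legendrian z hz).fderiv_injective hne
    intro u v huv
    have e := fderiv_emb ((hψ c hc).contDiffAt_emb hz)
    exact hi (congrArg Prod.fst ((e u).symm.trans (huv.trans (e v))))
  · exact (hψ c hc).primitive hz
  · exact (hψ c hc).tension_eq_zero hz

end

end

end MinLag

end

theorem mainTheorem3 :
    -- `FL₂ = SU₃/K₂` is a 6-symmetric space for `σ = μν`
    ((∀ q : MinLag.FL2, ∃ g : MinLag.SU3, MinLag.FL2.act g MinLag.FL2.base = q) ∧
      Commute MinLag.mu MinLag.nu ∧ orderOf MinLag.sigma = 6 ∧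
      ∀ g : MinLag.SU3,
        (MinLag.FL2.act g MinLag.FL2.base = MinLag.FL2.base ↔ MinLag.sigma g = g) ∧
        (MinLag.sigma g = g ↔
          ∃ a : ℂ, (g : MinLag.Mat) = Matrix.diagonal ![1, a, a⁻¹])) ∧
    ∀ (M : Type*) [TopologicalSpace M] [ChartedSpace ℂ M] [IsManifold 𝓘(ℂ, ℂ) ω M]
      [ConnectedSpace M],
      -- the primitive harmonic lift of a minimal Lagrangian immersion
      (∀ (φ : M → MinLag.CP2) (f : M → MinLag.S5),
        MinLag.IsMinimalLagrangian φ → MinLag.IsHorizontalLift φ f →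
        ∃ f' : M → MinLag.S5, MinLag.IsHorizontalLift φ f' ∧
          (∃ a : ℂ, ‖a‖ = 1 ∧ ∀ p, (f' p : MinLag.V) = a • (f p : MinLag.V)) ∧
          ∃ ψ : M → MinLag.FL2,
            (∀ p, (ψ p).w = f' p ∧ (ψ p).W = MinLag.ell0 φ p ⊔ MinLag.ell1 φ p) ∧
            MinLag.IsPrimitive ψ ∧ MinLag.IsHarmonicFL2 ψ) ∧
      -- the converse
      (∀ ψ : M → MinLag.FL2, MinLag.IsPrimitive ψ →
        MinLag.IsConformalHarmonicLegendrian (fun p => (ψ p).w) ∧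
        MinLag.IsConformalHarmonicLagrangian (fun p => MinLag.hopf (ψ p).w) ∧
        (∀ c ∈ atlas ℂ M, ∀ z ∈ c.target,
          fderiv ℝ (MinLag.inChart c fun p => ((ψ p).w : MinLag.V)) z ≠ 0 →
          Function.Injective (fderiv ℝ (MinLag.inChart c fun p => ((ψ p).w : MinLag.V)) z) ∧
          Function.Injective
            (fderiv ℝ (MinLag.inChart c fun p => MinLag.CP2.emb (MinLag.hopf (ψ p).w)) z)) ∧
        (MinLag.IsImmersive (fun p => ((ψ p).w : MinLag.V)) →
          MinLag.IsMinimalLegendrian (fun p => (ψ p).w) ∧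
          MinLag.IsMinimalLagrangian (fun p => MinLag.hopf (ψ p).w))) := by
  refine ⟨⟨MinLag.exists_act_base_eq, MinLag.commute_mu_nu, MinLag.orderOf_sigma, fun g =>
    ⟨(MinLag.act_base_eq_base_iff g).trans (MinLag.sigma_eq_self_iff g).symm,
      MinLag.sigma_eq_self_iff g⟩⟩, fun M _ _ _ _ => ⟨fun φ f hφ hf => ?_, fun ψ hψ => hψ.converse⟩⟩
  obtain ⟨f', hf', ha, hph⟩ := MinLag.exists_lift_phase hφ hf
  exact ⟨f', hf', ha, MinLag.exists_primitive_harmonic_lift hφ hf' hph⟩
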